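/- Let $\mathfrak h$ be a complex separable Hilbert space (inner product linear in the second variable), let $J:\mathfrak h\to\mathfrak h^*$, $J(x)(y)=(x,y)$, be the canonical anti-unitary map, and on the Hilbert space $\mathfrak h\oplus\mathfrak h^*$ put $$\mathcal S=\begin{pmatrix}1&0\\0&-1\end{pmatrix},\qquad \mathcal J=\begin{pmatrix}0&J^*\\J&0\end{pmatrix}.$$ Let $\mathcal F=\bigoplus_{N\ge 0}\bigotimes_{\rm sym}^N\mathfrak h$ be the bosonic Fock space over $\mathfrak h$ with the usual annihilation and creation operators $a(f)$, $a^*(f)$, and for $f,g\in\mathfrak h$ let $A(f\oplus Jg)=a(f)+a^*(g)$, understood as a closed operator on its natural domain: all $\psi\in\mathcal F$ for which $a(f)\psi+a^*(g)\psi$, computed particle number by particle number, belongs to $\mathcal F$. A (bosonic) Bogoliubov transformation is a bounded linear isomorphism $\mathcal V$ of $\mathfrak h\oplus\mathfrak h^*$ with $\mathcal J\mathcal V\mathcal J=\mathcal V$ and $\mathcal V^*\mathcal S\mathcal V=\mathcal S$. It is unitarily implementable if there is a unitary $U:\mathcal F\to\mathcal F$ with $A(\mathcal VF)=U\,A(F)\,U^*$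 for all $F\in\mathfrak h\oplus\mathfrak h^*$. Theorem (Diagonalization of 1-pdm's by Bogoliubov transformations). Let $\gamma:\mathfrak h\to\mathfrak h$ and $\alpha:\mathfrak h^*\to\mathfrak h$ be bounded linear operators such that $$\Gamma=\begin{pmatrix}\gamma&\alpha\\ J\alpha J&1+J\gamma J^*\end{pmatrix}\ge 0\quad\text{on }\mathfrak h\oplus\mathfrak h^*,\qquad \operatorname{Tr}\gamma<\infty,$$ and let $\{u_n\}$ be any orthonormal basis of $\mathfrak h$ (finite or infinite). Then there are a unitarily implementable Bogoliubov transformation $\mathcal V$ and real numbers $\lambda_n$ such that, for all $n$, $$\mathcal V^*\Gamma\mathcal V\,(u_n\oplus 0)=\lambda_n\,(u_n\oplus 0),\qquad \mathcal V^*\Gamma\mathcal V\,(0\oplus Ju_n)=(1+\lambda_n)\,(0\oplus Ju_n),$$ that is, $\mathcal V^*\Gamma\mathcal V=\operatorname{diag}(\lambda_1,\lambda_2,\dots,1+\lambda_1,1+\lambda_2,\dots)$ in the orthonormal basis $\{u_n\oplus0\}\cup\{0\oplus Ju_n\}$. Moreover $\lambda_n\ge0$ for all $n$ and $\sum_n\lambda_n<\infty$.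 -/

import Mathlib

open scoped InnerProductSpace TensorProduct ComplexOrder

namespace BoseFock

noncomputable section

universe u

/-! ## The doubled one-particle space `h ⊕ h*` -/

section Doubled

variable (H : Type u) [NormedAddCommGroup H] [InnerProductSpace ℂ H] [CompleteSpace H]

/-- The anti-unitary `J : h → h*`, `J x y = ⟪x, y⟫`. -/
abbrev J : H ≃ₗᵢ⋆[ℂ] StrongDual ℂ H := InnerProductSpace.toDual ℂ H

/-- The Hilbert space structure of the dual: `⟪J x, J y⟫ = ⟪y, x⟫`, compatible with the
operator norm. -/
instance instInnerProductSpaceDual : InnerProductSpace ℂ (StrongDual ℂ H) where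
  inner φ χ := ⟪(J H).symm χ, (J H).symm φ⟫_ℂ
  norm_sq_eq_re_inner φ := by
    rw [← (J H).symm.norm_map φ]
    exact norm_sq_eq_re_inner (𝕜 := ℂ) _
  conj_inner_symm φ χ := inner_conj_symm _ _
  add_left φ χ ξ := by simp
  smul_left φ χ c := by
    rw [LinearIsometryEquiv.map_smulₛₗ, inner_smul_right]

/-- The Hilbert space direct sum `h ⊕ h*`. -/
abbrev Doubled : Type u := WithLp 2 (H × StrongDual ℂ H)

variable {H}

/-- The vector `f ⊕ φ`. -/
abbrev dsum (f : H) (φ : StrongDual ℂ H) : Doubled H := WithLp.toLp 2 (f, φ)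

/-- The bounded operator on `h ⊕ h*` with block matrix `(A, B; C, D)`. -/
def block (A : H →L[ℂ] H) (B : StrongDual ℂ H →L[ℂ] H)
    (C : H →L[ℂ] StrongDual ℂ H) (D : StrongDual ℂ H →L[ℂ] StrongDual ℂ H) :
    Doubled H →L[ℂ] Doubled H :=
  ((WithLp.prodContinuousLinearEquiv 2 ℂ H (StrongDual ℂ H)).symm :
      (H × StrongDual ℂ H) →L[ℂ] Doubled H) ∘L
    ((A.coprod B).prod (C.coprod D)) ∘L
    ((WithLp.prodContinuousLinearEquiv 2 ℂ H (StrongDual ℂ H)) :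
      Doubled H →L[ℂ] (H × StrongDual ℂ H))

theorem block_dsum (A : H →L[ℂ] H) (B : StrongDual ℂ H →L[ℂ] H)
    (C : H →L[ℂ] StrongDual ℂ H) (D : StrongDual ℂ H →L[ℂ] StrongDual ℂ H)
    (f : H) (φ : StrongDual ℂ H) :
    block A B C D (dsum f φ) = dsum (A f + B φ) (C f + D φ) := rfl

/-- The operator `𝒮 = (1, 0; 0, -1)`. -/
def calS : Doubled H →L[ℂ] Doubled H := block 1 0 0 (-1)

/-- The conjugate-linear map `𝒥 = (0, J*; J, 0)`, that is `𝒥 (f ⊕ Jg) = g ⊕ Jf`. -/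
def calJ (F : Doubled H) : Doubled H := dsum ((J H).symm F.snd) (J H F.fst)

/-- The operator `J α J : h → h*`, for `α : h* → h`. -/
def conjOffDiag (α : StrongDual ℂ H →L[ℂ] H) : H →L[ℂ] StrongDual ℂ H :=
  (J H : H →L⋆[ℂ] StrongDual ℂ H).comp (α.comp (J H : H →L⋆[ℂ] StrongDual ℂ H))

/-- The operator `J γ J* : h* → h*`, for `γ : h → h`. -/
def conjDiag (γ : H →L[ℂ] H) : StrongDual ℂ H →L[ℂ] StrongDual ℂ H :=
  (J H : H →L⋆[ℂ] StrongDual ℂ H).comp (γ.comp ((J H).symm : StrongDual ℂ H →L⋆[ℂ] H))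

/-- The operator `Γ = (γ, α; JαJ, 1 + JγJ*)` on `h ⊕ h*`. -/
def pdm (γ : H →L[ℂ] H) (α : StrongDual ℂ H →L[ℂ] H) : Doubled H →L[ℂ] Doubled H :=
  block γ α (conjOffDiag α) (1 + conjDiag γ)

/-- A bosonic Bogoliubov transformation: a bounded linear isomorphism `V` of `h ⊕ h*` with
`𝒥 V 𝒥 = V` and `V* 𝒮 V = 𝒮`. -/
structure IsBogoliubov (V : Doubled H ≃L[ℂ] Doubled H) : Prop where
  conj : ∀ F, calJ (V (calJ F)) = V F
  symplectic :
    (ContinuousLinearMap.adjoint (V : Doubled H →L[ℂ] Doubled H)) ∘L calS ∘L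
      (V : Doubled H →L[ℂ] Doubled H) = calS

/-- A bounded operator `T` is trace class if `Tr |T| < ∞`, the trace being computed in an
orthonormal basis (the choice of which is immaterial). -/
def IsTraceClass (T : H →L[ℂ] H) : Prop :=
  ∃ (w : Set H) (b : HilbertBasis w ℂ H), Summable fun i => ⟪b i, CFC.abs T (b i)⟫_ℂ

end Doubled

/-! ## Hilbert space tensor powers -/

section Tensor

variable (H : Type u) [NormedAddCommGroup H] [InnerProductSpace ℂ H]

/-- The algebraic `n`-fold tensor power of `H` (a synonym, which will carry the Hilbert norm). -/
def AlgTensor (n : ℕ) : Type u := ⨂[ℂ] _ : Fin n, H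

instance (n : ℕ) : AddCommGroup (AlgTensor H n) :=
  inferInstanceAs (AddCommGroup (⨂[ℂ] _ : Fin n, H))

instance (n : ℕ) : Module ℂ (AlgTensor H n) :=
  inferInstanceAs (Module ℂ (⨂[ℂ] _ : Fin n, H))

variable {H}

/-- The elementary tensor `x₁ ⊗ ⋯ ⊗ xₙ`, as a multilinear map. -/
def algPure (n : ℕ) : MultilinearMap ℂ (fun _ : Fin n => H) (AlgTensor H n) :=
  PiTensorProduct.tprod ℂ

/-- The universal property of the algebraic tensor power. -/
def algLift {n : ℕ} {E : Type*} [AddCommGroup E] [Module ℂ E]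
    (m : MultilinearMap ℂ (fun _ : Fin n => H) E) : AlgTensor H n →ₗ[ℂ] E :=
  PiTensorProduct.lift m

@[simp]
theorem algLift_pure {n : ℕ} {E : Type*} [AddCommGroup E] [Module ℂ E]
    (m : MultilinearMap ℂ (fun _ : Fin n => H) E) (x : Fin n → H) :
    algLift m (algPure n x) = m x :=
  PiTensorProduct.lift.tprod x

theorem span_algPure (n : ℕ) :
    Submodule.span ℂ (Set.range (algPure (H := H) n)) = ⊤ :=
  PiTensorProduct.span_tprod_eq_top

/-- The linear functional `z ↦ ⟪x₁ ⊗ ⋯ ⊗ xₙ, z⟫`. -/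
def pairPure {n : ℕ} (x : Fin n → H) : AlgTensor H n →ₗ[ℂ] ℂ :=
  algLift ((MultilinearMap.mkPiAlgebra ℂ (Fin n) ℂ).compLinearMap fun i => innerₛₗ ℂ (x i))

@[simp]
theorem pairPure_pure {n : ℕ} (x y : Fin n → H) :
    pairPure x (algPure n y) = ∏ i, ⟪x i, y i⟫_ℂ := by
  simp [pairPure]

theorem algTensor_induction {n : ℕ} {p : AlgTensor H n → Prop}
    (pure : ∀ x, p (algPure n x)) (zero : p 0) (add : ∀ z w, p z → p w → p (z + w))
    (smul : ∀ (c : ℂ) z, p z → p (c • z)) (z : AlgTensor H n) : p z := by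
  have hz : z ∈ Submodule.span ℂ (Set.range (algPure (H := H) n)) := by
    rw [span_algPure]; trivial
  induction hz using Submodule.span_induction with
  | mem z h => obtain ⟨x, rfl⟩ := h; exact pure x
  | zero => exact zero
  | add z w _ _ hz hw => exact add z w hz hw
  | smul c z _ hz => exact smul c z hz

/-- For fixed `z`, the multilinear map `x ↦ ⟪z, x₁ ⊗ ⋯ ⊗ xₙ⟫`. -/
def pairRight {n : ℕ} (z : AlgTensor H n) : MultilinearMap ℂ (fun _ : Fin n => H) ℂ where
  toFun x := starRingEnd ℂ (pairPure x z)
  map_update_add' x i a b := by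
    rw [← map_add]
    congr 1
    induction z using algTensor_induction with
    | pure y =>
      simp only [pairPure_pure]
      rw [← Finset.mul_prod_erase _ _ (Finset.mem_univ i),
        ← Finset.mul_prod_erase _ _ (Finset.mem_univ i),
        ← Finset.mul_prod_erase _ _ (Finset.mem_univ i)]
      have h : ∀ c : H, ∏ j ∈ Finset.univ.erase i, ⟪Function.update x i c j, y j⟫_ℂ
          = ∏ j ∈ Finset.univ.erase i, ⟪x j, y j⟫_ℂ := fun c =>
        Finset.prod_congr rfl fun j hj => by
          rw [Function.update_of_ne (Finset.ne_of_mem_erase hj)]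
      simp [h, add_mul]
    | zero => simp
    | add z w hz hw => simp only [map_add, hz, hw]; ring
    | smul c z hz => simp only [map_smul, hz, smul_add]
  map_update_smul' x i c a := by
    have key : pairPure (Function.update x i (c • a)) z
        = starRingEnd ℂ c * pairPure (Function.update x i a) z := by
      induction z using algTensor_induction with
      | pure y =>
        simp only [pairPure_pure]
        rw [← Finset.mul_prod_erase _ _ (Finset.mem_univ i),
          ← Finset.mul_prod_erase _ _ (Finset.mem_univ i)]
        have h : ∀ c : H, ∏ j ∈ Finset.univ.erase i, ⟪Function.update x i c j, y j⟫_ℂ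
            = ∏ j ∈ Finset.univ.erase i, ⟪x j, y j⟫_ℂ := fun c =>
          Finset.prod_congr rfl fun j hj => by
            rw [Function.update_of_ne (Finset.ne_of_mem_erase hj)]
        simp only [h, Function.update_self, inner_smul_left, mul_assoc]
      | zero => simp
      | add z w hz hw => simp only [map_add, hz, hw]; ring
      | smul d z hz => simp only [map_smul, hz, smul_eq_mul]; ring
    simp only [key, map_mul, Complex.conj_conj, smul_eq_mul]

/-- The inner product of the algebraic tensor power. -/
def algInner {n : ℕ} (z w : AlgTensor H n) : ℂ := algLift (pairRight z) w

theorem algInner_pure_right {n : ℕ} (z : AlgTensor H n) (x : Fin n → H) :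
    algInner z (algPure n x) = starRingEnd ℂ (pairPure x z) := by
  simp [algInner, pairRight]

theorem algInner_add_right {n : ℕ} (z w w' : AlgTensor H n) :
    algInner z (w + w') = algInner z w + algInner z w' := by simp [algInner]

theorem algInner_smul_right {n : ℕ} (c : ℂ) (z w : AlgTensor H n) :
    algInner z (c • w) = c * algInner z w := by simp [algInner]

theorem algInner_add_left {n : ℕ} (z z' w : AlgTensor H n) :
    algInner (z + z') w = algInner z w + algInner z' w := by
  induction w using algTensor_induction with
  | pure x => simp [algInner_pure_right]
  | zero => simp [algInner]
  | add u v hu hv => simp only [algInner_add_right, hu, hv]; ring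
  | smul c u hu => simp only [algInner_smul_right, hu]; ring

theorem algInner_smul_left {n : ℕ} (c : ℂ) (z w : AlgTensor H n) :
    algInner (c • z) w = starRingEnd ℂ c * algInner z w := by
  induction w using algTensor_induction with
  | pure x => simp [algInner_pure_right]
  | zero => simp [algInner]
  | add u v hu hv => simp only [algInner_add_right, hu, hv]; ring
  | smul d u hu => simp only [algInner_smul_right, hu]; ring

theorem algInner_zero_left {n : ℕ} (w : AlgTensor H n) : algInner 0 w = 0 := by
  simpa using algInner_smul_left 0 (0 : AlgTensor H n) w

/-- `⟪x₁ ⊗ ⋯ ⊗ xₙ, y₁ ⊗ ⋯ ⊗ yₙ⟫ = ∏ i, ⟪xᵢ, yᵢ⟫`. -/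
theorem algInner_pure_pure {n : ℕ} (x y : Fin n → H) :
    algInner (algPure n x) (algPure n y) = ∏ i, ⟪x i, y i⟫_ℂ := by
  simp [algInner_pure_right, map_prod]

theorem algInner_conj {n : ℕ} (z w : AlgTensor H n) :
    starRingEnd ℂ (algInner w z) = algInner z w := by
  induction w using algTensor_induction with
  | pure x =>
    induction z using algTensor_induction with
    | pure y => simp [algInner_pure_pure, map_prod]
    | zero => rw [algInner_zero_left]; simp [algInner]
    | add u v hu hv => simp only [algInner_add_right, algInner_add_left, map_add, hu, hv]
    | smul d u hu => simp only [algInner_smul_right, algInner_smul_left, map_mul, hu]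
  | zero => rw [algInner_zero_left]; simp [algInner]
  | add u v hu hv => simp only [algInner_add_right, algInner_add_left, map_add, hu, hv]
  | smul d u hu =>
    simp only [algInner_smul_right, algInner_smul_left, map_mul, hu, Complex.conj_conj]

theorem posSemidef_prod {n : ℕ} {κ : Type*} [Finite κ] (v : κ → Fin n → H) :
    (Matrix.of fun k l : κ => ∏ i, ⟪v k i, v l i⟫_ℂ).PosSemidef := by
  have key : ∀ s : Finset (Fin n),
      (Matrix.of fun k l : κ => ∏ i ∈ s, ⟪v k i, v l i⟫_ℂ).PosSemidef := by
    intro s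
    induction s using Finset.induction_on with
    | empty =>
      have h := Matrix.posSemidef_gram ℂ (fun _ : κ => (1 : ℂ))
      have e : Matrix.gram ℂ (fun _ : κ => (1 : ℂ))
          = Matrix.of fun k l : κ => ∏ i ∈ (∅ : Finset (Fin n)), ⟪v k i, v l i⟫_ℂ := by
        ext k l
        simp [Matrix.gram]
      rwa [e] at h
    | insert i s hi ih =>
      have h := (Matrix.posSemidef_gram ℂ (fun k : κ => v k i)).hadamard ih
      have e : (Matrix.gram ℂ (fun k : κ => v k i)).hadamard
            (Matrix.of fun k l : κ => ∏ i ∈ s, ⟪v k i, v l i⟫_ℂ)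
          = Matrix.of fun k l : κ => ∏ i ∈ insert i s, ⟪v k i, v l i⟫_ℂ := by
        ext k l
        simp [Matrix.gram, Finset.prod_insert hi]
      rwa [e] at h
  exact key Finset.univ

theorem algInner_sum_right {n : ℕ} {κ : Type*} (s : Finset κ) (z : AlgTensor H n)
    (w : κ → AlgTensor H n) :
    algInner z (∑ k ∈ s, w k) = ∑ k ∈ s, algInner z (w k) := by
  simp [algInner]

theorem algInner_sum_left {n : ℕ} {κ : Type*} (s : Finset κ) (w : κ → AlgTensor H n)
    (z : AlgTensor H n) :
    algInner (∑ k ∈ s, w k) z = ∑ k ∈ s, algInner (w k) z := by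
  rw [← algInner_conj, algInner_sum_right, map_sum]
  simp only [algInner_conj]

theorem algInner_self_nonneg {n : ℕ} (z : AlgTensor H n) : 0 ≤ (algInner z z).re := by
  have hz : z ∈ Submodule.span ℂ (Set.range (algPure (H := H) n)) := by
    rw [span_algPure]; trivial
  rw [Finsupp.mem_span_range_iff_exists_finsupp] at hz
  obtain ⟨c, rfl⟩ := hz
  have h := (posSemidef_prod (fun x : c.support => (x : Fin n → H))).dotProduct_mulVec_nonneg
    (fun x => c x)
  rw [Finsupp.sum, ← Finset.sum_coe_sort, algInner_sum_left]
  simp only [algInner_sum_right, algInner_smul_left, algInner_smul_right, algInner_pure_pure]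
  have h' := (Complex.le_def.1 h).1
  refine h'.trans_eq (congrArg Complex.re ?_)
  simp only [dotProduct, Matrix.mulVec, Matrix.of_apply, Pi.star_apply, Finset.mul_sum]
  refine Finset.sum_congr rfl fun x _ => Finset.sum_congr rfl fun y _ => ?_
  rw [Complex.star_def]
  ring

instance algCore (n : ℕ) : PreInnerProductSpace.Core ℂ (AlgTensor H n) where
  inner := algInner
  conj_inner_symm := algInner_conj
  re_inner_nonneg := algInner_self_nonneg
  add_left := algInner_add_left
  smul_left z w c := algInner_smul_left c z w

instance (n : ℕ) : SeminormedAddCommGroup (AlgTensor H n) :=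
  InnerProductSpace.Core.toSeminormedAddCommGroup (𝕜 := ℂ)

instance (n : ℕ) : InnerProductSpace ℂ (AlgTensor H n) := .ofCore _

variable (H) in
/-- The Hilbert space tensor power `H ⊗ ⋯ ⊗ H` (`n` factors). -/
abbrev HTensor (n : ℕ) : Type u := UniformSpace.Completion (AlgTensor H n)

/-- The elementary tensor `x₁ ⊗ ⋯ ⊗ xₙ` in the Hilbert space tensor power. -/
def pureTensor {n : ℕ} (x : Fin n → H) : HTensor H n := (algPure n x : AlgTensor H n)

theorem inner_pureTensor {n : ℕ} (x y : Fin n → H) :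
    ⟪pureTensor x, pureTensor y⟫_ℂ = ∏ i, ⟪x i, y i⟫_ℂ := by
  rw [pureTensor, pureTensor, UniformSpace.Completion.inner_coe]
  exact algInner_pure_pure x y

/-- The map `x₁ ⊗ ⋯ ⊗ xₙ ↦ g ⊗ x₁ ⊗ ⋯ ⊗ xₙ` on algebraic tensors. -/
def algPrepend (n : ℕ) (g : H) : AlgTensor H n →ₗ[ℂ] AlgTensor H (n + 1) :=
  algLift ((algPure (n + 1)).curryLeft g)

theorem algPrepend_pure (n : ℕ) (g : H) (x : Fin n → H) :
    algPrepend n g (algPure n x) = algPure (n + 1) (Fin.cons g x) := by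
  simp [algPrepend]

theorem algInner_prepend (n : ℕ) (g : H) (z w : AlgTensor H n) :
    algInner (algPrepend n g z) (algPrepend n g w) = ⟪g, g⟫_ℂ * algInner z w := by
  induction w using algTensor_induction with
  | pure x =>
    induction z using algTensor_induction with
    | pure y =>
      rw [algPrepend_pure, algPrepend_pure, algInner_pure_pure, algInner_pure_pure,
        Fin.prod_univ_succ]
      simp
    | zero => simp [algInner_pure_right, algPrepend_pure]
    | add u v hu hv => simp only [map_add, algInner_add_left, hu, hv]; ring
    | smul d u hu => simp only [map_smul, algInner_smul_left, hu]; ring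
  | zero => simp [algInner]
  | add u v hu hv => simp only [map_add, algInner_add_right, hu, hv]; ring
  | smul d u hu => simp only [map_smul, algInner_smul_right, hu]; ring

theorem norm_algPrepend (n : ℕ) (g : H) (z : AlgTensor H n) :
    ‖algPrepend n g z‖ = ‖g‖ * ‖z‖ := by
  have h : ⟪algPrepend n g z, algPrepend n g z⟫_ℂ = ⟪g, g⟫_ℂ * ⟪z, z⟫_ℂ :=
    algInner_prepend n g z z
  rw [inner_self_eq_norm_sq_to_K, inner_self_eq_norm_sq_to_K, inner_self_eq_norm_sq_to_K] at h
  have h2 : ‖algPrepend n g z‖ ^ 2 = (‖g‖ * ‖z‖) ^ 2 := by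
    rw [mul_pow]; exact_mod_cast h
  exact (pow_left_inj₀ (norm_nonneg _) (by positivity) two_ne_zero).1 h2

/-- The bounded operator `ψ ↦ g ⊗ ψ` from the `n`-fold to the `(n+1)`-fold tensor power. -/
def prepend (n : ℕ) (g : H) : HTensor H n →L[ℂ] HTensor H (n + 1) :=
  ((algPrepend n g).mkContinuous ‖g‖ fun z => (norm_algPrepend n g z).le).completion

theorem prepend_pureTensor (n : ℕ) (g : H) (x : Fin n → H) :
    prepend n g (pureTensor x) = pureTensor (Fin.cons g x : Fin (n + 1) → H) := by
  simp [prepend, pureTensor, algPrepend_pure]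

/-- The symmetric `n`-particle space: the closed span of the symmetrized elementary tensors
`∑ σ, x_{σ 1} ⊗ ⋯ ⊗ x_{σ n}`. -/
def symSubspace (H : Type u) [NormedAddCommGroup H] [InnerProductSpace ℂ H] (n : ℕ) :
    Submodule ℂ (HTensor H n) :=
  (Submodule.span ℂ (Set.range fun x : Fin n → H =>
    ∑ σ : Equiv.Perm (Fin n), pureTensor (x ∘ σ))).topologicalClosure

/-- The symmetric tensor product Hilbert space of `n` particles. -/
abbrev SymPow (H : Type u) [NormedAddCommGroup H] [InnerProductSpace ℂ H] (n : ℕ) : Type u :=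
  symSubspace H n

instance (n : ℕ) : CompleteSpace (symSubspace H n) :=
  Submodule.topologicalClosure.completeSpace _

end Tensor

/-! ## Fock space, creation and annihilation operators -/

section Fock

variable (H : Type u) [NormedAddCommGroup H] [InnerProductSpace ℂ H] [CompleteSpace H]

/-- The bosonic Fock space, the Hilbert space direct sum of the symmetric `n`-particle spaces. -/
abbrev Fock : Type u := lp (fun n : ℕ => SymPow H n) 2

variable {H}

/-- The creation operator `a*(g)` from `n` to `n + 1` particles: `√(n+1) P_sym (g ⊗ ψ)`. -/
def create (n : ℕ) (g : H) : SymPow H n →L[ℂ] SymPow H (n + 1) :=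
  ((Real.sqrt (n + 1) : ℝ) : ℂ) •
    ((symSubspace H (n + 1)).orthogonalProjectionOnto ∘L prepend n g ∘L (symSubspace H n).subtypeL)

/-- The annihilation operator `a(f)` from `n + 1` to `n` particles, the adjoint of `a*(f)`. -/
def annihilate (n : ℕ) (f : H) : SymPow H (n + 1) →L[ℂ] SymPow H n :=
  ContinuousLinearMap.adjoint (create n f)

/-- The `n`-particle component of `a*(g) ψ`. -/
def createComponent (g : H) (ψ : Fock H) : (n : ℕ) → SymPow H n
  | 0 => 0
  | n + 1 => create n g (ψ n)

/-- The `n`-particle component of `A(F) ψ = a(f) ψ + a*(g) ψ`, where `F = f ⊕ Jg`. -/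
def fieldComponent (F : Doubled H) (ψ : Fock H) (n : ℕ) : SymPow H n :=
  annihilate n F.fst (ψ (n + 1)) + createComponent ((J H).symm F.snd) ψ n

theorem fieldComponent_add (F : Doubled H) (ψ χ : Fock H) :
    fieldComponent F (ψ + χ) = fieldComponent F ψ + fieldComponent F χ := by
  funext n
  cases n <;> simp [fieldComponent, createComponent]; abel

theorem fieldComponent_smul (F : Doubled H) (c : ℂ) (ψ : Fock H) :
    fieldComponent F (c • ψ) = c • fieldComponent F ψ := by
  funext n
  cases n <;> simp [fieldComponent, createComponent]

/-- The generalized annihilation operator `A(f ⊕ Jg) = a(f) + a*(g)`, as a closed unbounded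
operator on Fock space with its natural domain: those `ψ` for which the sequence of components
of `a(f) ψ + a*(g) ψ` is square summable. For `g = 0` or `f = 0` this is the usual closed
annihilation or creation operator. -/
def fieldOp (F : Doubled H) : Fock H →ₗ.[ℂ] Fock H where
  domain :=
    { carrier := {ψ | Memℓp (fieldComponent F ψ) 2}
      add_mem' := fun {ψ χ} hψ hχ => by
        simp only [Set.mem_ofPred_eq] at *
        rw [fieldComponent_add]
        exact hψ.add hχ
      zero_mem' := by
        have h : fieldComponent F (0 : Fock H) = 0 := by
          simpa using fieldComponent_smul F 0 (0 : Fock H)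
        simp only [Set.mem_ofPred_eq]
        rw [h]
        exact zero_memℓp
      smul_mem' := fun c ψ hψ => by
        simp only [Set.mem_ofPred_eq] at *
        rw [fieldComponent_smul]
        exact hψ.const_smul c }
  toFun :=
    { toFun := fun ψ => ⟨fieldComponent F ψ.1, ψ.2⟩
      map_add' := fun ψ χ => Subtype.ext (fieldComponent_add F ψ.1 χ.1)
      map_smul' := fun c ψ => Subtype.ext (fieldComponent_smul F c ψ.1) }

/-- `V` is unitarily implementable: there is a unitary `U` on Fock space with
`A(V F) = U A(F) U*` for all `F`, as an identity of unbounded operators (equal domains and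
equal values), expressed through the graphs. -/
def UnitarilyImplementable (V : Doubled H ≃L[ℂ] Doubled H) : Prop :=
  ∃ U : Fock H ≃ₗᵢ[ℂ] Fock H, ∀ (F : Doubled H) (ψ χ : Fock H),
    (U ψ, U χ) ∈ (fieldOp (V F)).graph ↔ (ψ, χ) ∈ (fieldOp F).graph

end Fock

end

end BoseFock

/-!
Write `S = 𝒮`, `j = 𝒥`, and `Γ` for the density matrix. Since `j Γ j = Γ + S`, the operator
`a = 2Γ + S = Γ + j Γ j` commutes with `j`; as `‖x‖ = ‖(jΓj - Γ) x‖` is controlled by the two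
quadratic forms, `a` is bounded below, hence strictly positive.

**Diagonalization** (`exists_symplectic_sqrt`, `exists_symplectic_diagonalization`). In any
C⋆-algebra, the equation `x a x = S a S` has a unique positive solution, namely
`x = a^{-1/2} (a^{1/2} S a S a^{1/2})^{1/2} a^{-1/2}`. As `S x⁻¹ S` is another positive solution,
`x S x = S`, and the square root `v = √x` is a positive symplectic operator for which `v a v`, and
so `v Γ v`, commutes with `S`: it is block diagonal. Uniqueness also shows that `v` commutes with
`j`. The operator `v Γ v` restricts to a compact positive operator `γ'` on `h`; composing `v` with
the unitary `W ⊕ J W J*`, where `W` maps the given basis to an eigenbasis of `γ'`, gives the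
Bogoliubov transformation.

**Summability.** Because `γ` is trace class, `√Γ` is Hilbert–Schmidt on `h`, so `a - 1` is
Hilbert–Schmidt on `h ⊕ h*`. The Hilbert–Schmidt operators are a two-sided ideal, and `v - 1` is
obtained from `a - 1` by ideal operations. Hence the off-diagonal blocks of the transformation are
Hilbert–Schmidt, and so is `√Γ v` on `h`, whose squared Hilbert–Schmidt norm is `∑ λₙ`.

**Implementation** (`IsBogoliubov.unitarilyImplementable`, one direction of Shale's theorem). Write
`V (f ⊕ 0) = u f ⊕ J (v f)`. The operator `K = -v u⁻¹` is symmetric, Hilbert–Schmidt and of norm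
less than one, so the squeezed vector `exp (½ ∑ a*(eᵢ) a*(K eᵢ)) Ω` exists, decreases rapidly in
the particle number, and is annihilated by all `A (V (f ⊕ 0))`
(`CreationSystem.exists_squeezed_vacuum`). By the commutation relations, words in the transformed
creation operators applied to it have the same Gram matrix as the usual Fock words, which gives an
intertwining isometry. The isometry for `V⁻¹` composes with it to a multiple of the identity, by
uniqueness of the vacuum, so it is onto (`CreationSystem.exists_unitary`). Operators with their
maximal domains are compared by testing against Fock words.
-/

open scoped InnerProductSpace TensorProduct ComplexOrder

namespace BoseFock

noncomputable section

universe u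

set_option linter.unusedSectionVars false

-- with `ComplexOrder` open, the Hilbert C⋆-module structure on `ℂ` would also provide `inner`
attribute [local instance 2000] InnerProductSpace.toInner

/-! ### Symmetrized elementary tensors -/

section Sectors

variable {H : Type u} [NormedAddCommGroup H] [InnerProductSpace ℂ H]

/-- The symmetric part of `x₁ ⊗ ⋯ ⊗ xₙ`. -/
def symPure {n : ℕ} (x : Fin n → H) : SymPow H n :=
  (symSubspace H n).orthogonalProjectionOnto (pureTensor x)

theorem sum_pureTensor_comp_mem {n : ℕ} (x : Fin n → H) :
    ∑ σ : Equiv.Perm (Fin n), pureTensor (x ∘ σ) ∈ symSubspace H n :=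
  Submodule.le_topologicalClosure _ (Submodule.subset_span ⟨x, rfl⟩)

theorem inner_pureTensor_comp_perm {n : ℕ} (x y : Fin n → H) (σ : Equiv.Perm (Fin n)) :
    ⟪pureTensor (x ∘ σ), pureTensor (y ∘ σ)⟫_ℂ = ⟪pureTensor x, pureTensor y⟫_ℂ := by
  simp only [inner_pureTensor, Function.comp_apply]
  exact Equiv.prod_comp σ fun i => ⟪x i, y i⟫_ℂ

theorem inner_sum_pureTensor_comp {n : ℕ} (x y : Fin n → H) (σ : Equiv.Perm (Fin n)) :
    ⟪∑ τ : Equiv.Perm (Fin n), pureTensor (x ∘ τ), pureTensor (y ∘ σ)⟫_ℂ =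
      ⟪∑ τ : Equiv.Perm (Fin n), pureTensor (x ∘ τ), pureTensor y⟫_ℂ := by
  simp only [sum_inner]
  refine Fintype.sum_equiv (Equiv.mulRight σ⁻¹) _ _ fun τ => ?_
  rw [← inner_pureTensor_comp_perm _ y σ]
  congr 2
  funext i
  simp

theorem coe_symPure {n : ℕ} (x : Fin n → H) :
    (symPure x : HTensor H n) =
      ((n.factorial : ℂ)⁻¹) • ∑ σ : Equiv.Perm (Fin n), pureTensor (x ∘ σ) := by
  refine Submodule.eq_starProjection_of_mem_orthogonal
    (Submodule.smul_mem _ _ (sum_pureTensor_comp_mem x)) ?_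
  refine (Submodule.orthogonal_closure _).ge ((Submodule.mem_orthogonal _ _).2 fun z hz => ?_)
  induction hz using Submodule.span_induction with
  | mem z h =>
    obtain ⟨y, rfl⟩ := h
    rw [inner_sub_right, inner_smul_right, inner_sum]
    simp only [inner_sum_pureTensor_comp]
    rw [Finset.sum_const, Finset.card_univ, Fintype.card_perm, Fintype.card_fin, nsmul_eq_mul,
      inv_mul_cancel_left₀ (by exact_mod_cast n.factorial_ne_zero), sub_self]
  | zero => simp
  | add z w _ _ hz hw => rw [inner_add_left, hz, hw, add_zero]
  | smul c z _ hz => rw [inner_smul_left, hz, mul_zero]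

theorem symPure_comp_perm {n : ℕ} (x : Fin n → H) (σ : Equiv.Perm (Fin n)) :
    symPure (x ∘ σ) = symPure x := by
  apply Subtype.ext
  rw [coe_symPure, coe_symPure]
  congr 1
  refine Fintype.sum_equiv (Equiv.mulLeft σ) _ _ fun τ => ?_
  congr 1

theorem inner_symPure_left {n : ℕ} (x : Fin n → H) (η : SymPow H n) :
    ⟪symPure x, η⟫_ℂ = ⟪pureTensor x, (η : HTensor H n)⟫_ℂ := by
  rw [symPure, Submodule.inner_orthogonalProjectionOnto_eq_of_mem_right]

theorem inner_symPure {n : ℕ} (x y : Fin n → H) :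
    ⟪symPure x, symPure y⟫_ℂ =
      ((n.factorial : ℂ)⁻¹) * ∑ σ : Equiv.Perm (Fin n), ∏ i, ⟪x i, y (σ i)⟫_ℂ := by
  rw [inner_symPure_left, coe_symPure, inner_smul_right, inner_sum]
  simp [inner_pureTensor]

theorem symPow_inner_smul_left {n : ℕ} (c : ℂ) (φ ψ : SymPow H n) :
    ⟪c • φ, ψ⟫_ℂ = starRingEnd ℂ c * ⟪φ, ψ⟫_ℂ :=
  inner_smul_left φ ψ c

theorem symPow_inner_smul_right {n : ℕ} (c : ℂ) (φ ψ : SymPow H n) :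
    ⟪φ, c • ψ⟫_ℂ = c * ⟪φ, ψ⟫_ℂ :=
  inner_smul_right φ ψ c

theorem eq_zero_of_inner_symPure {n : ℕ} {η : SymPow H n}
    (h : ∀ x, ⟪symPure x, η⟫_ℂ = 0) : η = 0 := by
  have h1 : (η : HTensor H n) ∈ (symSubspace H n)ᗮ := by
    refine (Submodule.orthogonal_closure _).ge ((Submodule.mem_orthogonal _ _).2 fun z hz => ?_)
    induction hz using Submodule.span_induction with
    | mem z hz =>
      obtain ⟨y, rfl⟩ := hz
      rw [sum_inner]
      exact Finset.sum_eq_zero fun σ _ => by rw [← inner_symPure_left, h]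
    | zero => simp
    | add z w _ _ hz hw => rw [inner_add_left, hz, hw, add_zero]
    | smul c z _ hz => rw [inner_smul_left, hz, mul_zero]
  have h2 := Submodule.inner_right_of_mem_orthogonal η.2 h1
  exact Subtype.ext (inner_self_eq_zero.1 h2)

theorem dense_span_symPure (n : ℕ) :
    Dense (Submodule.span ℂ (Set.range (symPure (H := H) (n := n))) : Set (SymPow H n)) := by
  rw [Submodule.dense_iff_topologicalClosure_eq_top, Submodule.topologicalClosure_eq_top_iff,
    Submodule.eq_bot_iff]
  intro η hη
  refine eq_zero_of_inner_symPure fun x => ?_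
  exact Submodule.inner_right_of_mem_orthogonal (Submodule.subset_span (Set.mem_range_self x)) hη

theorem clm_ext_symPure {n : ℕ} {E : Type*} [TopologicalSpace E] [T2Space E] [AddCommMonoid E]
    [Module ℂ E] {S T : SymPow H n →L[ℂ] E} (h : ∀ x, S (symPure x) = T (symPure x)) : S = T := by
  refine ContinuousLinearMap.ext_on (dense_span_symPure n) ?_
  rintro _ ⟨x, rfl⟩
  exact h x

theorem inner_prepend (n : ℕ) (f g : H) (z w : HTensor H n) :
    ⟪prepend n f z, prepend n g w⟫_ℂ = ⟪f, g⟫_ℂ * ⟪z, w⟫_ℂ := by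
  induction z, w using UniformSpace.Completion.induction_on₂ with
  | hp => exact isClosed_eq (by fun_prop) (by fun_prop)
  | ih z w =>
    have key : algInner (algPrepend n f z) (algPrepend n g w) = ⟪f, g⟫_ℂ * algInner z w := by
      induction w using algTensor_induction with
      | pure x =>
        induction z using algTensor_induction with
        | pure y =>
          rw [algPrepend_pure, algPrepend_pure, algInner_pure_pure, algInner_pure_pure,
            Fin.prod_univ_succ]
          simp
        | zero => simp [algInner_zero_left]
        | add u v hu hv => simp only [map_add, algInner_add_left, hu, hv]; ring
        | smul d u hu => simp only [map_smul, algInner_smul_left, hu]; ring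
      | zero => simp [algInner]
      | add u v hu hv => simp only [map_add, algInner_add_right, hu, hv]; ring
      | smul d u hu => simp only [map_smul, algInner_smul_right, hu]; ring
    simp only [prepend, ContinuousLinearMap.completion_apply_coe, UniformSpace.Completion.inner_coe]
    exact key

theorem algPrepend_add (n : ℕ) (f g : H) (z : AlgTensor H n) :
    algPrepend n (f + g) z = algPrepend n f z + algPrepend n g z := by
  induction z using algTensor_induction with
  | pure x => simp [algPrepend]
  | zero => simp
  | add u v hu hv => simp only [map_add, hu, hv]; abel
  | smul d u hu => simp only [map_smul, hu, smul_add]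

theorem algPrepend_smul (n : ℕ) (c : ℂ) (f : H) (z : AlgTensor H n) :
    algPrepend n (c • f) z = c • algPrepend n f z := by
  induction z using algTensor_induction with
  | pure x => simp [algPrepend]
  | zero => simp
  | add u v hu hv => simp only [map_add, hu, hv, smul_add]
  | smul d u hu => simp only [map_smul, hu]; rw [smul_comm]

theorem prepend_add (n : ℕ) (f g : H) (z : HTensor H n) :
    prepend n (f + g) z = prepend n f z + prepend n g z := by
  induction z using UniformSpace.Completion.induction_on with
  | hp => exact isClosed_eq (by fun_prop) (by fun_prop)
  | ih z =>
    simp only [prepend, ContinuousLinearMap.completion_apply_coe,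
      LinearMap.mkContinuous_apply, algPrepend_add, UniformSpace.Completion.coe_add]

theorem prepend_smul (n : ℕ) (c : ℂ) (f : H) (z : HTensor H n) :
    prepend n (c • f) z = c • prepend n f z := by
  induction z using UniformSpace.Completion.induction_on with
  | hp => exact isClosed_eq (by fun_prop) ((prepend n f).continuous.const_smul c)
  | ih z =>
    simp only [prepend, ContinuousLinearMap.completion_apply_coe,
      LinearMap.mkContinuous_apply, algPrepend_smul, UniformSpace.Completion.coe_smul]

/-! ### Creation and annihilation operators on the particle number sectors -/

theorem create_apply (n : ℕ) (g : H) (φ : SymPow H n) :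
    create n g φ = ((Real.sqrt (n + 1) : ℝ) : ℂ) •
      (symSubspace H (n + 1)).orthogonalProjectionOnto (prepend n g (φ : HTensor H n)) := rfl

theorem create_add (n : ℕ) (f g : H) (φ : SymPow H n) :
    create n (f + g) φ = create n f φ + create n g φ := by
  simp only [create_apply, prepend_add, map_add, smul_add]

theorem create_smul (n : ℕ) (c : ℂ) (g : H) (φ : SymPow H n) :
    create n (c • g) φ = c • create n g φ := by
  simp only [create_apply, prepend_smul, map_smul]
  rw [smul_comm]

theorem norm_sq_sum_create_le (n : ℕ) {ι : Type*} (s : Finset ι) (f : ι → H)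
    (χ : ι → SymPow H n) :
    ‖∑ i ∈ s, create n (f i) (χ i)‖ ^ 2 ≤
      (n + 1) * (∑ i ∈ s, ∑ j ∈ s, ⟪f i, f j⟫_ℂ * ⟪χ i, χ j⟫_ℂ).re := by
  have h : ∑ i ∈ s, create n (f i) (χ i) = ((Real.sqrt (n + 1) : ℝ) : ℂ) •
      (symSubspace H (n + 1)).orthogonalProjectionOnto
        (∑ i ∈ s, prepend n (f i) (χ i : HTensor H n)) := by
    simp only [create_apply, map_sum, Finset.smul_sum]
  have h2 : (∑ i ∈ s, ∑ j ∈ s, ⟪f i, f j⟫_ℂ * ⟪χ i, χ j⟫_ℂ).re =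
      ‖∑ i ∈ s, prepend n (f i) (χ i : HTensor H n)‖ ^ 2 := by
    rw [← inner_self_eq_norm_sq (𝕜 := ℂ), sum_inner]
    simp only [inner_sum, inner_prepend]
    rfl
  rw [h2, h, norm_smul, Complex.norm_real, Real.norm_of_nonneg (Real.sqrt_nonneg _), mul_pow,
    Real.sq_sqrt (by positivity)]
  gcongr
  exact Submodule.norm_orthogonalProjectionOnto_apply_le _ _

theorem inner_annihilate_right (n : ℕ) (f : H) (φ : SymPow H (n + 1)) (ψ : SymPow H n) :
    ⟪ψ, annihilate n f φ⟫_ℂ = ⟪create n f ψ, φ⟫_ℂ :=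
  ContinuousLinearMap.adjoint_inner_right _ _ _

theorem cons_comp_perm {H : Type*} {n : ℕ} (g : H) (x : Fin n → H) (σ : Equiv.Perm (Fin n)) :
    (Fin.cons g (x ∘ σ) : Fin (n + 1) → H) =
      (Fin.cons g x : Fin (n + 1) → H) ∘ (Equiv.Perm.decomposeFin.symm (0, σ)) := by
  funext i
  refine Fin.cases ?_ (fun i => ?_) i <;> simp

theorem create_symPure (n : ℕ) (g : H) (x : Fin n → H) :
    create n g (symPure x) =
      ((Real.sqrt (n + 1) : ℝ) : ℂ) • symPure (Fin.cons g x : Fin (n + 1) → H) := by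
  rw [create_apply]
  congr 1
  rw [coe_symPure, map_smul, map_sum, map_smul, map_sum]
  simp only [prepend_pureTensor]
  change _ • ∑ σ : Equiv.Perm (Fin n), symPure (Fin.cons g (x ∘ σ) : Fin (n + 1) → H) = _
  simp only [cons_comp_perm, symPure_comp_perm]
  rw [Finset.sum_const, Finset.card_univ, Fintype.card_perm, Fintype.card_fin,
    ← Nat.cast_smul_eq_nsmul ℂ, smul_smul,
    inv_mul_cancel₀ (by exact_mod_cast n.factorial_ne_zero), one_smul]

theorem create_comm (n : ℕ) (f g : H) (φ : SymPow H n) :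
    create (n + 1) f (create n g φ) = create (n + 1) g (create n f φ) := by
  suffices h : create (n + 1) f ∘L create n g = create (n + 1) g ∘L create n f from
    congrArg (fun T => T φ) h
  refine clm_ext_symPure fun x => ?_
  simp only [ContinuousLinearMap.comp_apply, create_symPure, map_smul]
  congr 2
  rw [← symPure_comp_perm _ (Equiv.swap 0 1)]
  congr 1
  funext i
  refine Fin.cases ?_ (fun i => Fin.cases ?_ (fun i => ?_) i) i
  · simp
  · have : (Fin.succ 0 : Fin (n + 2)) = 1 := rfl
    simp [this]
  · have h1 : (i.succ.succ : Fin (n + 2)) ≠ 1 := by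
      rw [← Fin.succ_zero_eq_one]
      exact fun h => Fin.succ_ne_zero _ (Fin.succ_injective _ h)
    rw [Function.comp_apply, Equiv.swap_apply_of_ne_of_ne (Fin.succ_ne_zero _) h1]
    simp

/-- Expansion of the permanent along its first row. -/
theorem annihilate_symPure (n : ℕ) (f : H) (x : Fin (n + 1) → H) :
    annihilate n f (symPure x) = ((Real.sqrt (n + 1) : ℝ) : ℂ)⁻¹ •
      ∑ p, ⟪f, x p⟫_ℂ • symPure (Fin.tail (x ∘ Equiv.swap 0 p)) := by
  rw [← sub_eq_zero]
  refine eq_zero_of_inner_symPure fun y => ?_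
  rw [inner_sub_right, inner_annihilate_right, create_symPure, sub_eq_zero,
    symPow_inner_smul_left, symPow_inner_smul_right, inner_sum, inner_symPure]
  simp only [symPow_inner_smul_right, inner_symPure]
  rw [← Equiv.sum_comp Equiv.Perm.decomposeFin.symm, Fintype.sum_prod_type, Complex.conj_ofReal]
  simp only [Fin.prod_univ_succ, Fin.cons_zero, Fin.cons_succ,
    Equiv.Perm.decomposeFin_symm_apply_zero, Equiv.Perm.decomposeFin_symm_apply_succ,
    Fin.tail, Function.comp_apply]
  have hs : ((Real.sqrt (n + 1) : ℝ) : ℂ) * ((Real.sqrt (n + 1) : ℝ) : ℂ) = (n + 1 : ℂ) := by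
    rw [← Complex.ofReal_mul, Real.mul_self_sqrt (by positivity)]
    push_cast; rfl
  have h0 : ((Real.sqrt (n + 1) : ℝ) : ℂ) ≠ 0 := by
    have : Real.sqrt (n + 1) ≠ 0 := by positivity
    exact_mod_cast this
  rw [eq_inv_mul_iff_mul_eq₀ h0, ← mul_assoc, hs, Nat.factorial_succ, Nat.cast_mul, mul_inv,
    ← mul_assoc, ← mul_assoc, Nat.cast_succ,
    mul_inv_cancel₀ (by exact_mod_cast n.succ_ne_zero), one_mul, Finset.mul_sum]
  refine Finset.sum_congr rfl fun p _ => ?_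
  rw [← Finset.mul_sum]
  ring

/-- The canonical commutation relation on the sectors with at least one particle. -/
theorem annihilate_create_succ (n : ℕ) (f g : H) (φ : SymPow H (n + 1)) :
    annihilate (n + 1) f (create (n + 1) g φ) =
      ⟪f, g⟫_ℂ • φ + create n g (annihilate n f φ) := by
  suffices h : annihilate (n + 1) f ∘L create (n + 1) g =
      ⟪f, g⟫_ℂ • ContinuousLinearMap.id ℂ _ + create n g ∘L annihilate n f from
    congrArg (fun T => T φ) h
  refine clm_ext_symPure fun x => ?_
  have h1 : ∀ k : ℕ, ((Real.sqrt (k + 1) : ℝ) : ℂ) ≠ 0 := fun k => by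
    have : Real.sqrt (k + 1) ≠ 0 := by positivity
    exact_mod_cast this
  simp only [ContinuousLinearMap.comp_apply, add_apply,
    smul_apply, ContinuousLinearMap.id_apply, create_symPure, map_smul,
    annihilate_symPure, map_sum]
  rw [smul_inv_smul₀ (h1 _), Fin.sum_univ_succ]
  congr 1
  · rw [Finset.smul_sum]
    refine Finset.sum_congr rfl fun p _ => ?_
    rw [smul_comm (⟪f, x p⟫_ℂ), inv_smul_smul₀ (h1 _), Fin.cons_succ]
    congr 1
    rw [← symPure_comp_perm (Fin.cons g _) (Equiv.swap 0 p)]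
    congr 1
    funext i
    by_cases hi : i = p
    · subst hi
      simp [Fin.tail]
    · have h2 : (i.succ : Fin (n + 2)) ≠ p.succ := fun h => hi (Fin.succ_injective _ h)
      simp only [Fin.tail, Function.comp_apply,
        Equiv.swap_apply_of_ne_of_ne (Fin.succ_ne_zero i) h2, Fin.cons_succ]
      by_cases hi0 : i = 0
      · subst hi0
        rw [Equiv.swap_apply_left]
        obtain ⟨q, rfl⟩ := Fin.exists_succ_eq.2 (Ne.symm hi)
        simp [Fin.tail]
      · rw [Equiv.swap_apply_of_ne_of_ne hi0 hi]
        obtain ⟨q, rfl⟩ := Fin.exists_succ_eq.2 hi0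
        rw [Fin.cons_succ, Fin.tail, Function.comp_apply,
          Equiv.swap_apply_of_ne_of_ne (Fin.succ_ne_zero q) hi]

/-- The canonical commutation relation on the vacuum sector. -/
theorem annihilate_create_zero (f g : H) (φ : SymPow H 0) :
    annihilate 0 f (create 0 g φ) = ⟪f, g⟫_ℂ • φ := by
  suffices h : annihilate 0 f ∘L create 0 g = ⟪f, g⟫_ℂ • ContinuousLinearMap.id ℂ _ from
    congrArg (fun T => T φ) h
  refine clm_ext_symPure fun x => ?_
  simp [create_symPure, annihilate_symPure]

end Sectors

/-! ### Bosonic creation operators on a graded Hilbert space -/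

/-- The structural properties of the creation operators on the particle number sectors `G n` of a
bosonic Fock space over `H`: linearity, the canonical (anti)commutation relations, the estimate
`‖∑ a*(fᵢ) χᵢ‖² ≤ (n + 1) ‖∑ fᵢ ⊗ χᵢ‖²`, and the existence of a vacuum from which all
sectors are generated. -/
structure CreationSystem (H : Type u) [NormedAddCommGroup H] [InnerProductSpace ℂ H]
    (G : ℕ → Type*) [∀ n, NormedAddCommGroup (G n)] [∀ n, InnerProductSpace ℂ (G n)]
    [∀ n, CompleteSpace (G n)] where
  cr : ∀ n, H → G n →L[ℂ] G (n + 1)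
  cr_add : ∀ n f g φ, cr n (f + g) φ = cr n f φ + cr n g φ
  cr_smul : ∀ n (c : ℂ) f φ, cr n (c • f) φ = c • cr n f φ
  cr_comm : ∀ n f g φ, cr (n + 1) f (cr n g φ) = cr (n + 1) g (cr n f φ)
  ccr_zero : ∀ f g φ, ContinuousLinearMap.adjoint (cr 0 f) (cr 0 g φ) = ⟪f, g⟫_ℂ • φ
  ccr_succ : ∀ n f g φ, ContinuousLinearMap.adjoint (cr (n + 1) f) (cr (n + 1) g φ) =
    ⟪f, g⟫_ℂ • φ + cr n g (ContinuousLinearMap.adjoint (cr n f) φ)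
  norm_sq_sum_cr_le : ∀ n {κ : Type u} (s : Finset κ) (f : κ → H) (χ : κ → G n),
    ‖∑ i ∈ s, cr n (f i) (χ i)‖ ^ 2 ≤
      (n + 1) * (∑ i ∈ s, ∑ j ∈ s, ⟪f i, f j⟫_ℂ * ⟪χ i, χ j⟫_ℂ).re
  vac : G 0
  norm_vac : ‖vac‖ = 1
  exists_smul_vac : ∀ φ : G 0, ∃ c : ℂ, φ = c • vac
  eq_zero_of_an : ∀ n (φ : G (n + 1)),
    (∀ f, ContinuousLinearMap.adjoint (cr n f) φ = 0) → φ = 0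

namespace CreationSystem

variable {H : Type u} [NormedAddCommGroup H] [InnerProductSpace ℂ H]
  {G : ℕ → Type*} [∀ n, NormedAddCommGroup (G n)] [∀ n, InnerProductSpace ℂ (G n)]
  [∀ n, CompleteSpace (G n)] (S : CreationSystem H G)

/-- The annihilation operator from `n + 1` to `n` particles. -/
def an (n : ℕ) (f : H) : G (n + 1) →L[ℂ] G n := ContinuousLinearMap.adjoint (S.cr n f)

theorem inner_an_left (n : ℕ) (f : H) (φ : G (n + 1)) (ψ : G n) :
    ⟪S.an n f φ, ψ⟫_ℂ = ⟪φ, S.cr n f ψ⟫_ℂ :=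
  ContinuousLinearMap.adjoint_inner_left _ _ _

theorem inner_an_right (n : ℕ) (f : H) (φ : G (n + 1)) (ψ : G n) :
    ⟪ψ, S.an n f φ⟫_ℂ = ⟪S.cr n f ψ, φ⟫_ℂ :=
  ContinuousLinearMap.adjoint_inner_right _ _ _

theorem an_add (n : ℕ) (f g : H) (φ : G (n + 1)) :
    S.an n (f + g) φ = S.an n f φ + S.an n g φ := by
  refine ext_inner_left ℂ fun ψ => ?_
  simp only [inner_an_right, inner_add_right, S.cr_add, inner_add_left]

theorem an_smul (n : ℕ) (c : ℂ) (f : H) (φ : G (n + 1)) :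
    S.an n (c • f) φ = starRingEnd ℂ c • S.an n f φ := by
  refine ext_inner_left ℂ fun ψ => ?_
  simp only [inner_an_right, inner_smul_right, S.cr_smul, inner_smul_left]

@[simp] theorem cr_zero (n : ℕ) : S.cr n 0 = 0 := by
  ext φ
  simpa using S.cr_smul n 0 0 φ

@[simp] theorem an_zero (n : ℕ) : S.an n 0 = 0 := by
  ext φ
  simpa using S.an_smul n 0 0 φ

theorem an_comm (n : ℕ) (f g : H) (φ : G (n + 2)) :
    S.an n f (S.an (n + 1) g φ) = S.an n g (S.an (n + 1) f φ) := by
  refine ext_inner_left ℂ fun ψ => ?_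
  simp only [inner_an_right, S.cr_comm]

theorem norm_cr_le (n : ℕ) (g : H) (φ : G n) : ‖S.cr n g φ‖ ≤ Real.sqrt (n + 1) * ‖g‖ * ‖φ‖ := by
  have h := S.norm_sq_sum_cr_le n {PUnit.unit} (fun _ => g) (fun _ => φ)
  simp only [Finset.sum_singleton, inner_self_eq_norm_sq_to_K] at h
  refine le_of_sq_le_sq ?_ (by positivity)
  rw [mul_pow, mul_pow, Real.sq_sqrt (by positivity)]
  refine h.trans_eq ?_
  have : ((‖g‖ : ℂ) ^ 2 * (‖φ‖ : ℂ) ^ 2).re = ‖g‖ ^ 2 * ‖φ‖ ^ 2 := by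
    rw [← Complex.ofReal_pow, ← Complex.ofReal_pow, ← Complex.ofReal_mul, Complex.ofReal_re]
  rw [mul_assoc]
  exact congrArg _ this

theorem norm_an_le (n : ℕ) (f : H) (φ : G (n + 1)) :
    ‖S.an n f φ‖ ≤ Real.sqrt (n + 1) * ‖f‖ * ‖φ‖ := by
  have h : ‖S.an n f‖ ≤ Real.sqrt (n + 1) * ‖f‖ := by
    rw [an, LinearIsometryEquiv.norm_map]
    exact ContinuousLinearMap.opNorm_le_bound _ (by positivity) fun φ => S.norm_cr_le n f φ
  exact (S.an n f).le_of_opNorm_le h φ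

/-! ### Field operators on formal sequences -/

/-- The creation operator on arbitrary sequences of `n`-particle vectors. -/
def crS (g : H) : (∀ n, G n) →ₗ[ℂ] (∀ n, G n) where
  toFun ψ n := match n with
    | 0 => 0
    | n + 1 => S.cr n g (ψ n)
  map_add' φ ψ := by funext n; cases n <;> simp
  map_smul' c ψ := by funext n; cases n <;> simp

/-- The annihilation operator on arbitrary sequences of `n`-particle vectors. -/
def anS (f : H) : (∀ n, G n) →ₗ[ℂ] (∀ n, G n) where
  toFun ψ n := S.an n f (ψ (n + 1))
  map_add' φ ψ := by funext n; simp
  map_smul' c ψ := by funext n; simp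

@[simp] theorem crS_zero (g : H) (ψ : ∀ n, G n) : S.crS g ψ 0 = 0 := rfl

@[simp] theorem crS_succ (g : H) (ψ : ∀ n, G n) (n : ℕ) :
    S.crS g ψ (n + 1) = S.cr n g (ψ n) := rfl

@[simp] theorem anS_apply (f : H) (ψ : ∀ n, G n) (n : ℕ) :
    S.anS f ψ n = S.an n f (ψ (n + 1)) := rfl

/-- The field operator `a(f) + a*(g)` on arbitrary sequences of `n`-particle vectors. -/
def fld (f g : H) : (∀ n, G n) →ₗ[ℂ] (∀ n, G n) := S.anS f + S.crS g

theorem fld_apply (f g : H) (ψ : ∀ n, G n) : S.fld f g ψ = S.anS f ψ + S.crS g ψ := rfl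

theorem crS_add (f g : H) : S.crS (f + g) = S.crS f + S.crS g := by
  refine LinearMap.ext fun ψ => funext fun n => ?_
  cases n <;> simp [S.cr_add]

theorem anS_add (f g : H) : S.anS (f + g) = S.anS f + S.anS g := by
  refine LinearMap.ext fun ψ => funext fun n => ?_
  simp [S.an_add]

theorem crS_smul (c : ℂ) (f : H) : S.crS (c • f) = c • S.crS f := by
  refine LinearMap.ext fun ψ => funext fun n => ?_
  cases n <;> simp [S.cr_smul]

theorem fld_add (f f' g g' : H) : S.fld (f + f') (g + g') = S.fld f g + S.fld f' g' := by
  simp only [fld, crS_add, anS_add]; abel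

theorem crS_comm (f g : H) (ψ : ∀ n, G n) : S.crS f (S.crS g ψ) = S.crS g (S.crS f ψ) := by
  funext n
  rcases n with _ | _ | n
  · rfl
  · simp
  · simp [S.cr_comm n f g]

theorem anS_comm (f g : H) (ψ : ∀ n, G n) : S.anS f (S.anS g ψ) = S.anS g (S.anS f ψ) := by
  funext n
  simp [S.an_comm n f g]

theorem anS_crS (f g : H) (ψ : ∀ n, G n) :
    S.anS f (S.crS g ψ) = ⟪f, g⟫_ℂ • ψ + S.crS g (S.anS f ψ) := by
  funext n
  rcases n with _ | n
  · simpa [an] using S.ccr_zero f g (ψ 0)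
  · simpa [an] using S.ccr_succ n f g (ψ (n + 1))

theorem fld_fld (f g f' g' : H) (ψ : ∀ n, G n) :
    S.fld f g (S.fld f' g' ψ) =
      (⟪f, g'⟫_ℂ - ⟪f', g⟫_ℂ) • ψ + S.fld f' g' (S.fld f g ψ) := by
  simp only [fld_apply, map_add, anS_crS, S.anS_comm f f', S.crS_comm g g', sub_smul]
  abel

/-! ### Rapidly decreasing vectors -/

variable (G) in
/-- The sequences of `n`-particle vectors which decrease faster than any power of `n`. -/
def rapid : Submodule ℂ (∀ n, G n) where
  carrier := {ψ | ∀ k : ℕ, ∃ C : ℝ, ∀ n : ℕ, ((n : ℝ) + 1) ^ k * ‖ψ n‖ ≤ C}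
  add_mem' {φ ψ} hφ hψ k := by
    obtain ⟨C, hC⟩ := hφ k
    obtain ⟨C', hC'⟩ := hψ k
    refine ⟨C + C', fun n => ?_⟩
    calc ((n : ℝ) + 1) ^ k * ‖φ n + ψ n‖ ≤ ((n : ℝ) + 1) ^ k * (‖φ n‖ + ‖ψ n‖) := by
          gcongr; exact norm_add_le _ _
      _ ≤ C + C' := by rw [mul_add]; exact add_le_add (hC n) (hC' n)
  zero_mem' k := ⟨0, fun n => by simp⟩
  smul_mem' c ψ hψ k := by
    obtain ⟨C, hC⟩ := hψ k
    refine ⟨‖c‖ * C, fun n => ?_⟩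
    rw [Pi.smul_apply, norm_smul, mul_left_comm]
    exact mul_le_mul_of_nonneg_left (hC n) (norm_nonneg _)

theorem sqrt_natCast_succ_le (n : ℕ) : Real.sqrt (n + 1) ≤ n + 1 :=
  Real.sqrt_le_iff.2 ⟨by positivity, by nlinarith [n.cast_nonneg (α := ℝ)]⟩

theorem anS_mem_rapid (f : H) {ψ : ∀ n, G n} (hψ : ψ ∈ rapid G) : S.anS f ψ ∈ rapid G := by
  intro k
  obtain ⟨C, hC⟩ := hψ (k + 1)
  refine ⟨‖f‖ * C, fun n => ?_⟩
  have h1 := S.norm_an_le n f (ψ (n + 1))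
  have h2 : Real.sqrt (n + 1) ≤ n + 1 := sqrt_natCast_succ_le n
  have h3 := hC (n + 1)
  push_cast at h3
  calc ((n : ℝ) + 1) ^ k * ‖S.an n f (ψ (n + 1))‖
      ≤ ((n : ℝ) + 1) ^ k * ((n + 1) * ‖f‖ * ‖ψ (n + 1)‖) := by
        gcongr; exact h1.trans (by gcongr)
    _ = ‖f‖ * (((n : ℝ) + 1) ^ (k + 1) * ‖ψ (n + 1)‖) := by ring
    _ ≤ ‖f‖ * (((n : ℝ) + 1 + 1) ^ (k + 1) * ‖ψ (n + 1)‖) := by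
        gcongr; linarith
    _ ≤ ‖f‖ * C := by gcongr

theorem crS_mem_rapid (g : H) {ψ : ∀ n, G n} (hψ : ψ ∈ rapid G) : S.crS g ψ ∈ rapid G := by
  intro k
  obtain ⟨C, hC⟩ := hψ (k + 1)
  have hC0 : 0 ≤ C := le_trans (by positivity) (hC 0)
  refine ⟨2 ^ k * ‖g‖ * C, fun n => ?_⟩
  rcases n with _ | n
  · rw [crS_zero, norm_zero, mul_zero]; positivity
  have h1 := S.norm_cr_le n g (ψ n)
  have h2 : Real.sqrt (n + 1) ≤ n + 1 := sqrt_natCast_succ_le n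
  rw [crS_succ]
  push_cast
  calc ((n : ℝ) + 1 + 1) ^ k * ‖S.cr n g (ψ n)‖
      ≤ (2 * ((n : ℝ) + 1)) ^ k * ((n + 1) * ‖g‖ * ‖ψ n‖) := by
        gcongr
        · linarith [n.cast_nonneg (α := ℝ)]
        · exact h1.trans (by gcongr)
    _ = 2 ^ k * ‖g‖ * (((n : ℝ) + 1) ^ (k + 1) * ‖ψ n‖) := by rw [mul_pow]; ring
    _ ≤ 2 ^ k * ‖g‖ * C := by gcongr; exact hC n

theorem fld_mem_rapid (f g : H) {ψ : ∀ n, G n} (hψ : ψ ∈ rapid G) : S.fld f g ψ ∈ rapid G :=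
  Submodule.add_mem _ (S.anS_mem_rapid f hψ) (S.crS_mem_rapid g hψ)

theorem memℓp_of_mem_rapid {ψ : ∀ n, G n} (hψ : ψ ∈ rapid G) : Memℓp ψ 2 := by
  obtain ⟨C, hC⟩ := hψ 1
  have hC0 : 0 ≤ C := le_trans (by positivity) (hC 0)
  refine memℓp_gen ?_
  have hs : Summable fun n : ℕ => C ^ 2 * (1 / ((n : ℝ) + 1) ^ 2) := by
    refine Summable.mul_left _ ?_
    have := (summable_nat_add_iff 1).2 (Real.summable_one_div_nat_pow.2 one_lt_two)
    simpa using this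
  refine Summable.of_nonneg_of_le (fun n => by positivity) (fun n => ?_) hs
  have h := hC n
  rw [pow_one] at h
  have hn : (0 : ℝ) < (n : ℝ) + 1 := by positivity
  have : ‖ψ n‖ ≤ C / ((n : ℝ) + 1) := by rw [le_div_iff₀ hn]; linarith
  simp only [ENNReal.toReal_ofNat, Real.rpow_ofNat]
  calc ‖ψ n‖ ^ 2 ≤ (C / ((n : ℝ) + 1)) ^ 2 := by gcongr
    _ = _ := by rw [div_pow, mul_one_div]

variable (G) in
/-- The embedding of the rapidly decreasing sequences into the Hilbert space direct sum. -/
def toLp : rapid G →ₗ[ℂ] lp G 2 where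
  toFun ψ := ⟨ψ.1, memℓp_of_mem_rapid ψ.2⟩
  map_add' _ _ := rfl
  map_smul' _ _ := rfl

@[simp] theorem toLp_apply (ψ : rapid G) (n : ℕ) : toLp G ψ n = ψ.1 n := rfl

/-- The field operator on rapidly decreasing vectors. -/
def fldD (f g : H) : rapid G →ₗ[ℂ] rapid G := (S.fld f g).restrict fun _ h => S.fld_mem_rapid f g h

@[simp] theorem coe_fldD (f g : H) (ψ : rapid G) : (S.fldD f g ψ : ∀ n, G n) = S.fld f g ψ := rfl

theorem hasSum_inner_crS (g : H) (φ ψ : ∀ n, G n) (s : ℂ) :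
    HasSum (fun n => ⟪S.crS g φ n, ψ n⟫_ℂ) s ↔ HasSum (fun n => ⟪φ n, S.anS g ψ n⟫_ℂ) s := by
  have h := hasSum_nat_add_iff' (f := fun n => ⟪S.crS g φ n, ψ n⟫_ℂ) (g := s) 1
  simp only [Finset.range_one, Finset.sum_singleton, crS_zero, inner_zero_left, sub_zero,
    crS_succ, ← inner_an_right] at h
  exact h.symm

theorem hasSum_inner_anS (f : H) (φ ψ : ∀ n, G n) (s : ℂ) :
    HasSum (fun n => ⟪S.anS f φ n, ψ n⟫_ℂ) s ↔ HasSum (fun n => ⟪φ n, S.crS f ψ n⟫_ℂ) s := by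
  have h := hasSum_nat_add_iff' (f := fun n => ⟪φ n, S.crS f ψ n⟫_ℂ) (g := s) 1
  simp only [Finset.range_one, Finset.sum_singleton, crS_zero, inner_zero_right, sub_zero,
    crS_succ, ← inner_an_left] at h
  exact h

/-- Integration by parts: no domain condition on `ψ` is needed if `φ` decreases rapidly. -/
theorem hasSum_inner_fld (f g : H) (φ : rapid G) (ψ : lp G 2) :
    HasSum (fun n => ⟪φ.1 n, S.fld f g ψ n⟫_ℂ) ⟪toLp G (S.fldD g f φ), ψ⟫_ℂ := by
  have h1 := lp.hasSum_inner (𝕜 := ℂ) (toLp G ⟨_, S.anS_mem_rapid g φ.2⟩) ψ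
  have h2 := lp.hasSum_inner (𝕜 := ℂ) (toLp G ⟨_, S.crS_mem_rapid f φ.2⟩) ψ
  simp only [toLp_apply] at h1 h2
  rw [hasSum_inner_anS] at h1
  rw [hasSum_inner_crS] at h2
  have h := h1.add h2
  rw [← inner_add_left, ← map_add] at h
  simp only [← inner_add_right] at h
  rw [fld_apply, add_comm]
  exact h

theorem inner_fldD (f g : H) (φ : rapid G) {ψ χ : lp G 2} (h : ∀ n, S.fld f g ψ n = χ n) :
    ⟪toLp G (S.fldD g f φ), ψ⟫_ℂ = ⟪toLp G φ, χ⟫_ℂ := by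
  have h1 := S.hasSum_inner_fld f g φ ψ
  simp only [h] at h1
  exact h1.unique (lp.hasSum_inner (𝕜 := ℂ) (toLp G φ) χ)

end CreationSystem

/-! ### Isometries between families with the same Gram matrix -/

/-- A family with dense span is mapped isometrically onto any family with the same Gram matrix. -/
theorem exists_linearIsometry_of_inner_eq {E F ι : Type*} [NormedAddCommGroup E]
    [InnerProductSpace ℂ E] [NormedAddCommGroup F] [InnerProductSpace ℂ F] [CompleteSpace F]
    (v : ι → E) (w : ι → F) (h : ∀ i j, ⟪v i, v j⟫_ℂ = ⟪w i, w j⟫_ℂ)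
    (hd : Dense (Submodule.span ℂ (Set.range v) : Set E)) :
    ∃ U : E →ₗᵢ[ℂ] F, ∀ i, U (v i) = w i := by
  set Lv := Finsupp.linearCombination ℂ v
  set Lw := Finsupp.linearCombination ℂ w
  have hn : ∀ x, ‖Lw x‖ = ‖Lv x‖ := by
    intro x
    have : ⟪Lw x, Lw x⟫_ℂ = ⟪Lv x, Lv x⟫_ℂ := by
      simp only [Lv, Lw, Finsupp.linearCombination_apply, Finsupp.sum, inner_sum, sum_inner,
        inner_smul_left, inner_smul_right, h]
    rw [inner_self_eq_norm_sq_to_K, inner_self_eq_norm_sq_to_K] at this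
    have h2 : ‖Lw x‖ ^ 2 = ‖Lv x‖ ^ 2 := by exact_mod_cast this
    exact (pow_left_inj₀ (norm_nonneg _) (norm_nonneg _) two_ne_zero).1 h2
  have hdr : DenseRange Lv := by
    have : Set.range Lv = (Submodule.span ℂ (Set.range v) : Set E) := by
      rw [← Finsupp.range_linearCombination]; rfl
    rw [DenseRange, this]
    exact hd
  have hb : ∃ C, ∀ x, ‖Lw x‖ ≤ C * ‖Lv x‖ := ⟨1, fun x => by rw [hn, one_mul]⟩
  have hU : ∀ x, Lw.extendOfNorm Lv (Lv x) = Lw x := LinearMap.extendOfNorm_eq hdr hb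
  refine ⟨⟨(Lw.extendOfNorm Lv).toLinearMap, fun x => ?_⟩, fun i => ?_⟩
  · induction x using hdr.induction_on with
    | hp => exact isClosed_eq (by fun_prop) (by fun_prop)
    | ih x =>
      rw [← hn, ← hU]; rfl
  · have := hU (Finsupp.single i 1)
    simpa [Lv, Lw] using this

/-! ### Words in the creation operators -/

/-- A pair `(u, v)` of a linear and a conjugate linear map for which
`(f, g) ↦ (u f + v g, v f + u g)` preserves the canonical commutation relations. -/
structure BogPair (H : Type*) [NormedAddCommGroup H] [InnerProductSpace ℂ H] where
  u : H →L[ℂ] H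
  v : H →L⋆[ℂ] H
  inner_sub : ∀ f g, ⟪u f, u g⟫_ℂ - ⟪v g, v f⟫_ℂ = ⟪f, g⟫_ℂ
  inner_symm : ∀ f g, ⟪u f, v g⟫_ℂ = ⟪u g, v f⟫_ℂ

/-- The trivial Bogoliubov pair. -/
def BogPair.id (H : Type*) [NormedAddCommGroup H] [InnerProductSpace ℂ H] : BogPair H where
  u := ContinuousLinearMap.id ℂ H
  v := 0
  inner_sub f g := by simp
  inner_symm f g := by simp

namespace CreationSystem

variable {H : Type u} [NormedAddCommGroup H] [InnerProductSpace ℂ H]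
  {G : ℕ → Type*} [∀ n, NormedAddCommGroup (G n)] [∀ n, InnerProductSpace ℂ (G n)]
  [∀ n, CompleteSpace (G n)] (S : CreationSystem H G) (p q : BogPair H)

/-- The transformed field operator on rapidly decreasing vectors. -/
def bfld (f g : H) : rapid G →ₗ[ℂ] rapid G := S.fldD (p.u f + p.v g) (p.v f + p.u g)

theorem bfld_eq_add (f g : H) (ψ : rapid G) :
    S.bfld p f g ψ = S.bfld p f 0 ψ + S.bfld p 0 g ψ := by
  refine Subtype.ext ?_
  have h := S.fld_add (p.u f) (p.v g) (p.v f) (p.u g)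
  simp only [bfld, map_zero, zero_add, add_zero, Submodule.coe_add, coe_fldD, h,
    LinearMap.add_apply]

theorem bfld_comm (f g : H) (ψ : rapid G) :
    S.bfld p f 0 (S.bfld p 0 g ψ) = ⟪f, g⟫_ℂ • ψ + S.bfld p 0 g (S.bfld p f 0 ψ) := by
  refine Subtype.ext ?_
  simp only [bfld, map_zero, zero_add, add_zero, Submodule.coe_add, coe_fldD, Submodule.coe_smul]
  rw [S.fld_fld, p.inner_sub]

theorem inner_bfld (f g : H) (φ ψ : rapid G) :
    ⟪toLp G (S.bfld p g f φ), toLp G ψ⟫_ℂ = ⟪toLp G φ, toLp G (S.bfld p f g ψ)⟫_ℂ := by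
  have h := S.inner_fldD (p.u f + p.v g) (p.v f + p.u g) φ (ψ := toLp G ψ)
    (χ := toLp G (S.bfld p f g ψ)) fun n => rfl
  rw [← h, bfld, add_comm (p.u g), add_comm (p.v g)]

/-- The vector obtained by applying transformed creation operators to `Ω`. -/
def word (Ω : rapid G) : List H → rapid G
  | [] => Ω
  | g :: l => S.bfld p 0 g (word Ω l)

/-- The formal expansion of `a(f) a*(g₁) ⋯ a*(gₙ) Ω` into words. -/
def contraction (f : H) : List H → (List H →₀ ℂ)
  | [] => 0
  | g :: l => Finsupp.single l ⟪f, g⟫_ℂ + Finsupp.mapDomain (List.cons g) (contraction f l)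

/-- `Ω` is a vacuum vector for the transformed annihilation operators. -/
def IsVacuum (Ω : rapid G) : Prop := ∀ f, S.bfld p f 0 Ω = 0

variable {p}

theorem bfld_word {Ω : rapid G} (hΩ : S.IsVacuum p Ω) (f : H) (l : List H) :
    S.bfld p f 0 (S.word p Ω l) =
      Finsupp.linearCombination ℂ (S.word p Ω) (contraction f l) := by
  induction l with
  | nil => simpa [word, contraction] using hΩ f
  | cons g l ih =>
    rw [word, bfld_comm, ih, contraction, map_add, Finsupp.linearCombination_single,
      Finsupp.linearCombination_mapDomain]
    congr 1
    simp only [Finsupp.linearCombination_apply, Finsupp.sum, map_sum, map_smul]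
    rfl

/-- The inner products of words in a vacuum vector are determined by the commutation relations. -/
theorem inner_word_eq {Ω Ω' : rapid G} (hΩ : S.IsVacuum p Ω) (hΩ' : S.IsVacuum q Ω')
    (hn : ‖toLp G Ω‖ = ‖toLp G Ω'‖) (l l' : List H) :
    ⟪toLp G (S.word p Ω l), toLp G (S.word p Ω l')⟫_ℂ =
      ⟪toLp G (S.word q Ω' l), toLp G (S.word q Ω' l')⟫_ℂ := by
  induction l generalizing l' with
  | nil =>
    cases l' with
    | nil => simp only [word, inner_self_eq_norm_sq_to_K, hn]
    | cons g l' =>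
      simp only [word]
      rw [← inner_bfld, ← inner_bfld, hΩ g, hΩ' g, map_zero, inner_zero_left, inner_zero_left]
  | cons f l ih =>
    rw [word, word, inner_bfld, inner_bfld, S.bfld_word hΩ, S.bfld_word hΩ']
    simp only [Finsupp.linearCombination_apply, Finsupp.sum, map_sum, map_smul, inner_sum,
      inner_smul_right, ih]

/-! ### The Fock vacuum -/

/-- The vacuum vector. -/
def vacuum : rapid G :=
  ⟨Pi.single 0 S.vac, fun k => ⟨1, fun n => by
    rcases n with _ | n
    · simp [S.norm_vac]
    · simp⟩⟩

theorem isVacuum_vacuum : S.IsVacuum (BogPair.id H) S.vacuum := by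
  intro f
  refine Subtype.ext (funext fun n => ?_)
  cases n <;> simp [bfld, BogPair.id, fld_apply, vacuum]

theorem norm_vacuum : ‖toLp G S.vacuum‖ = 1 := by
  have : toLp G S.vacuum = lp.single 2 0 S.vac := rfl
  rw [this, lp.norm_single (by norm_num), S.norm_vac]

theorem bfld_id (f g : H) (ψ : rapid G) : S.bfld (BogPair.id H) f g ψ = S.fldD f g ψ := by
  simp [bfld, BogPair.id]

/-- The Fock words `a*(g₁) ⋯ a*(gₙ) Ω`. -/
abbrev fockWord : List H → rapid G := S.word (BogPair.id H) S.vacuum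

theorem fockWord_cons_zero (g : H) (l : List H) : (S.fockWord (g :: l)).1 0 = 0 := by
  rw [fockWord, word, bfld_id]
  simp [fld_apply]

theorem fockWord_cons_succ (g : H) (l : List H) (n : ℕ) :
    (S.fockWord (g :: l)).1 (n + 1) = S.cr n g ((S.fockWord l).1 n) := by
  rw [fockWord, word, bfld_id]
  simp [fld_apply]

theorem fockWord_apply_of_ne (l : List H) {n : ℕ} (h : n ≠ l.length) :
    (S.fockWord l).1 n = 0 := by
  induction l generalizing n with
  | nil => exact Pi.single_eq_of_ne h _
  | cons g l ih =>
    rcases n with _ | n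
    · exact S.fockWord_cons_zero g l
    · rw [fockWord_cons_succ, ih (by simpa using h), map_zero]

/-- The `n`-particle components of the words of length `n` are total in the `n`-particle sector. -/
theorem eq_zero_of_inner_fockWord {n : ℕ} {η : G n}
    (h : ∀ l : List H, l.length = n → ⟪(S.fockWord l).1 n, η⟫_ℂ = 0) : η = 0 := by
  induction n with
  | zero =>
    obtain ⟨c, rfl⟩ := S.exists_smul_vac η
    have h0 := h [] rfl
    have h1 : (S.fockWord []).1 0 = S.vac :=
      Pi.single_eq_same (M := G) 0 S.vac
    rw [h1, inner_smul_right, inner_self_eq_norm_sq_to_K, S.norm_vac] at h0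
    have : c = 0 := by simpa using h0
    rw [this, zero_smul]
  | succ n ih =>
    refine S.eq_zero_of_an n η fun f => ih fun l hl => ?_
    have := h (f :: l) (by simp [hl])
    rw [fockWord_cons_succ, ← inner_an_right] at this
    exact this

theorem hasSum_inner_fockWord (l : List H) (ξ : ∀ n, G n) :
    HasSum (fun n => ⟪(S.fockWord l).1 n, ξ n⟫_ℂ)
      ⟪(S.fockWord l).1 l.length, ξ l.length⟫_ℂ :=
  hasSum_single _ fun n hn => by rw [S.fockWord_apply_of_ne l hn, inner_zero_left]

theorem dense_span_fockWord :
    Dense (Submodule.span ℂ (Set.range fun l => toLp G (S.fockWord l)) : Set (lp G 2)) := by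
  rw [Submodule.dense_iff_topologicalClosure_eq_top, Submodule.topologicalClosure_eq_top_iff,
    Submodule.eq_bot_iff]
  intro η hη
  refine lp.ext (funext fun n => S.eq_zero_of_inner_fockWord fun l hl => ?_)
  subst hl
  have h1 := Submodule.inner_right_of_mem_orthogonal
    (Submodule.subset_span (Set.mem_range_self (f := fun l => toLp G (S.fockWord l)) l)) hη
  rw [← h1]
  exact (S.hasSum_inner_fockWord l η).unique (lp.hasSum_inner (𝕜 := ℂ) (toLp G (S.fockWord l)) η)

/-- The field operator on its maximal domain is determined by testing against Fock words. -/
theorem fld_eq_of_inner_fockWord {f g : H} {η χ : lp G 2}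
    (h : ∀ l, ⟪toLp G (S.fldD g f (S.fockWord l)), η⟫_ℂ = ⟪toLp G (S.fockWord l), χ⟫_ℂ) (n : ℕ) :
    S.fld f g η n = χ n := by
  rw [← sub_eq_zero]
  refine S.eq_zero_of_inner_fockWord fun l hl => ?_
  subst hl
  have h1 := (S.hasSum_inner_fockWord l (S.fld f g η)).unique (S.hasSum_inner_fld f g _ η)
  have h2 := (S.hasSum_inner_fockWord l χ).unique
    (lp.hasSum_inner (𝕜 := ℂ) (toLp G (S.fockWord l)) χ)
  rw [inner_sub_right, h1, h2, h, sub_self]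

/-! ### Implementation of Bogoliubov transformations with a vacuum -/

variable {q}

/-- The isometry mapping Fock words to transformed words. -/
theorem exists_isometry_word {Ω : rapid G} (hΩ : S.IsVacuum p Ω) (hn : ‖toLp G Ω‖ = 1) :
    ∃ U : lp G 2 →ₗᵢ[ℂ] lp G 2,
      ∀ l, U (toLp G (S.fockWord l)) = toLp G (S.word p Ω l) :=
  exists_linearIsometry_of_inner_eq _ _
    (S.inner_word_eq p S.isVacuum_vacuum hΩ (by rw [hn, norm_vacuum])) S.dense_span_fockWord

section Intertwining

variable {Ω : rapid G} (hΩ : S.IsVacuum p Ω) {U : lp G 2 →ₗᵢ[ℂ] lp G 2}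
  (hU : ∀ l, U (toLp G (S.fockWord l)) = toLp G (S.word p Ω l))

include hΩ hU

theorem isometry_fldD_fockWord (f g : H) (l : List H) :
    U (toLp G (S.fldD f g (S.fockWord l))) = toLp G (S.bfld p f g (S.word p Ω l)) := by
  rw [← bfld_id, bfld_eq_add, S.bfld_eq_add p, map_add, map_add, map_add]
  congr 1
  · rw [S.bfld_word S.isVacuum_vacuum, S.bfld_word hΩ]
    simp only [Finsupp.linearCombination_apply, Finsupp.sum, map_sum, map_smul]
    exact Finset.sum_congr rfl fun l _ => by rw [← hU]
  · exact hU (g :: l)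

/-- The adjoint of the isometry intertwines the transformed field operators with the original ones;
the maximal domain matters here, as the adjoint need not preserve rapid decrease. -/
theorem fld_adjoint_isometry (f g : H) (φ : rapid G) (n : ℕ) :
    S.fld f g (ContinuousLinearMap.adjoint U.toContinuousLinearMap (toLp G φ)) n =
      ContinuousLinearMap.adjoint U.toContinuousLinearMap (toLp G (S.bfld p f g φ)) n := by
  refine S.fld_eq_of_inner_fockWord (fun l => ?_) n
  rw [ContinuousLinearMap.adjoint_inner_right, ContinuousLinearMap.adjoint_inner_right,
    LinearIsometry.coe_toContinuousLinearMap, S.isometry_fldD_fockWord hΩ hU, hU, inner_bfld]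

/-- The isometry intertwines the field operators on rapidly decreasing vectors. -/
theorem fld_isometry (f g : H) (ψ : rapid G) (n : ℕ) :
    S.fld (p.u f + p.v g) (p.v f + p.u g) (U (toLp G ψ)) n = U (toLp G (S.fldD f g ψ)) n := by
  refine S.fld_eq_of_inner_fockWord (fun l => ?_) n
  have e : S.fldD (p.v f + p.u g) (p.u f + p.v g) = S.bfld p g f := by
    rw [bfld, add_comm (p.u g), add_comm (p.v g)]
  have h := S.inner_fldD g f ψ (fun n => S.fld_adjoint_isometry hΩ hU g f (S.fockWord l) n)
  rw [ContinuousLinearMap.adjoint_inner_right, ContinuousLinearMap.adjoint_inner_right,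
    LinearIsometry.coe_toContinuousLinearMap] at h
  rw [e, ← inner_conj_symm, ← h, inner_conj_symm]

end Intertwining

/-- The vacuum is, up to scalars, the only vector annihilated by all `a(f)`. -/
theorem eq_smul_vacuum {ξ : lp G 2} (h : ∀ f n, S.fld f 0 ξ n = 0) :
    ∃ c : ℂ, ξ = c • toLp G S.vacuum := by
  obtain ⟨c, hc⟩ := S.exists_smul_vac (ξ 0)
  refine ⟨c, lp.ext (funext fun n => ?_)⟩
  rcases n with _ | n
  · simpa [vacuum] using hc
  · have : ξ (n + 1) = 0 := by
      refine S.eq_zero_of_an n _ fun f => ?_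
      have h1 := h f n
      have h2 : S.crS (0 : H) = 0 := by simpa using S.crS_smul 0 0
      rw [fld_apply, h2, LinearMap.zero_apply, add_zero] at h1
      exact h1
    simp [this, vacuum]

/-- Two Bogoliubov pairs which are inverse to each other and both have a vacuum vector are
implemented by a unitary, as an identity of operators on their maximal domains. -/
theorem exists_unitary {Ω Ω' : rapid G} (hΩ : S.IsVacuum p Ω) (hn : ‖toLp G Ω‖ = 1)
    (hΩ' : S.IsVacuum q Ω') (hn' : ‖toLp G Ω'‖ = 1)
    (hu : ∀ f, p.u (q.u f) + p.v (q.v f) = f) (hv : ∀ f, p.v (q.u f) + p.u (q.v f) = 0) :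
    ∃ U : lp G 2 ≃ₗᵢ[ℂ] lp G 2, ∀ (f g : H) (ψ χ : lp G 2),
      (∀ n, S.fld (p.u f + p.v g) (p.v f + p.u g) (U ψ) n = U χ n) ↔
        ∀ n, S.fld f g ψ n = χ n := by
  obtain ⟨U, hU⟩ := S.exists_isometry_word hΩ hn
  obtain ⟨W, hW⟩ := S.exists_isometry_word hΩ' hn'
  -- the transformation of the pair `(f, g)` by `q` and then by `p` is trivial
  have hpq : ∀ f g (ψ : rapid G) n,
      S.fld f g (U (toLp G ψ)) n = U (toLp G (S.bfld q f g ψ)) n := by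
    intro f g ψ n
    have h := S.fld_isometry hΩ hU (q.u f + q.v g) (q.v f + q.u g) ψ n
    have e1 : p.u (q.u f + q.v g) + p.v (q.v f + q.u g) = f := by
      rw [map_add, map_add]
      calc _ = (p.u (q.u f) + p.v (q.v f)) + (p.v (q.u g) + p.u (q.v g)) := by abel
        _ = f := by rw [hu, hv, add_zero]
    have e2 : p.v (q.u f + q.v g) + p.u (q.v f + q.u g) = g := by
      rw [map_add, map_add]
      calc _ = (p.u (q.u g) + p.v (q.v g)) + (p.v (q.u f) + p.u (q.v f)) := by abel
        _ = g := by rw [hu, hv, add_zero]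
    rw [e1, e2] at h
    exact h
  -- `U Ω'` is annihilated by every `a(f)`
  obtain ⟨c, hc⟩ : ∃ c : ℂ, U (toLp G Ω') = c • toLp G S.vacuum := by
    refine S.eq_smul_vacuum fun f n => ?_
    rw [hpq, hΩ' f]
    simp
  have hword : ∀ l, U (W (toLp G (S.fockWord l))) = c • toLp G (S.fockWord l) := by
    intro l
    rw [hW]
    induction l with
    | nil => exact hc
    | cons g l ih =>
      refine lp.ext (funext fun n => ?_)
      rw [word, ← hpq, ih]
      have : (⇑(c • toLp G (S.fockWord l)) : ∀ n, G n) = c • (S.fockWord l).1 := rfl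
      rw [this, map_smul]
      have h2 : S.fld 0 g (S.fockWord l).1 = (S.fockWord (g :: l)).1 := by
        rw [fockWord, word, bfld_id]; rfl
      rw [h2]
      rfl
  have hUW : ∀ x, U (W x) = c • x := by
    have h1 : U.toContinuousLinearMap ∘L W.toContinuousLinearMap =
        c • ContinuousLinearMap.id ℂ (lp G 2) := by
      refine ContinuousLinearMap.ext_on S.dense_span_fockWord ?_
      rintro _ ⟨l, rfl⟩
      exact hword l
    exact fun x => congrArg (fun T => T x) h1
  have hc0 : c ≠ 0 := by
    rintro rfl
    have := U.norm_map (toLp G Ω')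
    rw [hc, zero_smul, norm_zero, hn'] at this
    exact zero_ne_one this
  have hsurj : Function.Surjective U := fun x => ⟨c⁻¹ • W x, by
    rw [map_smul, hUW, inv_smul_smul₀ hc0]⟩
  refine ⟨LinearIsometryEquiv.ofSurjective U hsurj, fun f g ψ χ => ⟨fun h n => ?_, fun h n => ?_⟩⟩
  · refine S.fld_eq_of_inner_fockWord (fun l => ?_) n
    have h1 := S.inner_fldD _ _ (S.word p Ω l) h
    rw [← U.inner_map_map, S.isometry_fldD_fockWord hΩ hU, ← U.inner_map_map _ χ, hU]
    rw [bfld, add_comm (p.u g), add_comm (p.v g)]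
    exact h1
  · refine S.fld_eq_of_inner_fockWord (fun l => ?_) n
    have e : S.fldD (p.v f + p.u g) (p.u f + p.v g) = S.bfld p g f := by
      rw [bfld, add_comm (p.u g), add_comm (p.v g)]
    set φ := c⁻¹ • S.word q Ω' l with hφ
    have hφU : toLp G (S.fockWord l) = U (toLp G φ) := by
      rw [hφ, map_smul, map_smul, ← hW, hUW, inv_smul_smul₀ hc0]
    have h2 : toLp G (S.bfld p g f (S.fockWord l)) = U (toLp G (S.fldD g f φ)) := by
      refine lp.ext (funext fun n => ?_)
      rw [← S.fld_isometry hΩ hU, ← hφU]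
      rfl
    rw [e, h2, hφU]
    change ⟪U _, U ψ⟫_ℂ = ⟪U _, U χ⟫_ℂ
    rw [U.inner_map_map, U.inner_map_map]
    exact S.inner_fldD f g φ h

end CreationSystem

/-! ### Quadratic estimates for creation operators -/

/-- An almost orthogonal series converges if its dominating series does. -/
theorem summable_of_norm_sq_sum_le {ι E : Type*} [NormedAddCommGroup E] [CompleteSpace E]
    {f : ι → E} {a : ι → ℝ} {C : ℝ} (ha : Summable a) (ha0 : ∀ i, 0 ≤ a i) (hC : 0 ≤ C)
    (h : ∀ s : Finset ι, ‖∑ i ∈ s, f i‖ ^ 2 ≤ C * ∑ i ∈ s, a i) :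
    Summable f ∧ ‖∑' i, f i‖ ^ 2 ≤ C * ∑' i, a i := by
  have hf : Summable f := by
    rw [summable_iff_vanishing_norm]
    intro ε hε
    obtain ⟨s, hs⟩ := (summable_iff_vanishing_norm.1 ha) (ε ^ 2 / (C + 1)) (by positivity)
    refine ⟨s, fun t ht => ?_⟩
    have h1 := hs t ht
    rw [Real.norm_of_nonneg (Finset.sum_nonneg fun i _ => ha0 i), lt_div_iff₀ (by positivity)] at h1
    have h2 : 0 ≤ ∑ i ∈ t, a i := Finset.sum_nonneg fun i _ => ha0 i
    refine lt_of_pow_lt_pow_left₀ 2 hε.le ((h t).trans_lt ?_)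
    nlinarith
  refine ⟨hf, le_of_tendsto ((continuous_norm.pow 2).tendsto _ |>.comp hf.hasSum)
    (Filter.Eventually.of_forall fun s => (h s).trans ?_)⟩
  exact mul_le_mul_of_nonneg_left (ha.sum_le_tsum s fun i _ => ha0 i) hC

theorem norm_sq_sum_smul_orthonormal {H ι : Type*} [NormedAddCommGroup H] [InnerProductSpace ℂ H]
    {e : ι → H} (he : Orthonormal ℂ e) (s : Finset ι) (c : ι → ℂ) :
    ‖∑ i ∈ s, c i • e i‖ ^ 2 = ∑ i ∈ s, ‖c i‖ ^ 2 := by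
  have h := he.inner_sum c c s
  rw [inner_self_eq_norm_sq_to_K] at h
  simp only [RCLike.conj_mul] at h
  exact_mod_cast h

/-- If `∑ cᵢ ⊗ fᵢ` is bounded by `k` on scalar coefficients, then it is so on coefficients in an
arbitrary Hilbert space: the difference of the two sides is a sum of entries of a Schur product of
positive semidefinite matrices. -/
theorem re_sum_inner_mul_inner_le {H E ι : Type*} [NormedAddCommGroup H] [InnerProductSpace ℂ H]
    [NormedAddCommGroup E] [InnerProductSpace ℂ E] {k : ℝ} (s : Finset ι) (f : ι → H) (χ : ι → E)
    (hf : ∀ c : ι → ℂ, ‖∑ i ∈ s, c i • f i‖ ^ 2 ≤ k ^ 2 * ∑ i ∈ s, ‖c i‖ ^ 2) :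
    (∑ i ∈ s, ∑ j ∈ s, ⟪f i, f j⟫_ℂ * ⟪χ i, χ j⟫_ℂ).re ≤ k ^ 2 * ∑ i ∈ s, ‖χ i‖ ^ 2 := by
  classical
  set M : Matrix s s ℂ := ((k ^ 2 : ℝ) : ℂ) • (1 : Matrix s s ℂ) - Matrix.gram ℂ fun i : s => f i
    with hM
  have hMpos : M.PosSemidef := by
    refine Matrix.PosSemidef.of_dotProduct_mulVec_nonneg ?_ fun x => ?_
    · refine Matrix.IsHermitian.sub ?_ (Matrix.posSemidef_gram ℂ _).1
      ext i j
      simp only [Matrix.conjTranspose_apply, Matrix.smul_apply, Matrix.one_apply, eq_comm (a := j)]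
      split_ifs <;> simp
    · have h1 : star x ⬝ᵥ (M.mulVec x) =
          ((k ^ 2 * ∑ i, ‖x i‖ ^ 2 - ‖∑ i : s, x i • f i‖ ^ 2 : ℝ) : ℂ) := by
        rw [hM, Matrix.sub_mulVec, dotProduct_sub, Matrix.smul_mulVec, Matrix.one_mulVec,
          dotProduct_smul]
        have e1 : star x ⬝ᵥ x = ((∑ i, ‖x i‖ ^ 2 : ℝ) : ℂ) := by
          simp only [dotProduct, Pi.star_apply, RCLike.star_def, RCLike.conj_mul]
          push_cast; rfl
        have e2 : star x ⬝ᵥ ((Matrix.gram ℂ fun i : s => f i).mulVec x) =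
            ((‖∑ i : s, x i • f i‖ ^ 2 : ℝ) : ℂ) := by
          have := inner_self_eq_norm_sq_to_K (𝕜 := ℂ) (∑ i : s, x i • f i)
          push_cast
          refine Eq.trans ?_ this
          simp only [dotProduct, Matrix.mulVec, Matrix.gram_apply, Pi.star_apply, RCLike.star_def,
            sum_inner, inner_sum, inner_smul_left, inner_smul_right, Finset.mul_sum]
          rw [Finset.sum_comm]
          refine Finset.sum_congr rfl fun i _ => Finset.sum_congr rfl fun j _ => by ring
        rw [e1, e2, smul_eq_mul]
        push_cast; rfl
      rw [h1]
      have h2 := hf fun i => if h : i ∈ s then x ⟨i, h⟩ else 0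
      rw [← Finset.sum_coe_sort s, ← Finset.sum_coe_sort s] at h2
      simp only [Finset.coe_mem, dite_true, Subtype.coe_eta] at h2
      exact_mod_cast sub_nonneg.2 h2
  have h := (hMpos.hadamard (Matrix.posSemidef_gram ℂ fun i : s => χ i)).dotProduct_mulVec_nonneg
    fun _ => 1
  have h' := (Complex.le_def.1 h).1
  have e : (star (fun _ : s => (1 : ℂ)) ⬝ᵥ
      ((M.hadamard (Matrix.gram ℂ fun i : s => χ i)).mulVec fun _ => 1)) =
      ((k ^ 2 * ∑ i ∈ s, ‖χ i‖ ^ 2 : ℝ) : ℂ) -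
        ∑ i ∈ s, ∑ j ∈ s, ⟪f i, f j⟫_ℂ * ⟪χ i, χ j⟫_ℂ := by
    simp only [dotProduct, Matrix.mulVec, Pi.star_apply, star_one, one_mul, mul_one,
      Matrix.hadamard_apply, hM, Matrix.sub_apply, Matrix.smul_apply, Matrix.one_apply,
      Matrix.gram_apply, sub_mul, Finset.sum_sub_distrib, smul_eq_mul, mul_ite, mul_zero, ite_mul,
      zero_mul, Finset.sum_ite_eq, Finset.mem_univ, if_true]
    congr 1
    · rw [← Finset.sum_coe_sort s, Finset.mul_sum]
      simp only [inner_self_eq_norm_sq_to_K]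
      push_cast; rfl
    · simp only [← Finset.sum_coe_sort s]
  rw [e, Complex.sub_re, Complex.ofReal_re, Complex.zero_re] at h'
  exact sub_nonneg.1 h'

namespace CreationSystem

variable {H : Type u} [NormedAddCommGroup H] [InnerProductSpace ℂ H]
  {G : ℕ → Type*} [∀ n, NormedAddCommGroup (G n)] [∀ n, InnerProductSpace ℂ (G n)]
  [∀ n, CompleteSpace (G n)] (S : CreationSystem H G)

/-- `‖∑ a*(fᵢ) χᵢ‖² ≤ (n + 1) k² ∑ ‖χᵢ‖²` whenever `c ↦ ∑ cᵢ fᵢ` has norm at most `k`. -/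
theorem norm_sq_sum_cr_le' {ι : Type u} {k : ℝ} (n : ℕ) (s : Finset ι) (f : ι → H) (χ : ι → G n)
    (hf : ∀ c : ι → ℂ, ‖∑ i ∈ s, c i • f i‖ ^ 2 ≤ k ^ 2 * ∑ i ∈ s, ‖c i‖ ^ 2) :
    ‖∑ i ∈ s, S.cr n (f i) (χ i)‖ ^ 2 ≤ (n + 1) * (k ^ 2 * ∑ i ∈ s, ‖χ i‖ ^ 2) :=
  (S.norm_sq_sum_cr_le n s f χ).trans
    (mul_le_mul_of_nonneg_left (re_sum_inner_mul_inner_le s f χ hf) (by positivity))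

/-- The bound dual to `norm_sq_sum_cr_le'`. -/
theorem sum_norm_sq_an_le {ι : Type u} {k : ℝ} (n : ℕ) (s : Finset ι) (f : ι → H) (φ : G (n + 1))
    (hf : ∀ c : ι → ℂ, ‖∑ i ∈ s, c i • f i‖ ^ 2 ≤ k ^ 2 * ∑ i ∈ s, ‖c i‖ ^ 2) :
    ∑ i ∈ s, ‖S.an n (f i) φ‖ ^ 2 ≤ k ^ 2 * (n + 1) * ‖φ‖ ^ 2 := by
  set T := ∑ i ∈ s, ‖S.an n (f i) φ‖ ^ 2 with hT
  set ψ := ∑ i ∈ s, S.cr n (f i) (S.an n (f i) φ) with hψ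
  have hT0 : 0 ≤ T := Finset.sum_nonneg fun i _ => by positivity
  have h1 : (T : ℂ) = ⟪ψ, φ⟫_ℂ := by
    rw [hψ, sum_inner, hT]
    push_cast
    refine Finset.sum_congr rfl fun i _ => ?_
    rw [← inner_an_right, inner_self_eq_norm_sq_to_K]
    rfl
  have h2 : T ≤ ‖ψ‖ * ‖φ‖ := by
    have := norm_inner_le_norm (𝕜 := ℂ) ψ φ
    rwa [← h1, Complex.norm_real, Real.norm_of_nonneg hT0] at this
  have h3 : ‖ψ‖ ^ 2 ≤ (n + 1) * (k ^ 2 * T) := S.norm_sq_sum_cr_le' n s f _ hf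
  rcases hT0.eq_or_lt with h | h
  · rw [← h]; positivity
  · have h4 : T ^ 2 ≤ (n + 1) * (k ^ 2 * T) * ‖φ‖ ^ 2 := by
      calc T ^ 2 ≤ (‖ψ‖ * ‖φ‖) ^ 2 := by gcongr
        _ = ‖ψ‖ ^ 2 * ‖φ‖ ^ 2 := by ring
        _ ≤ _ := by gcongr
    refine le_of_mul_le_mul_left ?_ h
    calc T * T = T ^ 2 := by ring
      _ ≤ _ := h4
      _ = _ := by ring

theorem norm_sq_cr_zero (g : H) (φ : G 0) : ‖S.cr 0 g φ‖ ^ 2 = ‖g‖ ^ 2 * ‖φ‖ ^ 2 := by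
  have h : ⟪S.cr 0 g φ, S.cr 0 g φ⟫_ℂ = ⟪g, g⟫_ℂ * ⟪φ, φ⟫_ℂ := by
    rw [← inner_an_right, an, S.ccr_zero, inner_smul_right]
  simp only [inner_self_eq_norm_sq_to_K] at h
  exact_mod_cast h

theorem norm_sq_cr_succ (n : ℕ) (g : H) (φ : G (n + 1)) :
    ‖S.cr (n + 1) g φ‖ ^ 2 = ‖g‖ ^ 2 * ‖φ‖ ^ 2 + ‖S.an n g φ‖ ^ 2 := by
  have h : ⟪S.cr (n + 1) g φ, S.cr (n + 1) g φ⟫_ℂ =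
      ⟪g, g⟫_ℂ * ⟪φ, φ⟫_ℂ + ⟪S.an n g φ, S.an n g φ⟫_ℂ := by
    rw [← inner_an_right, an, S.ccr_succ, inner_add_right, inner_smul_right, inner_an_left]
    rfl
  simp only [inner_self_eq_norm_sq_to_K] at h
  exact_mod_cast h

theorem sum_norm_sq_cr_le {ι : Type u} {k h : ℝ} (n : ℕ) (s : Finset ι) (f : ι → H) (φ : G n)
    (hf : ∀ c : ι → ℂ, ‖∑ i ∈ s, c i • f i‖ ^ 2 ≤ k ^ 2 * ∑ i ∈ s, ‖c i‖ ^ 2)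
    (hh : ∑ i ∈ s, ‖f i‖ ^ 2 ≤ h) :
    ∑ i ∈ s, ‖S.cr n (f i) φ‖ ^ 2 ≤ (k ^ 2 * n + h) * ‖φ‖ ^ 2 := by
  rcases n with _ | n
  · simp only [norm_sq_cr_zero, ← Finset.sum_mul, Nat.cast_zero, mul_zero, zero_add]
    gcongr
  · simp only [norm_sq_cr_succ, Finset.sum_add_distrib, ← Finset.sum_mul]
    have h1 := S.sum_norm_sq_an_le n s f φ hf
    have h2 := mul_le_mul_of_nonneg_right hh (sq_nonneg ‖φ‖)
    push_cast
    nlinarith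

/-- The creation operators applied to a fixed vector, as a function of the one-particle vector. -/
def crL (n : ℕ) (φ : G n) : H →L[ℂ] G (n + 1) :=
  LinearMap.mkContinuous
    { toFun := fun g => S.cr n g φ
      map_add' := fun f g => S.cr_add n f g φ
      map_smul' := fun c g => S.cr_smul n c g φ } (Real.sqrt (n + 1) * ‖φ‖) fun g => by
    have := S.norm_cr_le n g φ
    calc _ ≤ _ := this
      _ = _ := by ring

/-! ### Squeezed vacuum vectors -/

section Squeezed

variable {ι : Type u} (e : HilbertBasis ι ℂ H) (K : H →L⋆[ℂ] H)

theorem norm_sq_sum_conj_smul_le {k : ℝ} (hk : ∀ f, ‖K f‖ ≤ k * ‖f‖) (s : Finset ι)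
    (c : ι → ℂ) : ‖∑ i ∈ s, c i • K (e i)‖ ^ 2 ≤ k ^ 2 * ∑ i ∈ s, ‖c i‖ ^ 2 := by
  have h1 : ∑ i ∈ s, c i • K (e i) = K (∑ i ∈ s, starRingEnd ℂ (c i) • e i) := by
    rw [map_sum]
    refine Finset.sum_congr rfl fun i _ => ?_
    rw [map_smulₛₗ, Complex.conj_conj]
  have h2 : ‖∑ i ∈ s, starRingEnd ℂ (c i) • e i‖ ^ 2 = ∑ i ∈ s, ‖c i‖ ^ 2 := by
    rw [norm_sq_sum_smul_orthonormal e.orthonormal]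
    simp
  rw [h1, ← h2, ← mul_pow]
  exact pow_le_pow_left₀ (norm_nonneg _) (hk _) 2

variable {k : ℝ} (hk : ∀ f, ‖K f‖ ≤ k * ‖f‖) (hK : Summable fun i => ‖K (e i)‖ ^ 2)

include hk hK in
/-- Convergence of the pair creation operator `∑ a*(eᵢ) a*(K eᵢ)` on the `n`-particle sector. The
coefficient of `n` in the bound is `k ^ 2`, the square of the operator norm of `K`, while the
Hilbert–Schmidt norm enters only through the constant term. -/
theorem pairCreation_aux (n : ℕ) (φ : G n) :
    Summable (fun i => S.cr (n + 1) (e i) (S.cr n (K (e i)) φ)) ∧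
      ‖∑' i, S.cr (n + 1) (e i) (S.cr n (K (e i)) φ)‖ ^ 2 ≤
        (n + 2) * ((k ^ 2 * n + ∑' i, ‖K (e i)‖ ^ 2) * ‖φ‖ ^ 2) := by
  have hb : ∀ s : Finset ι, ∑ i ∈ s, ‖S.cr n (K (e i)) φ‖ ^ 2 ≤
      (k ^ 2 * n + ∑' i, ‖K (e i)‖ ^ 2) * ‖φ‖ ^ 2 := fun s =>
    S.sum_norm_sq_cr_le n s _ φ (norm_sq_sum_conj_smul_le e K hk s)
      (hK.sum_le_tsum s fun i _ => by positivity)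
  have ha : Summable fun i => ‖S.cr n (K (e i)) φ‖ ^ 2 :=
    summable_of_sum_le (fun i => by positivity) hb
  have h := summable_of_norm_sq_sum_le (f := fun i => S.cr (n + 1) (e i) (S.cr n (K (e i)) φ))
    (C := n + 2) ha (fun i => by positivity) (by positivity) fun s => by
      have h1 := S.norm_sq_sum_cr_le' (k := 1) (n + 1) s e (fun i => S.cr n (K (e i)) φ) fun c => by
        rw [norm_sq_sum_smul_orthonormal e.orthonormal, one_pow, one_mul]
      refine h1.trans_eq ?_
      push_cast
      ring
  refine ⟨h.1, h.2.trans ?_⟩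
  gcongr
  exact ha.tsum_le_of_sum_le hb

/-- The pair creation operator `∑ a*(eᵢ) a*(K eᵢ)` from `n` to `n + 2` particles. -/
def pairCr (n : ℕ) (φ : G n) : G (n + 2) := ∑' i, S.cr (n + 1) (e i) (S.cr n (K (e i)) φ)

/-- The pair creation operator on arbitrary sequences. -/
def pairCrS (ψ : ∀ n, G n) : ∀ n, G n
  | 0 => 0
  | 1 => 0
  | n + 2 => S.pairCr e K n (ψ n)

include hk hK in
theorem hasSum_pairCrS (ψ : ∀ n, G n) (n : ℕ) :
    HasSum (fun i => S.crS (e i) (S.crS (K (e i)) ψ) n) (S.pairCrS e K ψ n) := by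
  rcases n with _ | _ | n
  · simp [pairCrS]
  · simp [pairCrS]
  · exact (S.pairCreation_aux e K hk hK n (ψ n)).1.hasSum

include hk hK in
theorem pairCrS_sub (φ ψ : ∀ n, G n) :
    S.pairCrS e K (φ - ψ) = S.pairCrS e K φ - S.pairCrS e K ψ := by
  funext n
  refine (S.hasSum_pairCrS e K hk hK (φ - ψ) n).unique ?_
  simpa using (S.hasSum_pairCrS e K hk hK φ n).sub (S.hasSum_pairCrS e K hk hK ψ n)

include hk hK in
theorem crS_pairCrS (g : H) (ψ : ∀ n, G n) :
    S.crS g (S.pairCrS e K ψ) = S.pairCrS e K (S.crS g ψ) := by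
  funext n
  rcases n with _ | n
  · rfl
  · refine HasSum.unique ?_ (S.hasSum_pairCrS e K hk hK (S.crS g ψ) (n + 1))
    have h := (S.hasSum_pairCrS e K hk hK ψ n).mapL (S.cr n g)
    simp only [← crS_succ, S.crS_comm g] at h
    exact h

include hk hK in
/-- The commutator of `a(f)` with the pair creation operator is `2 a*(K f)`; the two terms agree
because `K` is symmetric. -/
theorem anS_pairCrS (hsymm : ∀ f g, ⟪f, K g⟫_ℂ = ⟪g, K f⟫_ℂ) (f : H) (ψ : ∀ n, G n) :
    S.anS f (S.pairCrS e K ψ) =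
      (2 : ℂ) • S.crS (K f) ψ + S.pairCrS e K (S.anS f ψ) := by
  have hf1 : HasSum (fun i => ⟪f, e i⟫_ℂ • K (e i)) (K f) := by
    have h := (e.hasSum_repr f).mapL K
    simpa [e.repr_apply_apply] using h
  have hf2 : HasSum (fun i => ⟪f, K (e i)⟫_ℂ • e i) (K f) := by
    have h := e.hasSum_repr (K f)
    simpa [e.repr_apply_apply, hsymm f] using h
  have hcr : ∀ (a : ι → H) (b : H) (n : ℕ), HasSum a b →
      HasSum (fun i => S.crS (a i) ψ n) (S.crS b ψ n) := by
    intro a b n h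
    rcases n with _ | n
    · simp
    · exact h.mapL (S.crL n (ψ n))
  funext n
  have h := ((hcr _ _ n hf1).add (hcr _ _ n hf2)).add (S.hasSum_pairCrS e K hk hK (S.anS f ψ) n)
  have e2 : S.crS (K f) ψ n + S.crS (K f) ψ n = (2 : ℂ) • S.crS (K f) ψ n := (two_smul _ _).symm
  rw [e2] at h
  have h3 := (S.hasSum_pairCrS e K hk hK ψ (n + 1)).mapL (S.an n f)
  simp only [← anS_apply, anS_crS, map_add, map_smul] at h3
  simp only [crS_smul, LinearMap.smul_apply, Pi.smul_apply] at h
  have h4 : (fun i => ⟪f, e i⟫_ℂ • S.crS (K (e i)) ψ n + ⟪f, K (e i)⟫_ℂ • S.crS (e i) ψ n +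
      S.crS (e i) (S.crS (K (e i)) (S.anS f ψ)) n) = fun i =>
      (⟪f, e i⟫_ℂ • S.crS (K (e i)) ψ + (⟪f, K (e i)⟫_ℂ • S.crS (e i) ψ +
        S.crS (e i) (S.crS (K (e i)) (S.anS f ψ)))) n := by
    funext i
    simp only [Pi.add_apply, Pi.smul_apply, add_assoc]
  rw [h4] at h
  exact h3.unique h

/-- The components of the squeezed vacuum vector `exp (½ ∑ a*(eᵢ) a*(K eᵢ)) Ω`. -/
def squeezedSeq : ∀ n, G n
  | 0 => S.vac
  | 1 => 0
  | n + 2 => ((n + 2 : ℕ) : ℂ)⁻¹ • S.pairCr e K n (squeezedSeq n)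

theorem natCast_smul_squeezedSeq (n : ℕ) :
    (n : ℂ) • S.squeezedSeq e K n = S.pairCrS e K (S.squeezedSeq e K) n := by
  rcases n with _ | _ | n
  · simp [pairCrS]
  · simp [squeezedSeq, pairCrS]
  · rw [squeezedSeq, smul_inv_smul₀ (by exact_mod_cast (n + 1).succ_ne_zero)]
    rfl

include hk hK in
/-- Both sides of the vacuum equation satisfy `(N + 1) x = Q x + …` with the pair creation
operator `Q`, hence so does their difference `δ`: `(N + 1) δ = Q δ`, which forces `δ = 0`. -/
theorem anS_squeezedSeq (hsymm : ∀ f g, ⟪f, K g⟫_ℂ = ⟪g, K f⟫_ℂ) (f : H) :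
    S.anS f (S.squeezedSeq e K) = S.crS (K f) (S.squeezedSeq e K) := by
  set ψ := S.squeezedSeq e K with hψ
  have hN : ∀ n : ℕ, (n : ℂ) • ψ n = S.pairCrS e K ψ n := S.natCast_smul_squeezedSeq e K
  have h1 : ∀ n : ℕ, ((n + 1 : ℕ) : ℂ) • S.anS f ψ n =
      (2 : ℂ) • S.crS (K f) ψ n + S.pairCrS e K (S.anS f ψ) n := by
    intro n
    have h := congrFun (S.anS_pairCrS e K hk hK hsymm f ψ) n
    rw [anS_apply, ← hN, map_smul] at h
    exact h
  have h2 : ∀ n : ℕ, ((n + 1 : ℕ) : ℂ) • S.crS (K f) ψ n =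
      (2 : ℂ) • S.crS (K f) ψ n + S.pairCrS e K (S.crS (K f) ψ) n := by
    intro n
    rw [← S.crS_pairCrS e K hk hK]
    rcases n with _ | n
    · simp
    · rw [crS_succ, crS_succ, ← hN, map_smul, ← add_smul]
      congr 1
      push_cast
      ring
  set δ := S.anS f ψ - S.crS (K f) ψ with hδ
  have h3 : ∀ n : ℕ, ((n + 1 : ℕ) : ℂ) • δ n = S.pairCrS e K δ n := by
    intro n
    rw [hδ, S.pairCrS_sub e K hk hK, Pi.sub_apply, Pi.sub_apply, smul_sub, h1, h2]
    abel
  have h4 : ∀ n, δ n = 0 ∧ δ (n + 1) = 0 := by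
    have hs : ∀ n : ℕ, S.pairCrS e K δ n = 0 → δ n = 0 := fun n h => by
      have := h3 n
      rw [h] at this
      exact (smul_eq_zero.1 this).resolve_left (by exact_mod_cast n.succ_ne_zero)
    intro n
    induction n with
    | zero => exact ⟨hs 0 rfl, hs 1 rfl⟩
    | succ n ih =>
      refine ⟨ih.2, hs (n + 2) ?_⟩
      rw [pairCrS, ih.1, pairCr]
      simp
  exact sub_eq_zero.1 (funext fun n => (h4 n).1)

include hk hK in
/-- The ratio of consecutive nonzero terms of the squeezed vector tends to at most `k ^ 2`. -/
theorem norm_sq_squeezedSeq_le (n : ℕ) :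
    (n + 2) * ‖S.squeezedSeq e K (n + 2)‖ ^ 2 ≤
      (k ^ 2 * n + ∑' i, ‖K (e i)‖ ^ 2) * ‖S.squeezedSeq e K n‖ ^ 2 := by
  have h1 := (S.pairCreation_aux e K hk hK n (S.squeezedSeq e K n)).2
  have h2 : ((n : ℝ) + 2) * ‖S.squeezedSeq e K (n + 2)‖ =
      ‖S.pairCr e K n (S.squeezedSeq e K n)‖ := by
    rw [squeezedSeq, norm_smul, norm_inv, Complex.norm_natCast]
    push_cast
    rw [mul_inv_cancel_left₀ (by positivity)]
  rw [← pairCr, ← h2] at h1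
  refine le_of_mul_le_mul_left ?_ (show (0 : ℝ) < n + 2 by positivity)
  refine le_trans (le_of_eq ?_) h1
  ring

end Squeezed

theorem exists_bound_of_eventually_le {c : ℕ → ℝ}
    (h : ∀ᶠ n in Filter.atTop, c (n + 2) ≤ c n) : ∃ C, ∀ n, c n ≤ C := by
  obtain ⟨N, hN⟩ := Filter.eventually_atTop.1 h
  refine ⟨∑ i ∈ Finset.range (N + 2), |c i|, fun n => ?_⟩
  induction n using Nat.strong_induction_on with
  | _ n ih =>
    rcases lt_or_ge n (N + 2) with hn | hn
    · exact (le_abs_self _).trans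
        (Finset.single_le_sum (f := fun i => |c i|) (fun i _ => abs_nonneg _)
          (Finset.mem_range.2 hn))
    · obtain ⟨m, rfl⟩ := Nat.exists_eq_add_of_le' (show 2 ≤ n by omega)
      exact (hN m (by omega)).trans (ih m (by omega))

/-- A sequence whose ratios of consecutive terms tend to at most `a < 1` decreases rapidly. -/
theorem mem_rapid_of_norm_sq_le {ψ : ∀ n, G n} {a h : ℝ} (ha : a < 1)
    (hψ : ∀ n : ℕ, ((n : ℝ) + 2) * ‖ψ (n + 2)‖ ^ 2 ≤ (a * n + h) * ‖ψ n‖ ^ 2) : ψ ∈ rapid G := by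
  intro m
  -- the ratio of consecutive terms of `(n + 1) ^ (2 m) ‖ψ n‖ ^ 2` tends to at most `a < 1`
  have hlim : Filter.Tendsto (fun n : ℕ => (((n : ℝ) + 3) / (n + 1)) ^ (2 * m) *
      ((a * n + h) / (n + 2))) Filter.atTop (nhds (1 ^ (2 * m) * a)) := by
    have h0 : ∀ c : ℝ, Filter.Tendsto (fun n : ℕ => c / ((n : ℝ) + 1)) Filter.atTop (nhds 0) := by
      intro c
      have := (tendsto_one_div_add_atTop_nhds_zero_nat (𝕜 := ℝ)).const_mul c
      simpa [div_eq_mul_inv] using this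
    refine Filter.Tendsto.mul (Filter.Tendsto.pow ?_ _) ?_
    · have := (h0 2).const_add 1
      rw [add_zero] at this
      refine this.congr fun n => ?_
      field_simp
      ring
    · have h2 : Filter.Tendsto (fun n : ℕ => (h - 2 * a) / ((n : ℝ) + 2)) Filter.atTop (nhds 0) := by
        have := (h0 (h - 2 * a)).comp (Filter.tendsto_add_atTop_nat 1)
        refine this.congr fun n => ?_
        simp only [Function.comp_apply]
        push_cast
        ring_nf
      have := h2.const_add a
      rw [add_zero] at this
      refine this.congr fun n => ?_
      field_simp
      ring
  rw [one_pow, one_mul] at hlim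
  have hev := hlim.eventually (gt_mem_nhds ha)
  obtain ⟨C, hC⟩ := exists_bound_of_eventually_le
    (c := fun n : ℕ => (((n : ℝ) + 1) ^ m * ‖ψ n‖) ^ 2) (by
      filter_upwards [hev] with n hn
      have h1 : ‖ψ (n + 2)‖ ^ 2 ≤ (a * n + h) / (n + 2) * ‖ψ n‖ ^ 2 := by
        rw [div_mul_eq_mul_div, le_div_iff₀ (by positivity), mul_comm]
        exact hψ n
      have h2 : (((n : ℝ) + 3) / (n + 1)) ^ (2 * m) * (((n : ℝ) + 1) ^ m) ^ 2 =
          (((n : ℝ) + 3) ^ m) ^ 2 := by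
        rw [div_pow, ← pow_mul, ← pow_mul, mul_comm m 2, div_mul_cancel₀ _ (by positivity)]
      push_cast
      calc (((n : ℝ) + 2 + 1) ^ m * ‖ψ (n + 2)‖) ^ 2
          = (((n : ℝ) + 3) ^ m) ^ 2 * ‖ψ (n + 2)‖ ^ 2 := by ring
        _ ≤ (((n : ℝ) + 3) ^ m) ^ 2 * ((a * n + h) / (n + 2) * ‖ψ n‖ ^ 2) := by gcongr
        _ = ((((n : ℝ) + 3) / (n + 1)) ^ (2 * m) * ((a * n + h) / (n + 2))) *
            (((n : ℝ) + 1) ^ m * ‖ψ n‖) ^ 2 := by rw [← h2]; ring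
        _ ≤ 1 * (((n : ℝ) + 1) ^ m * ‖ψ n‖) ^ 2 := by gcongr
        _ = _ := one_mul _)
  exact ⟨Real.sqrt C, fun n => Real.le_sqrt_of_sq_le (hC n)⟩

/-- A symmetric conjugate linear Hilbert–Schmidt operator `K` of norm less than one has a squeezed
vacuum vector: a unit vector annihilated by all `a(f) - a*(K f)`. -/
theorem exists_squeezed_vacuum {ι : Type u} (e : HilbertBasis ι ℂ H) (K : H →L⋆[ℂ] H) {k : ℝ}
    (hk0 : 0 ≤ k) (hk1 : k < 1) (hk : ∀ f, ‖K f‖ ≤ k * ‖f‖)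
    (hK : Summable fun i => ‖K (e i)‖ ^ 2) (hsymm : ∀ f g, ⟪f, K g⟫_ℂ = ⟪g, K f⟫_ℂ) :
    ∃ Ω : rapid G, ‖toLp G Ω‖ = 1 ∧ ∀ f, S.anS f Ω.1 = S.crS (K f) Ω.1 := by
  have hmem : S.squeezedSeq e K ∈ rapid G :=
    mem_rapid_of_norm_sq_le (pow_lt_one₀ hk0 hk1 two_ne_zero)
      (S.norm_sq_squeezedSeq_le e K hk hK)
  set Ω : rapid G := ⟨S.squeezedSeq e K, hmem⟩
  have hne : ‖toLp G Ω‖ ≠ 0 := by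
    intro h
    rw [norm_eq_zero] at h
    have h0 : toLp G Ω 0 = 0 := by rw [h]; rfl
    have : S.vac = 0 := h0
    have hv := S.norm_vac
    rw [this, norm_zero] at hv
    exact zero_ne_one hv
  refine ⟨((‖toLp G Ω‖ : ℝ) : ℂ)⁻¹ • Ω, ?_, fun f => ?_⟩
  · rw [map_smul, norm_smul, norm_inv, Complex.norm_real, norm_norm, inv_mul_cancel₀ hne]
  · rw [Submodule.coe_smul, map_smul, map_smul, S.anS_squeezedSeq e K hk hK hsymm]

end CreationSystem

/-! ### Hilbert–Schmidt operators -/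

section HilbertSchmidt

open scoped ENNReal
open ContinuousLinearMap

variable {E F G : Type*} [NormedAddCommGroup E] [InnerProductSpace ℂ E] [CompleteSpace E]
  [NormedAddCommGroup F] [InnerProductSpace ℂ F] [CompleteSpace F]
  [NormedAddCommGroup G] [InnerProductSpace ℂ G] [CompleteSpace G]

theorem tsum_enorm_inner_sq {ι : Type*} (b : HilbertBasis ι ℂ E) (x : E) :
    ∑' i, ‖⟪b i, x⟫_ℂ‖ₑ ^ 2 = ‖x‖ₑ ^ 2 := by
  have h := b.hasSum_inner_mul_inner x x
  have h2 : HasSum (fun i => ‖⟪b i, x⟫_ℂ‖ ^ 2) (‖x‖ ^ 2) := by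
    have h3 := Complex.hasSum_re h
    rw [inner_self_eq_norm_sq_to_K] at h3
    convert h3 using 1
    · funext i
      rw [← inner_conj_symm x (b i), ← Complex.normSq_eq_conj_mul_self, Complex.normSq_eq_norm_sq,
        Complex.ofReal_re]
    · norm_cast
  have h4 : ∀ r : ℂ, ‖r‖ₑ ^ 2 = ENNReal.ofReal (‖r‖ ^ 2) := fun r => by
    rw [ENNReal.ofReal_pow (norm_nonneg _), ofReal_norm]
  simp only [h4]
  rw [← ENNReal.ofReal_tsum_of_nonneg (fun _ => by positivity) h2.summable, h2.tsum_eq,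
    ENNReal.ofReal_pow (norm_nonneg _), ofReal_norm]

/-- The Hilbert–Schmidt norms of `T` and of its adjoint agree, in any pair of bases; applied twice,
this gives independence of the basis. -/
theorem tsum_enorm_adjoint_sq {ι κ : Type*} (b : HilbertBasis ι ℂ E) (c : HilbertBasis κ ℂ F)
    (T : E →L[ℂ] F) : ∑' j, ‖adjoint T (c j)‖ₑ ^ 2 = ∑' i, ‖T (b i)‖ₑ ^ 2 := by
  simp only [← tsum_enorm_inner_sq c, ← tsum_enorm_inner_sq b]
  rw [ENNReal.tsum_comm]
  refine tsum_congr fun i => tsum_congr fun j => ?_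
  rw [adjoint_inner_right, ← inner_conj_symm, RCLike.enorm_conj]

/-- The operator norm is at most the Hilbert–Schmidt norm. -/
theorem enorm_sq_le_tsum {ι : Type*} (b : HilbertBasis ι ℂ E) (T : E →L[ℂ] F) (x : E) :
    ‖T x‖ₑ ^ 2 ≤ (∑' i, ‖T (b i)‖ₑ ^ 2) * ‖x‖ₑ ^ 2 := by
  obtain ⟨w, c, -⟩ := exists_hilbertBasis ℂ F
  rw [← tsum_enorm_inner_sq c, ← tsum_enorm_adjoint_sq b c, ← ENNReal.tsum_mul_right]
  refine ENNReal.tsum_le_tsum fun j => ?_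
  rw [← adjoint_inner_left, ← mul_pow]
  gcongr
  rw [← ofReal_norm, ← ofReal_norm, ← ofReal_norm, ← ENNReal.ofReal_mul (norm_nonneg _)]
  exact ENNReal.ofReal_le_ofReal (norm_inner_le_norm _ _)

/-- `T` is a Hilbert–Schmidt operator: `∑ ‖T bᵢ‖² < ∞` in some orthonormal basis (equivalently in
every one, see `isHS_iff_summable`). -/
def IsHS (T : E →L[ℂ] F) : Prop :=
  ∃ (w : Set E) (b : HilbertBasis w ℂ E), Summable fun i => ‖T (b i)‖ ^ 2

theorem summable_sq_iff_tsum_enorm {ι : Type*} (x : ι → F) :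
    (Summable fun i => ‖x i‖ ^ 2) ↔ ∑' i, ‖x i‖ₑ ^ 2 ≠ ∞ := by
  have h4 : ∀ i, ‖x i‖ₑ ^ 2 = ((‖x i‖₊ ^ 2 : NNReal) : ℝ≥0∞) := fun i => by
    rw [ENNReal.coe_pow]; rfl
  simp only [h4]
  rw [ENNReal.tsum_coe_ne_top_iff_summable, ← NNReal.summable_coe]
  simp

theorem isHS_iff_tsum {ι : Type*} (b : HilbertBasis ι ℂ E) (T : E →L[ℂ] F) :
    IsHS T ↔ ∑' i, ‖T (b i)‖ₑ ^ 2 ≠ ∞ := by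
  obtain ⟨w, c, -⟩ := exists_hilbertBasis ℂ F
  constructor
  · rintro ⟨w, b', h⟩
    rw [summable_sq_iff_tsum_enorm, ← tsum_enorm_adjoint_sq b' c] at h
    rwa [← tsum_enorm_adjoint_sq b c]
  · intro h
    obtain ⟨w', b', -⟩ := exists_hilbertBasis ℂ E
    refine ⟨w', b', ?_⟩
    rwa [summable_sq_iff_tsum_enorm, ← tsum_enorm_adjoint_sq b' c, tsum_enorm_adjoint_sq b c]

theorem isHS_iff_summable {ι : Type*} (b : HilbertBasis ι ℂ E) (T : E →L[ℂ] F) :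
    IsHS T ↔ Summable fun i => ‖T (b i)‖ ^ 2 := by
  rw [isHS_iff_tsum b, summable_sq_iff_tsum_enorm]

theorem IsHS.adjoint {T : E →L[ℂ] F} (hT : IsHS T) : IsHS (adjoint T) := by
  obtain ⟨w, b, -⟩ := exists_hilbertBasis ℂ E
  obtain ⟨w, c, -⟩ := exists_hilbertBasis ℂ F
  rwa [isHS_iff_tsum c, tsum_enorm_adjoint_sq b c, ← isHS_iff_tsum b]

theorem IsHS.clm_comp {T : E →L[ℂ] F} (hT : IsHS T) (A : F →L[ℂ] G) : IsHS (A ∘L T) := by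
  obtain ⟨w, b, -⟩ := exists_hilbertBasis ℂ E
  rw [isHS_iff_summable b] at hT ⊢
  refine Summable.of_nonneg_of_le (fun _ => by positivity) (fun i => ?_) (hT.mul_left (‖A‖ ^ 2))
  rw [← mul_pow]
  gcongr
  exact A.le_opNorm _

theorem IsHS.comp_clm {T : F →L[ℂ] G} (hT : IsHS T) (B : E →L[ℂ] F) : IsHS (T ∘L B) := by
  have h := (hT.adjoint.clm_comp (ContinuousLinearMap.adjoint B)).adjoint
  rwa [adjoint_comp, adjoint_adjoint, adjoint_adjoint] at h

theorem IsHS.add {S T : E →L[ℂ] F} (hS : IsHS S) (hT : IsHS T) : IsHS (S + T) := by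
  obtain ⟨w, b, -⟩ := exists_hilbertBasis ℂ E
  rw [isHS_iff_summable b] at *
  refine Summable.of_nonneg_of_le (fun _ => by positivity) (fun i => ?_) ((hS.add hT).mul_left 2)
  have h := norm_add_le (S (b i)) (T (b i))
  have h' := norm_nonneg ((S + T) (b i))
  simp only [add_apply] at h' ⊢
  nlinarith [sq_nonneg (‖S (b i)‖ - ‖T (b i)‖)]

theorem IsHS.neg {T : E →L[ℂ] F} (hT : IsHS T) : IsHS (-T) := by
  obtain ⟨w, b, h⟩ := hT
  exact ⟨w, b, by simpa using h⟩

theorem isHS_zero : IsHS (0 : E →L[ℂ] F) := by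
  obtain ⟨w, b, -⟩ := exists_hilbertBasis ℂ E
  exact ⟨w, b, by simp⟩

/-- A Hilbert–Schmidt operator is the norm limit of its restrictions to the spans of finitely many
basis vectors. -/
theorem IsHS.isCompactOperator {T : E →L[ℂ] F} (hT : IsHS T) : IsCompactOperator T := by
  classical
  obtain ⟨w, b, -⟩ := exists_hilbertBasis ℂ E
  rw [isHS_iff_tsum b] at hT
  let Ts : Finset w → E →L[ℂ] F := fun s => ∑ i ∈ s, (innerSL ℂ (b i)).smulRight (T (b i))
  have hTs : ∀ s, IsCompactOperator (Ts s) := by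
    intro s
    induction s using Finset.induction_on with
    | empty => exact isCompactOperator_zero
    | insert i s hi ih =>
      have e : Ts (insert i s) = (innerSL ℂ (b i)).smulRight (T (b i)) + Ts s :=
        Finset.sum_insert hi
      have hr : IsCompactOperator ((innerSL ℂ (b i)).smulRight (T (b i))) :=
        IsCompactOperator.clm_comp
          (isCompactOperator_of_locallyCompactSpace_dom (innerSL ℂ (b i)))
          ((1 : ℂ →L[ℂ] ℂ).smulRight (T (b i)))
      rw [e]
      exact hr.add ih
  have hb : ∀ s i, (T - Ts s) (b i) = if i ∈ s then 0 else T (b i) := by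
    intro s i
    have h : Ts s (b i) = if i ∈ s then T (b i) else 0 := by
      simp only [Ts, sum_apply, smulRight_apply, innerSL_apply_apply,
        orthonormal_iff_ite.1 b.orthonormal, ite_smul, one_smul, zero_smul, Finset.sum_ite_eq']
    rw [sub_apply, h]
    split_ifs <;> simp
  have hle : ∀ s, ‖Ts s - T‖ₑ ^ 2 ≤ ∑' i : {i // i ∉ s}, ‖T (b i)‖ₑ ^ 2 := by
    intro s
    have e : ∑' i, ‖(T - Ts s) (b i)‖ₑ ^ 2 = ∑' i : {i // i ∉ s}, ‖T (b i)‖ₑ ^ 2 := by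
      have h := tsum_subtype {i | i ∉ s} fun i => ‖T (b i)‖ₑ ^ 2
      refine Eq.trans (tsum_congr fun i => ?_) h.symm
      rw [hb]
      by_cases his : i ∈ s <;> simp [his, Set.indicator]
    rw [← e, ← enorm_neg, neg_sub]
    set c := ∑' i, ‖(T - Ts s) (b i)‖ₑ ^ 2 with hc
    by_cases hct : c = ∞
    · simp [hct]
    have h1 : ‖T - Ts s‖ ≤ Real.sqrt c.toReal := by
      refine opNorm_le_bound _ (Real.sqrt_nonneg _) fun x => ?_
      have h := enorm_sq_le_tsum b (T - Ts s) x
      rw [← hc] at h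
      have h2 := ENNReal.toReal_mono (ENNReal.mul_ne_top hct (by simp)) h
      rw [ENNReal.toReal_mul, ENNReal.toReal_pow, ENNReal.toReal_pow, toReal_enorm,
        toReal_enorm] at h2
      refine abs_le_of_sq_le_sq' ?_ (by positivity) |>.2
      rwa [mul_pow, Real.sq_sqrt ENNReal.toReal_nonneg]
    have h2 : ‖T - Ts s‖ ^ 2 ≤ c.toReal := by
      have := pow_le_pow_left₀ (norm_nonneg _) h1 2
      rwa [Real.sq_sqrt ENNReal.toReal_nonneg] at this
    rw [← ofReal_norm, ← ENNReal.ofReal_pow (norm_nonneg _)]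
    exact ENNReal.ofReal_le_of_le_toReal h2
  refine isCompactOperator_of_tendsto (l := Filter.atTop) (F := Ts) ?_
    (Filter.Eventually.of_forall hTs)
  rw [tendsto_iff_norm_sub_tendsto_zero]
  have h1 : Filter.Tendsto (fun s => ‖Ts s - T‖ₑ ^ 2) Filter.atTop (nhds 0) :=
    tendsto_of_tendsto_of_tendsto_of_le_of_le tendsto_const_nhds
      (ENNReal.tendsto_tsum_compl_atTop_zero hT) (fun _ => zero_le) hle
  have h2 := (ENNReal.tendsto_toReal ENNReal.zero_ne_top).comp h1
  have h3 := (Real.continuous_sqrt.tendsto _).comp h2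
  simpa [Function.comp_def, Real.sqrt_sq] using h3

end HilbertSchmidt

/-! ### Eigenbases of compact self-adjoint operators -/

section Eigenbasis

variable {E : Type*} [NormedAddCommGroup E] [InnerProductSpace ℂ E] [CompleteSpace E]

theorem countable_of_orthonormal [TopologicalSpace.SeparableSpace E] {ι : Type*} {v : ι → E}
    (hv : Orthonormal ℂ v) : Countable ι := by
  have hd : ∀ i j, i ≠ j → 1 < dist (v i) (v j) := by
    intro i j hij
    have h : ‖v i - v j‖ ^ 2 = 2 := by
      rw [@norm_sub_sq ℂ, hv.2 hij, hv.1, hv.1]; norm_num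
    rw [dist_eq_norm]
    nlinarith [norm_nonneg (v i - v j)]
  have h : (Set.univ : Set ι).PairwiseDisjoint fun i => Metric.ball (v i) (1 / 2) := by
    intro i _ j _ hij
    refine Metric.ball_disjoint_ball ?_
    linarith [hd i j hij]
  exact Set.countable_univ_iff.1 (h.countable_of_isOpen (fun i _ => Metric.isOpen_ball)
    fun i _ => ⟨v i, Metric.mem_ball_self (by norm_num)⟩)

theorem finite_of_hilbertBasis {ι κ : Type*} (b : HilbertBasis ι ℂ E) (c : HilbertBasis κ ℂ E)
    [Finite ι] : Finite κ := by
  have := Fintype.ofFinite ι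
  have : FiniteDimensional ℂ E := b.toOrthonormalBasis.toBasis.finiteDimensional_of_finite
  exact c.orthonormal.linearIndependent.finite

/-- Two orthonormal bases of a separable Hilbert space are indexed by equivalent types. -/
theorem nonempty_equiv_of_hilbertBasis [TopologicalSpace.SeparableSpace E] {ι κ : Type*}
    (b : HilbertBasis ι ℂ E) (c : HilbertBasis κ ℂ E) : Nonempty (ι ≃ κ) := by
  have := countable_of_orthonormal b.orthonormal
  have := countable_of_orthonormal c.orthonormal
  cases finite_or_infinite ι with
  | inl h =>
    have := finite_of_hilbertBasis b c
    have := Fintype.ofFinite ι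
    have := Fintype.ofFinite κ
    exact ⟨b.toOrthonormalBasis.toBasis.indexEquiv c.toOrthonormalBasis.toBasis⟩
  | inr h =>
    have : Infinite κ := by
      by_contra hκ
      have := not_infinite_iff_finite.1 hκ
      have := finite_of_hilbertBasis c b
      exact not_finite ι
    obtain ⟨d⟩ := nonempty_denumerable ι
    obtain ⟨d'⟩ := nonempty_denumerable κ
    exact ⟨Denumerable.equiv₂ ι κ⟩

/-- A compact self-adjoint operator on a separable Hilbert space has an orthonormal basis of
eigenvectors, indexed by the index type of any given orthonormal basis. -/
theorem exists_eigenbasis [TopologicalSpace.SeparableSpace E] {ι : Type*} (b : HilbertBasis ι ℂ E)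
    {T : E →L[ℂ] E} (hT : IsCompactOperator T) (hsa : (T : E →ₗ[ℂ] E).IsSymmetric) :
    ∃ (e : HilbertBasis ι ℂ E) (lam : ι → ℂ), ∀ i, T (e i) = lam i • e i := by
  let V : ℂ → Submodule ℂ E := fun μ => Module.End.eigenspace (T : Module.End ℂ E) μ
  have hVc : ∀ μ, CompleteSpace (V μ) := fun μ => by
    have hcl : IsClosed {x : E | T x = μ • x} :=
      isClosed_eq T.continuous (continuous_const_smul μ)
    have e : (V μ : Set E) = {x : E | T x = μ • x} := by
      ext x
      simp [V]
    exact (e ▸ hcl : IsClosed (V μ : Set E)).completeSpace_coe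
  have hb : ∀ μ, ∃ (w : Set (V μ)) (b : HilbertBasis w ℂ (V μ)), True := fun μ => by
    obtain ⟨w, b, -⟩ := exists_hilbertBasis ℂ (V μ)
    exact ⟨w, b, trivial⟩
  choose w c _ using hb
  have ho := hsa.orthogonalFamily_eigenspaces.orthonormal_sigma_orthonormal
    (v_family := fun μ i => c μ i) fun μ => (c μ).orthonormal
  have hspan : (Submodule.span ℂ (Set.range fun a : Σ μ, w μ => ((c a.1 a.2 : V a.1) : E)))ᗮ = ⊥ := by
    rw [Submodule.eq_bot_iff]
    intro x hx
    have hmem : x ∈ (⨆ μ, V μ)ᗮ := by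
      rw [← Submodule.iInf_orthogonal, Submodule.mem_iInf]
      intro μ
      have hz : ∀ i, ⟪((c μ i : V μ) : E), x⟫_ℂ = 0 := fun i =>
        (Submodule.mem_orthogonal _ _).1 hx _ (Submodule.subset_span ⟨⟨μ, i⟩, rfl⟩)
      have h2 := tsum_enorm_inner_sq (c μ) ((V μ).orthogonalProjectionOnto x)
      simpa [hz] using h2.symm
    have hbot := ContinuousLinearMap.orthogonalComplement_iSup_eigenspaces_eq_bot hT hsa
    have : x ∈ (⊥ : Submodule ℂ E) := hbot ▸ hmem
    simpa using this
  let d := HilbertBasis.mkOfOrthogonalEqBot ho hspan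
  obtain ⟨σ⟩ := nonempty_equiv_of_hilbertBasis b d
  have hd : ∀ a, d a = ((c a.1 a.2 : V a.1) : E) := fun a =>
    congrFun (HilbertBasis.coe_mkOfOrthogonalEqBot ho hspan) a
  have hor : Orthonormal ℂ fun i => d (σ i) := d.orthonormal.comp _ σ.injective
  have hr : Set.range (fun i => d (σ i)) = Set.range d := σ.surjective.range_comp d
  have hsp : ⊤ ≤ (Submodule.span ℂ (Set.range fun i => d (σ i))).topologicalClosure := by
    rw [hr, d.dense_span]
  refine ⟨HilbertBasis.mk hor hsp, fun i => (σ i).1, fun i => ?_⟩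
  rw [HilbertBasis.coe_mk, hd]
  exact Module.End.mem_eigenspace_iff.1 (c (σ i).1 (σ i).2).2

end Eigenbasis

/-! ### A positive symplectic square root in a C⋆-algebra -/

section SymplecticRoot

variable {A : Type*} [CStarAlgebra A] [PartialOrder A] [StarOrderedRing A]

/-- For strictly positive `a`, positive solutions of `x a x = b` are unique: `√a x √a` is the
positive square root of `√a b √a`. -/
theorem eq_of_mul_mul_eq {a x y : A} (ha : IsStrictlyPositive a) (hx : 0 ≤ x) (hy : 0 ≤ y)
    (h : x * a * x = y * a * y) : x = y := by
  have hr0 := CFC.sqrt_nonneg a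
  have hrr := CFC.sqrt_mul_sqrt_self a ha.nonneg
  obtain ⟨r, hr⟩ := ha.isUnit_cfcSqrt
  rw [← hr] at hr0 hrr
  have key : ∀ z : A, 0 ≤ z → CFC.sqrt (r * (z * a * z) * r) = r * z * r := fun z hz => by
    refine CFC.sqrt_unique ?_ ((IsSelfAdjoint.of_nonneg hr0).conjugate_nonneg hz)
    rw [← hrr]
    simp only [mul_assoc]
  have e := key x hx
  rw [h, key y hy] at e
  exact (r.mul_left_inj.1 (r.mul_right_inj.1 (by simpa only [mul_assoc] using e))).symm

theorem nonneg_of_mul_eq_one {x y : A} (hx : 0 ≤ x) (h : x * y = 1) (h' : y * x = 1) : 0 ≤ y := by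
  have hs : star y = y := by
    have h1 : star y * x = 1 := by
      have := congrArg star h
      rwa [star_mul, star_one, (IsSelfAdjoint.of_nonneg hx).star_eq] at this
    calc star y = star y * (x * y) := by rw [h, mul_one]
      _ = y := by rw [← mul_assoc, h1, one_mul]
  have := star_left_conjugate_nonneg hx y
  rwa [hs, h', one_mul] at this

theorem add_one_isUnit {x : A} (hx : 0 ≤ x) : IsUnit (x + 1) :=
  (IsStrictlyPositive.nonneg_add hx isStrictlyPositive_one).isUnit

/-- `x - 1 = (x² - 1) (x + 1)⁻¹`. -/
theorem sub_one_mem_of_sq_sub_one_mem (I : TwoSidedIdeal A) {x : A} (hx : 0 ≤ x)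
    (h : x * x - 1 ∈ I) : x - 1 ∈ I := by
  obtain ⟨w, hw⟩ := add_one_isUnit hx
  have e : (x - 1) * w = x * x - 1 := by rw [hw]; noncomm_ring
  have : x - 1 = (x * x - 1) * (w⁻¹ : Aˣ) := by rw [← e, Units.mul_inv_cancel_right]
  rw [this]
  exact I.mul_mem_right _ _ h

/-- Let `s` be a self-adjoint involution and `a` strictly positive. The positive solution `x` of
`x a x = s a s` satisfies `x s x = s`, since `s x⁻¹ s` is another one. Hence its square root `v`
satisfies `v s v = s`, and `v a v` commutes with `s`. If `a - 1` lies in some two-sided ideal, so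
does `v - 1`; and `v` is fixed by every multiplicative map which preserves positivity, fixes `a`
and sends `s` to `-s`. -/
theorem exists_symplectic_sqrt {s a : A} (hs : IsSelfAdjoint s) (hss : s * s = 1)
    (ha : IsStrictlyPositive a) :
    ∃ v : A, 0 ≤ v ∧ v * s * v = s ∧ Commute (v * a * v) s ∧
      (∀ I : TwoSidedIdeal A, a - 1 ∈ I → v - 1 ∈ I) ∧
      ∀ θ : A → A, (∀ y z, θ (y * z) = θ y * θ z) → (∀ y, 0 ≤ y → 0 ≤ θ y) → θ a = a →
        θ s = -s → θ v = v := by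
  have hr0 := CFC.sqrt_nonneg a
  have hrr := CFC.sqrt_mul_sqrt_self a ha.nonneg
  obtain ⟨r, hr⟩ := ha.isUnit_cfcSqrt
  rw [← hr] at hr0 hrr
  have hrsa := IsSelfAdjoint.of_nonneg hr0
  have hss' : ∀ z : A, s * (s * z) = z := fun z => by rw [← mul_assoc, hss, one_mul]
  let b : A := r * (s * a * s) * r
  have hb0 : 0 ≤ b := hrsa.conjugate_nonneg (hs.conjugate_nonneg ha.nonneg)
  have hbu : IsUnit b := by
    have hsu : IsUnit s := ⟨⟨s, s, hss, hss⟩, rfl⟩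
    exact (r.isUnit.mul ((hsu.mul ha.isUnit).mul hsu)).mul r.isUnit
  have hM0 := CFC.sqrt_nonneg b
  have hMM := CFC.sqrt_mul_sqrt_self b hb0
  obtain ⟨M, hM⟩ := (CFC.isUnit_sqrt_iff b hb0).2 hbu
  rw [← hM] at hM0 hMM
  have hri0 : 0 ≤ ((r⁻¹ : Aˣ) : A) := nonneg_of_mul_eq_one hr0 (by simp) (by simp)
  let x : Aˣ := r⁻¹ * M * r⁻¹
  have hx0 : 0 ≤ (x : A) := by
    have := (IsSelfAdjoint.of_nonneg hri0).conjugate_nonneg hM0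
    simpa [x] using this
  have hxi0 : 0 ≤ ((x⁻¹ : Aˣ) : A) := nonneg_of_mul_eq_one hx0 (by simp) (by simp)
  have hxax : (x : A) * a * x = s * a * s := by
    rw [← hrr]
    simp only [x, Units.val_mul, mul_assoc, Units.inv_mul_cancel_left, Units.mul_inv_cancel_left]
    rw [← mul_assoc (M : A) M, hMM]
    simp only [b, ← mul_assoc, Units.inv_mul, one_mul]
    simp only [mul_assoc, Units.mul_inv, mul_one]
    rw [← hrr]
    simp only [mul_assoc]
  -- `s x⁻¹ s` solves the same equation as `x`
  have hsx : s * (x⁻¹ : Aˣ) * s = x := by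
    refine eq_of_mul_mul_eq ha (hs.conjugate_nonneg hxi0) hx0 ?_
    rw [hxax]
    have : s * a * s = (x : A) * a * x := hxax.symm
    calc s * ((x⁻¹ : Aˣ) : A) * s * a * (s * ((x⁻¹ : Aˣ) : A) * s)
        = s * ((x⁻¹ : Aˣ) : A) * (s * a * s) * ((x⁻¹ : Aˣ) : A) * s := by simp only [mul_assoc]
      _ = s * a * s := by
        rw [this]
        simp only [mul_assoc, Units.inv_mul_cancel_left, Units.mul_inv_cancel_left]
        simpa only [mul_assoc] using this
  have hv0 := CFC.sqrt_nonneg (x : A)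
  have hvv := CFC.sqrt_mul_sqrt_self (x : A) hx0
  obtain ⟨v, hv⟩ := (CFC.isUnit_sqrt_iff (x : A) hx0).2 x.isUnit
  have hvu : ∀ y : A, 0 ≤ y → y * y = x → y = v := fun y hy h => by
    rw [hv, CFC.sqrt_unique h hy]
  rw [← hv] at hv0 hvv
  have hvvu : v * v = x := Units.ext hvv
  have hvi0 : 0 ≤ ((v⁻¹ : Aˣ) : A) := nonneg_of_mul_eq_one hv0 (by simp) (by simp)
  -- `s v⁻¹ s` is a positive square root of `s x⁻¹ s = x`
  have hsv : s * ((v⁻¹ : Aˣ) : A) * s = v := by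
    refine hvu _ (hs.conjugate_nonneg hvi0) ?_
    rw [← hsx, ← hvvu]
    simp only [mul_assoc, hss', mul_inv_rev, Units.val_mul]
  have hsvi : ((v⁻¹ : Aˣ) : A) = s * v * s := by
    rw [← hsv]
    simp only [mul_assoc, hss', hss, mul_one]
  refine ⟨v, hv0, ?_, ?_, fun I hI => ?_, fun θ hθ hθ0 hθa hθs => ?_⟩
  · have h : (s * v * s) * v = 1 := by rw [← hsvi, Units.inv_mul]
    calc (v : A) * s * v = s * ((s * v * s) * v) := by simp only [mul_assoc, hss']
      _ = s := by rw [h, mul_one]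
  · have h : (v : A) * a * v = s * (v * a * v) * s := by
      calc (v : A) * a * v = ((v⁻¹ : Aˣ) : A) * ((v * v) * a * (v * v)) * ((v⁻¹ : Aˣ) : A) := by
            simp only [mul_assoc, Units.inv_mul_cancel_left, Units.mul_inv, mul_one]
        _ = s * (v * a * v) * s := by
            rw [hvv, hxax, hsvi]
            simp only [mul_assoc, hss']
    calc (v : A) * a * v * s = s * (v * a * v) * s * s := by rw [← h]
      _ = s * (v * a * v) := by rw [mul_assoc _ s s, hss, mul_one]
  · refine sub_one_mem_of_sq_sub_one_mem I hv0 ?_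
    -- `v² - 1 = r⁻¹ (M - a) r⁻¹` with `r = √a` and `M² = r s a s r`
    have hM1 : (M : A) - 1 ∈ I := by
      refine sub_one_mem_of_sq_sub_one_mem I hM0 ?_
      have e : (M : A) * M - 1 = r * s * (a - 1) * (s * r) + (a - 1) := by
        rw [hMM]
        simp only [b, ← hrr, mul_sub, sub_mul, mul_assoc, mul_one, hss']
        abel
      rw [e]
      exact I.add_mem (I.mul_mem_right _ _ (I.mul_mem_left _ _ hI)) hI
    have e : (v : A) * v - 1 = ((r⁻¹ : Aˣ) : A) * ((M - 1) - (a - 1)) * ((r⁻¹ : Aˣ) : A) := by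
      rw [hvv, ← hrr]
      simp only [x, Units.val_mul, sub_sub_sub_cancel_right, mul_sub, sub_mul, mul_assoc,
        Units.mul_inv, mul_one, Units.inv_mul]
    rw [e]
    exact I.mul_mem_right _ _ (I.mul_mem_left _ _ (I.sub_mem hM1 hI))
  · have hθx : θ x = x := by
      refine eq_of_mul_mul_eq ha (hθ0 _ hx0) hx0 ?_
      calc θ x * a * θ x = θ (x * a * x) := by rw [hθ, hθ, hθa]
        _ = x * a * x := by rw [hxax, hθ, hθ, hθs, hθa]; simp
    exact hvu _ (hθ0 _ hv0) (by rw [← hθ, hvv, hθx])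

end SymplecticRoot

/-! ### Symplectic diagonalization with respect to an involution -/

section Diagonalization

open ContinuousLinearMap

variable {E : Type*} [NormedAddCommGroup E] [InnerProductSpace ℂ E] [CompleteSpace E]

variable (E) in
/-- The two-sided ideal of Hilbert–Schmidt operators. -/
def hsIdeal : TwoSidedIdeal (E →L[ℂ] E) :=
  TwoSidedIdeal.mk' {T | IsHS T} isHS_zero (fun hS hT => hS.add hT) (fun hT => hT.neg)
    (fun hT => hT.clm_comp _) (fun hT => hT.comp_clm _)

theorem mem_hsIdeal {T : E →L[ℂ] E} : T ∈ hsIdeal E ↔ IsHS T :=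
  TwoSidedIdeal.mem_mk' _ _ _ _ _ _ _

/-- The conjugate `j T j` of an operator by a conjugate-linear map. -/
def conjBy (j : E →L⋆[ℂ] E) (T : E →L[ℂ] E) : E →L[ℂ] E := j.comp (T.comp j)

theorem conjBy_apply (j : E →L⋆[ℂ] E) (T : E →L[ℂ] E) (x : E) : conjBy j T x = j (T (j x)) := rfl

theorem conjBy_mul {j : E →L⋆[ℂ] E} (hj : ∀ x, j (j x) = x) (S T : E →L[ℂ] E) :
    conjBy j (S * T) = conjBy j S * conjBy j T := by
  ext x
  simp [conjBy_apply, hj]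

theorem conjBy_nonneg {j : E →L⋆[ℂ] E} (hj : ∀ x, j (j x) = x)
    (hji : ∀ x y, ⟪j x, j y⟫_ℂ = ⟪y, x⟫_ℂ) {T : E →L[ℂ] E} (hT : 0 ≤ T) : 0 ≤ conjBy j T := by
  rw [nonneg_iff_isPositive] at *
  rw [isPositive_iff_complex]
  intro x
  have h : ⟪conjBy j T x, x⟫_ℂ = ⟪j x, T (j x)⟫_ℂ := by
    rw [conjBy_apply, ← hji, hj]
  rw [h]
  have h2 := hT.inner_nonneg_right (j x)
  have h3 := Complex.le_def.1 h2
  refine ⟨Complex.ext (by simp) (by simpa using h3.2), h3.1⟩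

theorem norm_sq_sqrt_apply {T : E →L[ℂ] E} (hT : 0 ≤ T) (x : E) :
    ((‖CFC.sqrt T x‖ ^ 2 : ℝ) : ℂ) = ⟪T x, x⟫_ℂ := by
  have h1 := CFC.sqrt_mul_sqrt_self T hT
  have h2 := (CFC.sqrt_nonneg T)
  rw [nonneg_iff_isPositive] at h2
  conv_rhs => rw [← h1]
  rw [mul_apply_eq_comp, ← adjoint_inner_right, h2.isSelfAdjoint.adjoint_eq, inner_self_eq_norm_sq_to_K]
  norm_cast

/-- If `Γ ≥ 0` and `Γ + s ≥ 0` for an isometry `s`, then `2Γ + s` is bounded below. -/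
theorem isStrictlyPositive_of_symmetry {s Γ : E →L[ℂ] E} (hs : ∀ x, ‖s x‖ = ‖x‖) (hΓ : 0 ≤ Γ)
    (hΓ' : 0 ≤ Γ + s) : IsStrictlyPositive (2 • Γ + s) := by
  have e : 2 • Γ + s = Γ + (Γ + s) := by abel
  rw [e]
  refine ⟨add_nonneg hΓ hΓ', ?_⟩
  let r := CFC.sqrt Γ
  let r' := CFC.sqrt (Γ + s)
  let C : NNReal := 2 * (‖r‖₊ ^ 2 + ‖r'‖₊ ^ 2) + 1
  have hC : 0 < C := by positivity
  refine isUnit_of_forall_le_norm_inner_map _ (c := C⁻¹) (by positivity) fun x => ?_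
  have h1 : r * r = Γ := CFC.sqrt_mul_sqrt_self Γ hΓ
  have h2 : r' * r' = Γ + s := CFC.sqrt_mul_sqrt_self _ hΓ'
  have h3 : ⟪(Γ + (Γ + s)) x, x⟫_ℂ = ((‖r x‖ ^ 2 + ‖r' x‖ ^ 2 : ℝ) : ℂ) := by
    rw [add_apply, inner_add_left, Complex.ofReal_add, ← norm_sq_sqrt_apply hΓ,
      ← norm_sq_sqrt_apply hΓ']
  have h4 : ‖x‖ ≤ ‖r‖ * ‖r x‖ + ‖r'‖ * ‖r' x‖ := by
    have h5 : s x = r' (r' x) - r (r x) := by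
      rw [← mul_apply_eq_comp, ← mul_apply_eq_comp, h1, h2, add_apply, add_sub_cancel_left]
    rw [← hs, h5]
    refine (norm_sub_le _ _).trans ?_
    rw [add_comm]
    exact add_le_add (r.le_opNorm _) (r'.le_opNorm _)
  rw [h3, Complex.norm_real, Real.norm_of_nonneg (by positivity), NNReal.coe_inv,
    ← div_eq_mul_inv, div_le_iff₀ (by exact_mod_cast hC)]
  have hCe : (C : ℝ) = 2 * (‖r‖ ^ 2 + ‖r'‖ ^ 2) + 1 := by simp [C]
  rw [hCe]
  have h6 : ‖x‖ ^ 2 ≤ (‖r‖ * ‖r x‖ + ‖r'‖ * ‖r' x‖) ^ 2 := by gcongr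
  nlinarith [sq_nonneg (‖r‖ * ‖r x‖ - ‖r'‖ * ‖r' x‖), sq_nonneg (‖r‖ * ‖r' x‖),
    sq_nonneg (‖r'‖ * ‖r x‖), sq_nonneg ‖r x‖, sq_nonneg ‖r' x‖]

/-- Let `s` be a self-adjoint involution, `j` an anti-unitary involution anticommuting with `s`,
and `Γ ≥ 0` with `j Γ j = Γ + s`. Then some self-adjoint `v`, commuting with `j` and symplectic
for `s`, makes `v Γ v` commute with `s`; and `v - 1` is Hilbert–Schmidt if `2Γ + s - 1` is. -/
theorem exists_symplectic_diagonalization {s Γ : E →L[ℂ] E} {j : E →L⋆[ℂ] E}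
    (hs : IsSelfAdjoint s) (hss : s * s = 1) (hj : ∀ x, j (j x) = x)
    (hji : ∀ x y, ⟪j x, j y⟫_ℂ = ⟪y, x⟫_ℂ) (hjs : ∀ x, j (s x) = -s (j x)) (hΓ : 0 ≤ Γ)
    (hjΓ : ∀ x, j (Γ (j x)) = Γ x + s x) (hHS : IsHS (2 • Γ + s - 1)) :
    ∃ v : E →L[ℂ] E, IsSelfAdjoint v ∧ v * s * v = s ∧ (∀ x, j (v (j x)) = v x) ∧
      Commute (v * Γ * v) s ∧ IsHS (v - 1) ∧ IsHS (2 • (v * Γ * v) + s - 1) := by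
  have hjΓ' : conjBy j Γ = Γ + s := ext fun x => hjΓ x
  have hsn : ∀ x, ‖s x‖ = ‖x‖ := fun x => by
    have h : ⟪s x, s x⟫_ℂ = ⟪x, x⟫_ℂ := by
      rw [← adjoint_inner_right, hs.adjoint_eq, ← mul_apply_eq_comp, hss, one_apply_eq_self]
    rw [@norm_eq_sqrt_re_inner ℂ, h, ← @norm_eq_sqrt_re_inner ℂ]
  have hpos : IsStrictlyPositive (2 • Γ + s) :=
    isStrictlyPositive_of_symmetry hsn hΓ (hjΓ' ▸ conjBy_nonneg hj hji hΓ)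
  obtain ⟨v, hv0, hvs, hcomm, hI, hθ⟩ := exists_symplectic_sqrt hs hss hpos
  have e : v * (2 • Γ + s) * v = 2 • (v * Γ * v) + s := by
    rw [mul_add, add_mul, hvs, mul_smul_comm, smul_mul_assoc]
  have hθv : conjBy j v = v := by
    refine hθ (conjBy j) (conjBy_mul hj) (fun y hy => conjBy_nonneg hj hji hy) ?_ ?_
    · have h2 : conjBy j (2 • Γ + s) = 2 • conjBy j Γ + conjBy j s := by
        ext x
        simp [conjBy_apply]
      have h3 : conjBy j s = -s := by
        ext x
        simp [conjBy_apply, hjs, hj]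
      rw [h2, h3, hjΓ']
      module
    · ext x
      simp [conjBy_apply, hjs, hj]
  have hv1 : v - 1 ∈ hsIdeal E := hI _ (mem_hsIdeal.2 hHS)
  refine ⟨v, IsSelfAdjoint.of_nonneg hv0, hvs, fun x => congrArg (fun T : E →L[ℂ] E => T x) hθv,
    ?_, mem_hsIdeal.1 hv1, ?_⟩
  · rw [e] at hcomm
    have h := hcomm.sub_left (Commute.refl s)
    rw [add_sub_cancel_right] at h
    have h2 := h.smul_left (2⁻¹ : ℂ)
    rwa [← Nat.cast_smul_eq_nsmul ℂ, smul_smul, Nat.cast_ofNat,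
      inv_mul_cancel₀ (two_ne_zero' ℂ), one_smul] at h2
  · rw [← mem_hsIdeal, ← e]
    have e2 : v * (2 • Γ + s) * v - 1 = v * (2 • Γ + s - 1) * v + (v - 1) * (v + 1) := by
      noncomm_ring
    rw [e2]
    exact TwoSidedIdeal.add_mem _ (TwoSidedIdeal.mul_mem_right _ _ _
      (TwoSidedIdeal.mul_mem_left _ _ _ (mem_hsIdeal.2 hHS))) (TwoSidedIdeal.mul_mem_right _ _ _ hv1)

end Diagonalization

/-! ### The doubled space -/

section DoubledSpace

open ContinuousLinearMap

variable {H : Type u} [NormedAddCommGroup H] [InnerProductSpace ℂ H] [CompleteSpace H]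

variable (H) in
/-- The inclusion `f ↦ f ⊕ 0`. -/
def inlD : H →L[ℂ] Doubled H :=
  ((WithLp.prodContinuousLinearEquiv 2 ℂ H (StrongDual ℂ H)).symm :
    (H × StrongDual ℂ H) →L[ℂ] Doubled H) ∘L ContinuousLinearMap.inl ℂ H (StrongDual ℂ H)

variable (H) in
/-- The inclusion `φ ↦ 0 ⊕ φ`. -/
def inrD : StrongDual ℂ H →L[ℂ] Doubled H :=
  ((WithLp.prodContinuousLinearEquiv 2 ℂ H (StrongDual ℂ H)).symm :
    (H × StrongDual ℂ H) →L[ℂ] Doubled H) ∘L ContinuousLinearMap.inr ℂ H (StrongDual ℂ H)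

variable (H) in
/-- The projection `f ⊕ φ ↦ f`. -/
def fstD : Doubled H →L[ℂ] H :=
  ContinuousLinearMap.fst ℂ H (StrongDual ℂ H) ∘L
    ((WithLp.prodContinuousLinearEquiv 2 ℂ H (StrongDual ℂ H)) :
      Doubled H →L[ℂ] (H × StrongDual ℂ H))

variable (H) in
/-- The projection `f ⊕ φ ↦ φ`. -/
def sndD : Doubled H →L[ℂ] StrongDual ℂ H :=
  ContinuousLinearMap.snd ℂ H (StrongDual ℂ H) ∘L
    ((WithLp.prodContinuousLinearEquiv 2 ℂ H (StrongDual ℂ H)) :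
      Doubled H →L[ℂ] (H × StrongDual ℂ H))

@[simp] theorem inlD_apply (f : H) : inlD H f = dsum f 0 := rfl
@[simp] theorem inrD_apply (φ : StrongDual ℂ H) : inrD H φ = dsum 0 φ := rfl
@[simp] theorem fstD_apply (F : Doubled H) : fstD H F = F.fst := rfl
@[simp] theorem sndD_apply (F : Doubled H) : sndD H F = F.snd := rfl

theorem dsum_fst_snd (F : Doubled H) : dsum F.fst F.snd = F := rfl

theorem dsum_add (f g : H) (φ χ : StrongDual ℂ H) :
    dsum f φ + dsum g χ = dsum (f + g) (φ + χ) := rfl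

theorem inner_doubled (F G : Doubled H) :
    ⟪F, G⟫_ℂ = ⟪F.fst, G.fst⟫_ℂ + ⟪F.snd, G.snd⟫_ℂ := WithLp.prod_inner_apply _ _

theorem inner_dual (φ χ : StrongDual ℂ H) : ⟪φ, χ⟫_ℂ = ⟪(J H).symm χ, (J H).symm φ⟫_ℂ := rfl

theorem calS_apply (F : Doubled H) : calS F = dsum F.fst (-F.snd) := by
  change dsum ((1 : H →L[ℂ] H) F.fst + (0 : StrongDual ℂ H →L[ℂ] H) F.snd)
    ((0 : H →L[ℂ] StrongDual ℂ H) F.fst + (-1 : StrongDual ℂ H →L[ℂ] StrongDual ℂ H) F.snd) = _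
  simp

theorem inner_calS (F G : Doubled H) :
    ⟪F, calS G⟫_ℂ = ⟪F.fst, G.fst⟫_ℂ - ⟪F.snd, G.snd⟫_ℂ := by
  rw [inner_doubled, calS_apply, sub_eq_add_neg]
  exact congrArg _ (inner_neg_right _ _)

theorem calS_calS (F : Doubled H) : calS (calS F) = F := by
  rw [calS_apply, calS_apply]
  change dsum F.fst (- -F.snd) = F
  rw [neg_neg]
  rfl

theorem calS_isSelfAdjoint : IsSelfAdjoint (calS : Doubled H →L[ℂ] Doubled H) := by
  rw [isSelfAdjoint_iff_isSymmetric]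
  intro F G
  change ⟪calS F, G⟫_ℂ = ⟪F, calS G⟫_ℂ
  rw [inner_calS, inner_doubled, calS_apply, sub_eq_add_neg]
  exact congrArg _ (inner_neg_left _ _)

theorem calJ_calJ (F : Doubled H) : calJ (calJ F) = F := by
  change dsum ((J H).symm (J H F.fst)) (J H ((J H).symm F.snd)) = F
  rw [LinearIsometryEquiv.symm_apply_apply, LinearIsometryEquiv.apply_symm_apply]
  rfl

theorem inner_calJ (F G : Doubled H) : ⟪calJ F, calJ G⟫_ℂ = ⟪G, F⟫_ℂ := by
  rw [inner_doubled, inner_doubled]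
  have h1 : ⟪(calJ F).fst, (calJ G).fst⟫_ℂ = ⟪G.snd, F.snd⟫_ℂ := rfl
  have h2 : ⟪(calJ F).snd, (calJ G).snd⟫_ℂ = ⟪G.fst, F.fst⟫_ℂ := by
    rw [inner_dual]
    simp [calJ]
  rw [h1, h2, add_comm]

theorem calJ_calS (F : Doubled H) : calJ (calS F) = -calS (calJ F) := by
  rw [calS_apply, calS_apply]
  change dsum _ _ = dsum _ _
  simp [calJ]

variable (H) in
/-- The conjugation `𝒥` as a bounded conjugate-linear map. -/
def calJL : Doubled H →L⋆[ℂ] Doubled H :=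
  LinearMap.mkContinuous
    { toFun := calJ
      map_add' := fun F G => by
        change dsum ((J H).symm (F.snd + G.snd)) (J H (F.fst + G.fst)) = _
        rw [map_add, map_add]
        rfl
      map_smul' := fun c F => by
        change dsum ((J H).symm (c • F.snd)) (J H (c • F.fst)) = _
        rw [LinearIsometryEquiv.map_smulₛₗ, LinearIsometryEquiv.map_smulₛₗ]
        rfl } 1 fun F => by
    change ‖calJ F‖ ≤ _
    rw [@norm_eq_sqrt_re_inner ℂ, inner_calJ, ← @norm_eq_sqrt_re_inner ℂ, one_mul]

theorem calJL_apply (F : Doubled H) : calJL H F = calJ F := rfl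

theorem calJ_add (F G : Doubled H) : calJ (F + G) = calJ F + calJ G := (calJL H).map_add F G

theorem calJ_sub (F G : Doubled H) : calJ (F - G) = calJ F - calJ G := (calJL H).map_sub F G

theorem calJ_smul (c : ℂ) (F : Doubled H) : calJ (c • F) = starRingEnd ℂ c • calJ F :=
  (calJL H).map_smulₛₗ c F

namespace IsBogoliubov

variable {V : Doubled H ≃L[ℂ] Doubled H}

theorem map_calJ (hV : IsBogoliubov V) (F : Doubled H) : V (calJ F) = calJ (V F) := by
  rw [← hV.conj F, calJ_calJ]

theorem inner_map (hV : IsBogoliubov V) (F G : Doubled H) :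
    ⟪V F, calS (V G)⟫_ℂ = ⟪F, calS G⟫_ℂ := by
  conv_rhs => rw [← hV.symplectic]
  exact (adjoint_inner_right (V : Doubled H →L[ℂ] Doubled H) F _).symm

theorem of_inner (h1 : ∀ F, V (calJ F) = calJ (V F))
    (h2 : ∀ F G, ⟪V F, calS (V G)⟫_ℂ = ⟪F, calS G⟫_ℂ) : IsBogoliubov V where
  conj F := by rw [h1, calJ_calJ]
  symplectic := by
    ext1 G
    refine ext_inner_left ℂ fun F => ?_
    rw [← h2]
    exact adjoint_inner_right (V : Doubled H →L[ℂ] Doubled H) F _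

theorem symm (hV : IsBogoliubov V) : IsBogoliubov V.symm := by
  refine of_inner (fun F => ?_) fun F G => ?_
  · rw [ContinuousLinearEquiv.symm_apply_eq, hV.map_calJ, ContinuousLinearEquiv.apply_symm_apply]
  · rw [← hV.inner_map, ContinuousLinearEquiv.apply_symm_apply,
      ContinuousLinearEquiv.apply_symm_apply]

end IsBogoliubov

end DoubledSpace

/-! ### Shale's criterion -/

section Shale

open ContinuousLinearMap

/-- The creation operators on the symmetric tensor powers of `H`. -/
def fockSystem (H : Type u) [NormedAddCommGroup H] [InnerProductSpace ℂ H] [CompleteSpace H] :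
    CreationSystem H fun n => SymPow H n where
  cr := create
  cr_add := create_add
  cr_smul := create_smul
  cr_comm := create_comm
  ccr_zero := annihilate_create_zero
  ccr_succ := annihilate_create_succ
  norm_sq_sum_cr_le n _ s f χ := norm_sq_sum_create_le n s f χ
  vac := symPure 0
  norm_vac := by
    have h : ⟪symPure (0 : Fin 0 → H), symPure 0⟫_ℂ = 1 := by
      rw [inner_symPure]
      simp
    have h2 : (‖symPure (0 : Fin 0 → H)‖ : ℂ) ^ 2 = 1 := by
      rw [← h]
      exact (inner_self_eq_norm_sq_to_K (𝕜 := ℂ) (symPure (0 : Fin 0 → H))).symm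
    have h3 : ‖symPure (0 : Fin 0 → H)‖ ^ 2 = 1 := by exact_mod_cast h2
    exact (pow_eq_one_iff_of_nonneg (norm_nonneg _) two_ne_zero).1 h3
  exists_smul_vac φ := by
    refine ⟨⟪symPure (0 : Fin 0 → H), φ⟫_ℂ, ?_⟩
    rw [← sub_eq_zero]
    refine eq_zero_of_inner_symPure fun x => ?_
    rw [Subsingleton.elim x 0, inner_sub_right, symPow_inner_smul_right, inner_symPure]
    simp
  eq_zero_of_an n φ h := by
    refine eq_zero_of_inner_symPure fun x => ?_
    have h1 := inner_annihilate_right n (x 0) φ (symPure (Fin.tail x))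
    rw [show annihilate n (x 0) φ = 0 from h (x 0), inner_zero_right, create_symPure,
      Fin.cons_self_tail, symPow_inner_smul_left] at h1
    refine (mul_eq_zero.1 h1.symm).resolve_left ?_
    rw [Complex.conj_ofReal, Complex.ofReal_eq_zero]
    positivity

variable {H : Type u} [NormedAddCommGroup H] [InnerProductSpace ℂ H] [CompleteSpace H]

/-- The graph of the field operator consists of the pairs related componentwise: square summability
of the components is then automatic. -/
theorem mem_graph_fieldOp (F : Doubled H) (ψ χ : Fock H) :
    (ψ, χ) ∈ (fieldOp F).graph ↔ ∀ n, (fockSystem H).fld F.fst ((J H).symm F.snd) ψ n = χ n := by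
  have key : ∀ n, fieldComponent F ψ n = (fockSystem H).fld F.fst ((J H).symm F.snd) ψ n := by
    intro n
    cases n <;> rfl
  rw [LinearPMap.mem_graph_iff]
  constructor
  · rintro ⟨y, hy, h⟩ n
    obtain rfl : (y : Fock H) = ψ := hy
    obtain rfl : fieldOp F y = χ := h
    exact (key n).symm
  · intro h
    have hm : Memℓp (fieldComponent F ψ) 2 := by
      have : fieldComponent F ψ = χ := funext fun n => (key n).trans (h n)
      rw [this]
      exact lp.memℓp χ
    exact ⟨⟨ψ, hm⟩, rfl, Subtype.ext (funext fun n => (key n).trans (h n))⟩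

theorem BogPair.norm_sq (p : BogPair H) (f : H) : ‖p.u f‖ ^ 2 = ‖f‖ ^ 2 + ‖p.v f‖ ^ 2 := by
  have h := p.inner_sub f f
  rw [inner_self_eq_norm_sq_to_K, inner_self_eq_norm_sq_to_K, inner_self_eq_norm_sq_to_K,
    sub_eq_iff_eq_add] at h
  exact_mod_cast h

/-- If `u` is invertible and `v` is Hilbert–Schmidt, the pair `(u, v)` has a vacuum, the squeezed
vacuum for `K = -v u⁻¹`. -/
theorem BogPair.exists_vacuum {G : ℕ → Type*} [∀ n, NormedAddCommGroup (G n)]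
    [∀ n, InnerProductSpace ℂ (G n)] [∀ n, CompleteSpace (G n)] (S : CreationSystem H G)
    (p : BogPair H) (w : H ≃L[ℂ] H) (hw : ∀ f, p.u f = w f)
    {F : Type*} [NormedAddCommGroup F] [InnerProductSpace ℂ F] [CompleteSpace F] {T : H →L[ℂ] F}
    (hT : IsHS T) (hTv : ∀ f, ‖T f‖ = ‖p.v f‖) :
    ∃ Ω, S.IsVacuum p Ω ∧ ‖CreationSystem.toLp G Ω‖ = 1 := by
  obtain ⟨s, e, -⟩ := exists_hilbertBasis ℂ H
  let K : H →L⋆[ℂ] H := -(p.v.comp (w.symm : H →L[ℂ] H))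
  have hK : ∀ f, K f = -p.v (w.symm f) := fun f => rfl
  let C : ℝ := ‖(w : H →L[ℂ] H)‖ + 1
  have hC : 1 ≤ C := by simp [C]
  have hC2 : 0 < (C ^ 2)⁻¹ := by positivity
  have hC1 : (C ^ 2)⁻¹ ≤ 1 := inv_le_one_of_one_le₀ (one_le_pow₀ hC)
  -- from `‖u g‖² = ‖g‖² + ‖v g‖²` and `‖u g‖ ≤ C ‖g‖`
  have hKn : ∀ f, ‖K f‖ ≤ Real.sqrt (1 - (C ^ 2)⁻¹) * ‖f‖ := fun f => by
    rw [hK, norm_neg]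
    refine (abs_le_of_sq_le_sq' ?_ (by positivity)).2
    rw [mul_pow, Real.sq_sqrt (by linarith)]
    have h1 := p.norm_sq (w.symm f)
    rw [hw, ContinuousLinearEquiv.apply_symm_apply] at h1
    have h2 : ‖f‖ ≤ C * ‖w.symm f‖ := by
      have := (w : H →L[ℂ] H).le_opNorm (w.symm f)
      rw [ContinuousLinearEquiv.coe_coe, ContinuousLinearEquiv.apply_symm_apply] at this
      refine this.trans ?_
      gcongr
      simp [C]
    have h3 : (C ^ 2)⁻¹ * ‖f‖ ^ 2 ≤ ‖w.symm f‖ ^ 2 := by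
      rw [inv_mul_le_iff₀ (by positivity), ← mul_pow]
      gcongr
    linarith
  have hKs : Summable fun i => ‖K (e i)‖ ^ 2 := by
    have h := (isHS_iff_summable e _).1 (hT.comp_clm (w.symm : H →L[ℂ] H))
    simpa [hK, hTv] using h
  have hsymm : ∀ f g, ⟪f, K g⟫_ℂ = ⟪g, K f⟫_ℂ := fun f g => by
    rw [hK, hK, inner_neg_right, inner_neg_right]
    have h := p.inner_symm (w.symm f) (w.symm g)
    rw [hw, hw, ContinuousLinearEquiv.apply_symm_apply,
      ContinuousLinearEquiv.apply_symm_apply] at h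
    rw [h]
  obtain ⟨Ω, hn, hΩ⟩ := S.exists_squeezed_vacuum e K (Real.sqrt_nonneg _)
    ((Real.sqrt_lt' one_pos).2 (by linarith)) hKn hKs hsymm
  refine ⟨Ω, fun f => Subtype.ext ?_, hn⟩
  have h := hΩ (w f)
  have hKf : K (w f) = -p.v f := by rw [hK, ContinuousLinearEquiv.symm_apply_apply]
  have hneg : S.crS (-p.v f) = -S.crS (p.v f) := by
    have h' := S.crS_smul (-1) (p.v f)
    rw [neg_one_smul] at h'
    exact h'.trans (LinearMap.ext fun _ => neg_one_smul ℂ _)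
  simp only [CreationSystem.bfld, map_zero, add_zero, CreationSystem.coe_fldD,
    CreationSystem.fld_apply, hw, h, hKf, hneg]
  exact neg_add_cancel _

variable {V : Doubled H ≃L[ℂ] Doubled H}

/-- The pair `(u, v)` of a Bogoliubov transformation, `V (f ⊕ 0) = u f ⊕ J (v f)`. -/
def IsBogoliubov.pair (hV : IsBogoliubov V) : BogPair H where
  u := fstD H ∘L (V : Doubled H →L[ℂ] Doubled H) ∘L inlD H
  v := ((J H).symm : StrongDual ℂ H →L⋆[ℂ] H).comp
    (sndD H ∘L (V : Doubled H →L[ℂ] Doubled H) ∘L inlD H)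
  inner_sub f g := by
    have h := hV.inner_map (dsum f 0) (dsum g 0)
    rw [inner_calS, inner_calS, inner_dual] at h
    simpa using h
  inner_symm f g := by
    have h := hV.inner_map (dsum f 0) (calJ (dsum g 0))
    rw [inner_calS, inner_calS, hV.map_calJ, inner_dual] at h
    simpa [calJ, sub_eq_zero] using h

theorem IsBogoliubov.pair_u (hV : IsBogoliubov V) (f : H) : hV.pair.u f = (V (dsum f 0)).fst := rfl

theorem IsBogoliubov.pair_v (hV : IsBogoliubov V) (f : H) :
    hV.pair.v f = (J H).symm (V (dsum f 0)).snd := rfl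

theorem IsBogoliubov.map_dsum (hV : IsBogoliubov V) (f g : H) :
    V (dsum f (J H g)) = dsum (hV.pair.u f + hV.pair.v g) (J H (hV.pair.v f + hV.pair.u g)) := by
  have h1 : dsum f (J H g) = dsum f 0 + calJ (dsum g 0) := by
    simp [calJ, dsum_add]
  rw [h1, map_add, hV.map_calJ, ← dsum_fst_snd (V (dsum f 0)), ← dsum_fst_snd (V (dsum g 0))]
  simp [calJ, dsum_add, hV.pair_u, hV.pair_v]

theorem IsBogoliubov.pair_comp (hV : IsBogoliubov V) (f : H) :
    hV.pair.u (hV.symm.pair.u f) + hV.pair.v (hV.symm.pair.v f) = f ∧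
      hV.pair.v (hV.symm.pair.u f) + hV.pair.u (hV.symm.pair.v f) = 0 := by
  have h := hV.map_dsum (hV.symm.pair.u f) (hV.symm.pair.v f)
  have h2 : dsum (hV.symm.pair.u f) (J H (hV.symm.pair.v f)) = V.symm (dsum f 0) := by
    rw [hV.symm.pair_u, hV.symm.pair_v, LinearIsometryEquiv.apply_symm_apply]
    rfl
  rw [h2, ContinuousLinearEquiv.apply_symm_apply] at h
  have h3 := congrArg WithLp.fst h
  have h4 := congrArg WithLp.snd h
  refine ⟨h3.symm, ?_⟩
  rw [← (J H).map_eq_zero_iff]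
  exact h4.symm

/-- The operator `u` of the inverse transformation is the adjoint of that of `V`. -/
theorem IsBogoliubov.inner_pair_u (hV : IsBogoliubov V) (f g : H) :
    ⟪hV.symm.pair.u f, g⟫_ℂ = ⟪f, hV.pair.u g⟫_ℂ := by
  have h := hV.inner_map (V.symm (dsum f 0)) (dsum g 0)
  rw [ContinuousLinearEquiv.apply_symm_apply, inner_calS, inner_calS] at h
  simpa [hV.pair_u, hV.symm.pair_u] using h.symm

/-- `u` is invertible: `u* u` and `u u*` are at least `1`, since `u*` is the corresponding operator
of the inverse transformation. -/
theorem IsBogoliubov.exists_equiv (hV : IsBogoliubov V) :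
    ∃ w : H ≃L[ℂ] H, ∀ f, hV.pair.u f = w f := by
  have key : ∀ p q : BogPair H, (∀ f g, ⟪q.u f, g⟫_ℂ = ⟪f, p.u g⟫_ℂ) → IsUnit (q.u * p.u) := by
    intro p q hpq
    refine isUnit_of_forall_le_norm_inner_map _ (c := 1) one_pos fun x => ?_
    rw [mul_apply_eq_comp, hpq, inner_self_eq_norm_sq_to_K, NNReal.coe_one, mul_one]
    have h := p.norm_sq x
    rw [norm_pow, RCLike.norm_ofReal, abs_norm, h]
    exact le_add_of_nonneg_right (by positivity)
  have h1 := isUnit_iff_bijective.1 (key hV.pair hV.symm.pair hV.inner_pair_u)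
  have h2 := isUnit_iff_bijective.1 (key hV.symm.pair hV.pair hV.symm.inner_pair_u)
  have hb : Function.Bijective hV.pair.u :=
    ⟨Function.Injective.of_comp (f := hV.symm.pair.u) h1.1,
      Function.Surjective.of_comp (g := hV.symm.pair.u) h2.2⟩
  exact ⟨ContinuousLinearEquiv.ofBijective hV.pair.u (LinearMap.ker_eq_bot.2 hb.1)
    (LinearMap.range_eq_top.2 hb.2), fun f => rfl⟩

/-- A Bogoliubov transformation with Hilbert–Schmidt off-diagonal part has a vacuum vector. -/
theorem IsBogoliubov.exists_vacuum (hV : IsBogoliubov V)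
    (hHS : IsHS (sndD H ∘L (V : Doubled H →L[ℂ] Doubled H) ∘L inlD H)) :
    ∃ Ω, (fockSystem H).IsVacuum hV.pair Ω ∧
      ‖CreationSystem.toLp (fun n => SymPow H n) Ω‖ = 1 := by
  obtain ⟨w, hw⟩ := hV.exists_equiv
  refine hV.pair.exists_vacuum _ w hw hHS fun f => ?_
  rw [hV.pair_v, LinearIsometryEquiv.norm_map]
  rfl

/-- A Bogoliubov transformation is unitarily implementable if its off-diagonal part and that of its
inverse are Hilbert–Schmidt. -/
theorem IsBogoliubov.unitarilyImplementable (hV : IsBogoliubov V)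
    (h1 : IsHS (sndD H ∘L (V : Doubled H →L[ℂ] Doubled H) ∘L inlD H))
    (h2 : IsHS (sndD H ∘L (V.symm : Doubled H →L[ℂ] Doubled H) ∘L inlD H)) :
    UnitarilyImplementable V := by
  obtain ⟨Ω, hΩ, hn⟩ := hV.exists_vacuum h1
  obtain ⟨Ω', hΩ', hn'⟩ := hV.symm.exists_vacuum h2
  obtain ⟨U, hU⟩ := (fockSystem H).exists_unitary hΩ hn hΩ' hn'
    (fun f => (hV.pair_comp f).1) (fun f => (hV.pair_comp f).2)
  refine ⟨U, fun F ψ χ => ?_⟩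
  have hF : F = dsum F.fst (J H ((J H).symm F.snd)) := by
    rw [LinearIsometryEquiv.apply_symm_apply]
    rfl
  rw [mem_graph_fieldOp, mem_graph_fieldOp, ← hU F.fst ((J H).symm F.snd) ψ χ]
  have hVF := hV.map_dsum F.fst ((J H).symm F.snd)
  rw [← hF] at hVF
  rw [hVF]
  change (∀ n, (fockSystem H).fld _ ((J H).symm (J H _)) (U ψ) n = U χ n) ↔ _
  rw [LinearIsometryEquiv.symm_apply_apply]
  rfl

end Shale

/-! ### Diagonalization of the one-particle density matrix -/

section Pdm

open ContinuousLinearMap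

theorem _root_.ContinuousLinearMap.IsPositive.exists_sqrt {E : Type*} [NormedAddCommGroup E]
    [InnerProductSpace ℂ E] [CompleteSpace E] {T : E →L[ℂ] E} (hT : T.IsPositive) :
    ∃ r : E →L[ℂ] E, r * r = T ∧ ∀ x, ((‖r x‖ ^ 2 : ℝ) : ℂ) = ⟪T x, x⟫_ℂ :=
  have hT' : 0 ≤ T := (nonneg_iff_isPositive T).2 hT
  ⟨CFC.sqrt T, CFC.sqrt_mul_sqrt_self T hT', norm_sq_sqrt_apply hT'⟩

theorem two_nsmul_add_sub_one_apply {E : Type*} [NormedAddCommGroup E] [InnerProductSpace ℂ E]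
    (A S : E →L[ℂ] E) (x : E) : (2 • A + S - 1 : E →L[ℂ] E) x = A x + A x + S x - x := by
  rw [two_nsmul]
  rfl

theorem smul_add_self {E : Type*} [NormedAddCommGroup E] [InnerProductSpace ℂ E] (c : ℂ) (x : E) :
    c • x + x = (c + 1) • x := by
  rw [add_smul, one_smul]

variable {H : Type u} [NormedAddCommGroup H] [InnerProductSpace ℂ H] [CompleteSpace H]

/-- The orthonormal basis `J bᵢ` of the dual. -/
theorem exists_dual_hilbertBasis {ι : Type*} (b : HilbertBasis ι ℂ H) :
    ∃ c : HilbertBasis ι ℂ (StrongDual ℂ H), ∀ i, c i = J H (b i) := by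
  have ho : Orthonormal ℂ fun i => J H (b i) := by
    refine ⟨fun i => ?_, fun i j hij => ?_⟩
    · rw [LinearIsometryEquiv.norm_map, b.orthonormal.1]
    · change ⟪J H (b i), J H (b j)⟫_ℂ = 0
      rw [inner_dual, LinearIsometryEquiv.symm_apply_apply, LinearIsometryEquiv.symm_apply_apply]
      exact b.orthonormal.2 hij.symm
  have hs : (Submodule.span ℂ (Set.range fun i => J H (b i)))ᗮ = ⊥ := by
    rw [Submodule.eq_bot_iff]
    intro φ hφ
    have hz : ∀ i, ⟪b i, (J H).symm φ⟫_ℂ = 0 := fun i => by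
      have h := (Submodule.mem_orthogonal _ _).1 hφ _ (Submodule.subset_span ⟨i, rfl⟩)
      rw [inner_dual, LinearIsometryEquiv.symm_apply_apply] at h
      rw [← inner_conj_symm, h, map_zero]
    have h2 := tsum_enorm_inner_sq b ((J H).symm φ)
    rw [← (J H).symm.map_eq_zero_iff, ← enorm_eq_zero]
    simp only [hz, enorm_zero, ne_eq, OfNat.ofNat_ne_zero, not_false_eq_true, zero_pow,
      tsum_zero] at h2
    exact (pow_eq_zero_iff two_ne_zero).1 h2.symm
  exact ⟨HilbertBasis.mkOfOrthogonalEqBot ho hs, fun i =>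
    congrFun (HilbertBasis.coe_mkOfOrthogonalEqBot ho hs) i⟩

/-- An operator on `h ⊕ h*` commuting with `𝒥` is Hilbert–Schmidt if its restriction to `h` is. -/
theorem isHS_of_comp_inlD {T : Doubled H →L[ℂ] Doubled H} (hT : ∀ F, T (calJ F) = calJ (T F))
    (h : IsHS (T ∘L inlD H)) : IsHS T := by
  obtain ⟨w, b, -⟩ := exists_hilbertBasis ℂ H
  obtain ⟨c, hc⟩ := exists_dual_hilbertBasis b
  have h2 : IsHS (T ∘L inrD H) := by
    rw [isHS_iff_summable c]
    refine ((isHS_iff_summable b _).1 h).congr fun i => ?_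
    have e : inrD H (c i) = calJ (inlD H (b i)) := by
      simp [hc, calJ]
    have hn : ∀ F : Doubled H, ‖calJ F‖ = ‖F‖ := fun F => by
      rw [@norm_eq_sqrt_re_inner ℂ, inner_calJ, ← @norm_eq_sqrt_re_inner ℂ]
    rw [comp_apply, comp_apply, e, hT, hn]
  have e : T = (T ∘L inlD H) ∘L fstD H + (T ∘L inrD H) ∘L sndD H := by
    ext1 F
    change T F = T (dsum F.fst 0) + T (dsum 0 F.snd)
    rw [← map_add, dsum_add, add_zero, zero_add]
    rfl
  rw [e]
  exact (h.comp_clm _).add (h2.comp_clm _)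

theorem calS_dsum_zero (f : H) : calS (dsum f 0) = dsum f 0 := by
  rw [calS_apply]
  simp

theorem calJ_pdm (γ : H →L[ℂ] H) (α : StrongDual ℂ H →L[ℂ] H) (F : Doubled H) :
    calJ (pdm γ α (calJ F)) = pdm γ α F + calS F := by
  rw [← dsum_fst_snd F, calS_apply]
  simp only [calJ, pdm, block_dsum, conjOffDiag, conjDiag]
  rw [dsum_add]
  change dsum ((J H).symm (J H (α (J H ((J H).symm F.snd))) +
      (J H F.fst + J H (γ ((J H).symm (J H F.fst))))))
      (J H (γ ((J H).symm F.snd) + α (J H F.fst))) =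
    dsum (γ F.fst + α F.snd + F.fst) (J H (α (J H F.fst)) +
      (F.snd + J H (γ ((J H).symm F.snd))) + -F.snd)
  simp only [map_add, LinearIsometryEquiv.symm_apply_apply, LinearIsometryEquiv.apply_symm_apply]
  exact congrArg₂ dsum (by abel) (by abel)

/-- If `γ` is trace class, then `r = √Γ` is Hilbert–Schmidt on the subspace `h`, for
`‖r (f ⊕ 0)‖² = ⟪f, γ f⟫`. -/
theorem isHS_sqrt_pdm {γ : H →L[ℂ] H} {α : StrongDual ℂ H →L[ℂ] H}
    (hγ : IsTraceClass γ) {r : Doubled H →L[ℂ] Doubled H}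
    (hr : ∀ F, ((‖r F‖ ^ 2 : ℝ) : ℂ) = ⟪pdm γ α F, F⟫_ℂ) : IsHS (r ∘L inlD H) := by
  have hin : ∀ f, ((‖r (dsum f 0)‖ ^ 2 : ℝ) : ℂ) = ⟪γ f, f⟫_ℂ := fun f => by
    rw [hr, pdm, block_dsum, inner_doubled]
    simp
  have hpos : 0 ≤ γ := by
    rw [nonneg_iff_isPositive, isPositive_iff_complex]
    intro f
    rw [← hin]
    have h0 : 0 ≤ ‖r (dsum f 0)‖ ^ 2 := sq_nonneg _
    generalize ‖r (dsum f 0)‖ ^ 2 = c at h0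
    exact ⟨by simp, by simpa using h0⟩
  obtain ⟨w, b, hb⟩ := hγ
  rw [CFC.abs_of_nonneg γ hpos] at hb
  rw [isHS_iff_summable b]
  refine (Complex.hasSum_re hb.hasSum).summable.congr fun i => ?_
  have h := hin (b i)
  rw [← inner_conj_symm, ← h, Complex.conj_ofReal, Complex.ofReal_re]
  rfl

/-- The Bogoliubov transformation `W ⊕ J W J*` induced by a unitary `W` of `h`. -/
def diagEquiv (W : H ≃ₗᵢ[ℂ] H) : Doubled H ≃L[ℂ] Doubled H :=
  ContinuousLinearEquiv.equivOfInverse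
    (block (W : H →L[ℂ] H) 0 0 (conjDiag (W : H →L[ℂ] H)))
    (block (W.symm : H →L[ℂ] H) 0 0 (conjDiag (W.symm : H →L[ℂ] H)))
    (fun F => by
      rw [← dsum_fst_snd F, block_dsum, block_dsum]
      simp [conjDiag])
    (fun F => by
      rw [← dsum_fst_snd F, block_dsum, block_dsum]
      simp [conjDiag])

theorem diagEquiv_dsum (W : H ≃ₗᵢ[ℂ] H) (f : H) (φ : StrongDual ℂ H) :
    diagEquiv W (dsum f φ) = dsum (W f) (J H (W ((J H).symm φ))) := by
  change block (W : H →L[ℂ] H) 0 0 (conjDiag (W : H →L[ℂ] H)) (dsum f φ) = _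
  rw [block_dsum]
  simp [conjDiag]

theorem diagEquiv_calJ (W : H ≃ₗᵢ[ℂ] H) (F : Doubled H) :
    diagEquiv W (calJ F) = calJ (diagEquiv W F) := by
  rw [← dsum_fst_snd F, diagEquiv_dsum, calJ, diagEquiv_dsum, calJ]
  simp

theorem inner_diagEquiv (W : H ≃ₗᵢ[ℂ] H) (F G : Doubled H) :
    ⟪diagEquiv W F, diagEquiv W G⟫_ℂ = ⟪F, G⟫_ℂ := by
  rw [← dsum_fst_snd F, ← dsum_fst_snd G, diagEquiv_dsum, diagEquiv_dsum, inner_doubled,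
    inner_doubled, inner_dual, inner_dual]
  simp

theorem diagEquiv_calS (W : H ≃ₗᵢ[ℂ] H) (F : Doubled H) :
    diagEquiv W (calS F) = calS (diagEquiv W F) := by
  rw [← dsum_fst_snd F, diagEquiv_dsum, calS_apply, calS_apply, diagEquiv_dsum]
  simp

/-- Some self-adjoint symplectic `v`, commuting with `𝒥` and differing from `1` by a
Hilbert–Schmidt operator, makes `v Γ v` block diagonal with compact upper left block `γ'`, whose quadratic form
is `‖r v f‖²` for the Hilbert–Schmidt operator `r v = √Γ v` on `h`. -/
theorem exists_block_diagonalization {γ : H →L[ℂ] H} {α : StrongDual ℂ H →L[ℂ] H}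
    (hΓ : (pdm γ α).IsPositive) (hγ : IsTraceClass γ) :
    ∃ v r : Doubled H →L[ℂ] Doubled H, ∃ γ' : H →L[ℂ] H,
      (∀ F G, ⟪v F, G⟫_ℂ = ⟪F, v G⟫_ℂ) ∧ (∀ F, v (calS (v F)) = calS F) ∧
      (∀ F, v (calJ F) = calJ (v F)) ∧ IsHS (v - 1) ∧
      (∀ f, v (pdm γ α (v (dsum f 0))) = dsum (γ' f) 0) ∧
      (∀ f, ((‖(r ∘L v ∘L inlD H) f‖ ^ 2 : ℝ) : ℂ) = ⟪γ' f, f⟫_ℂ) ∧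
      IsHS (r ∘L v ∘L inlD H) ∧ IsCompactOperator γ' := by
  obtain ⟨r, hrr, hr⟩ := hΓ.exists_sqrt
  have hrHS : IsHS (r ∘L inlD H) := isHS_sqrt_pdm hγ hr
  have hss : (calS * calS : Doubled H →L[ℂ] Doubled H) = 1 := ext fun F => calS_calS F
  have hjΓ := calJ_pdm γ α
  -- on `h`, the operator `2Γ + S - 1` is `2Γ = 2 r²`
  have hHS : IsHS (2 • pdm γ α + calS - 1) := by
    refine isHS_of_comp_inlD (fun F => ?_) ?_
    · have h1 : pdm γ α (calJ F) = calJ (pdm γ α F) + calJ (calS F) := by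
        rw [← calJ_add, ← hjΓ, calJ_calJ]
      have h2 : calS (calJ F) = -calJ (calS F) := by rw [calJ_calS, neg_neg]
      simp only [two_nsmul_add_sub_one_apply, h1, h2, calJ_sub, calJ_add]
      abel
    · have e : (2 • pdm γ α + calS - 1) ∘L inlD H = r ∘L r ∘L inlD H + r ∘L r ∘L inlD H := by
        ext1 f
        have h1 : r (r (dsum f 0)) = pdm γ α (dsum f 0) := by rw [← mul_apply_eq_comp, hrr]
        change (2 • pdm γ α + calS - 1 : Doubled H →L[ℂ] Doubled H) (dsum f 0) = r (r (dsum f 0)) + r (r (dsum f 0))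
        rw [two_nsmul_add_sub_one_apply, h1, calS_dsum_zero, add_sub_cancel_right]
      rw [e]
      exact (hrHS.clm_comp _).add (hrHS.clm_comp _)
  obtain ⟨v, hvsa, hvs, hvj, hcomm, hv1, hT⟩ :=
    exists_symplectic_diagonalization (j := calJL H) calS_isSelfAdjoint hss calJ_calJ inner_calJ
      calJ_calS ((nonneg_iff_isPositive _).2 hΓ) hjΓ hHS
  have hvin : ∀ F G, ⟪v F, G⟫_ℂ = ⟪F, v G⟫_ℂ := isSelfAdjoint_iff_isSymmetric.1 hvsa
  -- `f ⊕ 0` is fixed by `S`, hence so is its image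
  have hoff : ∀ f, ((v * pdm γ α * v) (dsum f 0)).snd = 0 := fun f => by
    have h := congrArg (fun T : Doubled H →L[ℂ] Doubled H => T (dsum f 0)) hcomm.eq
    have h2 := congrArg WithLp.snd h
    simp only [mul_apply_eq_comp, calS_dsum_zero] at h2
    rw [calS_apply] at h2
    have h3 := eq_neg_iff_add_eq_zero.1 h2
    rw [← two_smul ℂ] at h3
    exact (smul_eq_zero.1 h3).resolve_left two_ne_zero
  refine ⟨v, r, fstD H ∘L (v * pdm γ α * v) ∘L inlD H, hvin, fun F => ?_, fun F => ?_, hv1,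
    fun f => ?_, fun f => ?_, ?_, ?_⟩
  · exact congrArg (fun T : Doubled H →L[ℂ] Doubled H => T F) hvs
  · rw [← hvj, calJL_apply, calJL_apply, calJ_calJ]
  · rw [← dsum_fst_snd (v (pdm γ α (v (dsum f 0))))]
    exact congrArg (dsum _) (hoff f)
  · refine (hr _).trans ?_
    change ⟪pdm γ α (v (dsum f 0)), v (dsum f 0)⟫_ℂ = ⟪(v (pdm γ α (v (dsum f 0)))).fst, f⟫_ℂ
    rw [← hvin, inner_doubled]
    simp
  · have e : r ∘L v ∘L inlD H = r ∘L inlD H + r ∘L (v - 1) ∘L inlD H := by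
      ext1 f
      simp
    rw [e]
    exact hrHS.add ((hv1.comp_clm _).clm_comp _)
  · have e : fstD H ∘L (v * pdm γ α * v) ∘L inlD H =
        ((2⁻¹ : ℂ) • fstD H) ∘L (2 • (v * pdm γ α * v) + calS - 1) ∘L inlD H := by
      ext1 f
      change ((v * pdm γ α * v) (dsum f 0)).fst =
        (2⁻¹ : ℂ) • ((2 • (v * pdm γ α * v) + calS - 1 : Doubled H →L[ℂ] Doubled H) (dsum f 0)).fst
      rw [two_nsmul_add_sub_one_apply, calS_dsum_zero, add_sub_cancel_right, WithLp.add_fst,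
        ← two_smul ℂ, smul_smul, inv_mul_cancel₀ two_ne_zero, one_smul]
    rw [e]
    exact ((hT.comp_clm _).clm_comp _).isCompactOperator

/-- The transformation is `v (W ⊕ J W J*)`, where `W` maps the given basis to an eigenbasis of the
upper left block `γ'` of `v Γ v`. -/
theorem exists_diagonalization [TopologicalSpace.SeparableSpace H]
    {γ : H →L[ℂ] H} {α : StrongDual ℂ H →L[ℂ] H}
    (hΓ : (pdm γ α).IsPositive) (hγ : IsTraceClass γ) {ι : Type*} (u : HilbertBasis ι ℂ H) :
    ∃ V : Doubled H ≃L[ℂ] Doubled H, IsBogoliubov V ∧ UnitarilyImplementable V ∧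
      ∃ lam : ι → ℝ,
        (∀ n, adjoint (V : Doubled H →L[ℂ] Doubled H) (pdm γ α (V (dsum (u n) 0))) =
          (lam n : ℂ) • dsum (u n) 0) ∧
        (∀ n, adjoint (V : Doubled H →L[ℂ] Doubled H) (pdm γ α (V (dsum 0 (J H (u n))))) =
          ((1 + lam n : ℝ) : ℂ) • dsum 0 (J H (u n))) ∧
        (∀ n, 0 ≤ lam n) ∧ Summable lam := by
  obtain ⟨v, r, γ', hvin, hvs, hvj, hv1, hγ', hr, hrHS, hc⟩ := exists_block_diagonalization hΓ hγ
  have hsymm : (γ' : H →ₗ[ℂ] H).IsSymmetric := fun f g => by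
    have h : ⟪dsum (γ' f) 0, dsum g 0⟫_ℂ = ⟪dsum f 0, dsum (γ' g) 0⟫_ℂ := by
      rw [← hγ', ← hγ', hvin, ← hvin (dsum f 0)]
      exact (isSelfAdjoint_iff_isSymmetric.1 hΓ.isSelfAdjoint) _ _
    simpa [inner_doubled] using h
  obtain ⟨e, μ, hμ⟩ := exists_eigenbasis u hc hsymm
  let lam : ι → ℝ := fun n => ‖(r ∘L v ∘L inlD H) (e n)‖ ^ 2
  have hlam : ∀ n, γ' (e n) = (lam n : ℂ) • e n := fun n => by
    have h := hr (e n)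
    have hen : ⟪e n, e n⟫_ℂ = 1 := by
      rw [inner_self_eq_norm_sq_to_K, e.orthonormal.1]
      simp
    rw [hμ, inner_smul_left, hen, mul_one] at h
    rw [hμ, show (lam n : ℂ) = _ from h, ← Complex.conj_conj (μ n), ← h, Complex.conj_ofReal,
      Complex.conj_ofReal]
  let W : H ≃ₗᵢ[ℂ] H := u.repr.trans e.repr.symm
  have hW : ∀ n, W (u n) = e n := fun n => by
    classical
    rw [LinearIsometryEquiv.trans_apply, HilbertBasis.repr_self, HilbertBasis.repr_symm_single]
  let vE : Doubled H ≃L[ℂ] Doubled H :=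
    ContinuousLinearEquiv.equivOfInverse v (calS ∘L v ∘L calS)
      (fun F => by
        change calS (v (calS (v F))) = F
        rw [hvs, calS_calS])
      (fun F => by
        change v (calS (v (calS F))) = F
        rw [hvs, calS_calS])
  let V : Doubled H ≃L[ℂ] Doubled H := (diagEquiv W).trans vE
  have hVapp : ∀ F, V F = v (diagEquiv W F) := fun F => rfl
  have hVsymm : ∀ F, V.symm F = diagEquiv W.symm (calS (v (calS F))) := fun F => rfl
  have hV : IsBogoliubov V := by
    refine .of_inner (fun F => ?_) fun F G => ?_
    · rw [hVapp, hVapp, diagEquiv_calJ, hvj]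
    · rw [hVapp, hVapp, hvin, hvs, ← diagEquiv_calS, inner_diagEquiv]
  have hoff : IsHS (sndD H ∘L (v - 1) ∘L inlD H) := (hv1.comp_clm _).clm_comp _
  have himp : UnitarilyImplementable V := by
    refine hV.unitarilyImplementable ?_ ?_
    · have e1 : sndD H ∘L (V : Doubled H →L[ℂ] Doubled H) ∘L inlD H =
          (sndD H ∘L (v - 1) ∘L inlD H) ∘L (W : H →L[ℂ] H) := by
        ext1 f
        change (v (diagEquiv W (dsum f 0))).snd = (v (dsum (W f) 0) - dsum (W f) 0).snd
        rw [diagEquiv_dsum, map_zero, map_zero, map_zero]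
        simp
      rw [e1]
      exact hoff.comp_clm _
    · have e1 : sndD H ∘L (V.symm : Doubled H →L[ℂ] Doubled H) ∘L inlD H =
          -(conjDiag (W.symm : H →L[ℂ] H) ∘L (sndD H ∘L (v - 1) ∘L inlD H)) := by
        ext1 f
        change (diagEquiv W.symm (calS (v (calS (dsum f 0))))).snd =
          -J H (W.symm ((J H).symm (v (dsum f 0) - dsum f 0).snd))
        rw [calS_dsum_zero, calS_apply, diagEquiv_dsum]
        simp
      rw [e1]
      exact (hoff.clm_comp _).neg
  -- an eigenvector of `v Γ v` is transported to one of `V* Γ V` by the unitary `W ⊕ J W J*`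
  have key : ∀ (F : Doubled H) (c : ℂ),
      v (pdm γ α (v (diagEquiv W F))) = c • diagEquiv W F →
      adjoint (V : Doubled H →L[ℂ] Doubled H) (pdm γ α (V F)) = c • F := fun F c h => by
    refine ext_inner_left ℂ fun G => ?_
    rw [adjoint_inner_right, ContinuousLinearEquiv.coe_coe, hVapp, hVapp, hvin, h, ← map_smul,
      inner_diagEquiv]
  have h1 : ∀ n, v (pdm γ α (v (dsum (e n) 0))) = (lam n : ℂ) • dsum (e n) 0 := fun n => by
    rw [hγ', hlam]
    exact (inlD H).map_smul _ _
  refine ⟨V, hV, himp, lam, fun n => key _ _ ?_, fun n => key _ _ ?_, fun n => sq_nonneg _,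
    (isHS_iff_summable e _).1 hrHS⟩
  · rw [diagEquiv_dsum, hW]
    simpa using h1 n
  · rw [diagEquiv_dsum, LinearIsometryEquiv.symm_apply_apply, hW, map_zero]
    have h2 : dsum 0 (J H (e n)) = calJ (dsum (e n) 0) := by simp [calJ]
    -- the lower right block is conjugate to the upper left one, shifted by `j Γ j = Γ + S`
    have h3 : ∀ F, pdm γ α (calJ F) = calJ (pdm γ α F) + calJ (calS F) := fun F => by
      rw [← calJ_add, ← calJ_pdm, calJ_calJ]
    rw [h2, hvj, h3, map_add, hvj, hvj, h1, hvs, calS_dsum_zero, calJ_smul,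
      Complex.conj_ofReal, Complex.ofReal_add, Complex.ofReal_one, add_comm (1 : ℂ)]
    exact smul_add_self _ _

end Pdm

end

end BoseFock

theorem mainTheorem3 {H : Type*} [NormedAddCommGroup H] [InnerProductSpace ℂ H] [CompleteSpace H]
    [TopologicalSpace.SeparableSpace H]
    (γ : H →L[ℂ] H) (α : StrongDual ℂ H →L[ℂ] H)
    (hΓ : (BoseFock.pdm γ α).IsPositive) (hγ : BoseFock.IsTraceClass γ)
    {ι : Type*} (u : HilbertBasis ι ℂ H) :
    ∃ V : BoseFock.Doubled H ≃L[ℂ] BoseFock.Doubled H,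
      BoseFock.IsBogoliubov V ∧ BoseFock.UnitarilyImplementable V ∧
      ∃ lam : ι → ℝ,
        (∀ n, (ContinuousLinearMap.adjoint (V : BoseFock.Doubled H →L[ℂ] BoseFock.Doubled H))
            (BoseFock.pdm γ α (V (BoseFock.dsum (u n) 0))) =
          (lam n : ℂ) • BoseFock.dsum (u n) 0) ∧
        (∀ n, (ContinuousLinearMap.adjoint (V : BoseFock.Doubled H →L[ℂ] BoseFock.Doubled H))
            (BoseFock.pdm γ α (V (BoseFock.dsum 0 (BoseFock.J H (u n))))) =
          ((1 + lam n : ℝ) : ℂ) • BoseFock.dsum 0 (BoseFock.J H (u n))) ∧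
        (∀ n, 0 ≤ lam n) ∧ Summable lam :=
  BoseFock.exists_diagonalization hΓ hγ u
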